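/- Let $G$ be a connected complex affine algebraic Poisson group with function algebra $F[G]$ and tangent Lie bialgebra $\mathfrak g$, and let $G^*$ be a fixed Poisson dual of $G$: a connected complex affine algebraic Poisson group whose tangent Lie bialgebra is identified with the dual Lie bialgebra $\mathfrak g^*$. Identify $G$, $G^*$ with their groups of complex points, with the classical topology. For a subgroup $H$, closed or not, let $\mathrm{Lie}(H)=\{x : \exp(tx)\in H \text{ for all } t\in\mathbb C\}$, let $\mathcal I(H)$ be the ideal of regular functions vanishing on $H$, and call $H$ coisotropic if $\mathcal I(H)$ is closed under the Poisson bracket. A connected Lie subgroup is a connected subgroup, not necessarily closed, that is generated by $\exp(\mathrm{Lie}(H))$. A Lie coideal is a subspace $\mathfrak c$ with $\delta(\mathfrak c)\subseteq \mathfrak c\wedge\mathfrak g$, where $\delta$ is the cobracket. Let $K$ be a Zariski closed subgroup of $G$, $\mathfrak k=\mathrm{Lie}(K)$, and let $\mathfrak k^\perp\subseteq\mathfrak g^*$ be its orthogonal. Let $K^{\langle\perp\rangle}$ be the subgroup of $G^*$ generated by $\exp(\mathfrak k^\perp)$; apply the same construction, with the roles of $G$ and $G^*$ exchanged, to define $(K^{\langle\perp\rangle})^{\langle\perp\rangle}\subseteq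 G$. The complementary dual of a closed coisotropic subgroup $C$ of $G$ is the unique connected Lie subgroup $C^\perp$ of $G^*$ with $\mathrm{Lie}(C^\perp)=\mathrm{Lie}(C)^\perp$. The coisotropic interior $\overset{\circ}{K}$ of $K$ is the largest Zariski closed, connected, coisotropic subgroup of $G$ contained in $K$. Then: (a) $\mathrm{Lie}(K^{\langle\perp\rangle})$ is the Lie subalgebra of $\mathfrak g^*$ generated by $\mathfrak k^\perp$. (b) $\mathrm{Lie}(K^{\langle\perp\rangle})$ is a Lie coideal of $\mathfrak g^*$, and $K^{\langle\perp\rangle}$ is a coisotropic subgroup of $G^*$. (c) The coisotropic interior $\overset{\circ}{K}$ exists, its complementary dual exists, and $K^{\langle\perp\rangle}=(\overset{\circ}{K})^\perp$. In particular, if $K$ is coisotropic, then $K^\perp$ exists and $K^{\langle\perp\rangle}=K^\perp$. (d) $(K^{\langle\perp\rangle})^{\langle\perp\rangle}=\overset{\circ}{K}$. If $K$ is coisotropic, then $(K^{\langle\perp\rangle})^{\langle\perp\rangle}$ is the identity component of $K$. Moreover $(K^{\langle\perp\rangle})^{\langle\perp\rangle}=K$ if and only if $K$ is coisotropic and connected;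 thus a connected $K$ is coisotropic if and only if $(K^{\langle\perp\rangle})^{\langle\perp\rangle}=K$. -/

import Mathlib

open scoped TensorProduct

noncomputable section

namespace PoissonGroup

universe u v

/-! ### Complex affine algebraic groups

A connected complex affine algebraic group `G` is given by its Hopf algebra `A = F[G]` of regular
functions: a commutative Hopf algebra over `ℂ` which is finitely generated and a domain. -/

section AlgebraicGroup

variable (A : Type u) [CommRing A] [HopfAlgebra ℂ A]

/-- The group `G(ℂ)` of points of the algebraic group with function algebra `A`; the product is
`(g * h) f = ∑ g f₍₁₎ * h f₍₂₎`. -/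
abbrev Points : Type u := WithConv (A →ₐ[ℂ] ℂ)

/-- The classical topology on `G(ℂ)`: the coarsest one for which all regular functions are
continuous (for a closed embedding `G ⊆ ℂⁿ` it is the subspace topology). -/
instance pointsTopology : TopologicalSpace (Points A) :=
  TopologicalSpace.induced (fun (g : Points A) (f : A) => g f) inferInstance

/-- The convolution algebra dual to the coalgebra `A`. -/
abbrev ConvDual : Type u := WithConv (A →ₗ[ℂ] ℂ)

instance convDualLieRing : LieRing (ConvDual A) := LieRing.ofAssociativeRing

instance convDualLieAlgebra : LieAlgebra ℂ (ConvDual A) := LieAlgebra.ofAssociativeAlgebra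

variable {A}

/-- The functional `x ⊗ y` on `A ⊗ A`. -/
def tensorFun (x y : A →ₗ[ℂ] ℂ) : A ⊗[ℂ] A →ₗ[ℂ] ℂ :=
  LinearMap.mul' ℂ ℂ ∘ₗ TensorProduct.map x y

@[simp] theorem tensorFun_tmul (x y : A →ₗ[ℂ] ℂ) (a b : A) :
    tensorFun x y (a ⊗ₜ[ℂ] b) = x a * y b := rfl

theorem tensorFun_counit_right (x : A →ₗ[ℂ] ℂ) (a : A) :
    tensorFun x Coalgebra.counit (Coalgebra.comul (R := ℂ) a) = x a := by
  have h : ∀ T : A ⊗[ℂ] A, tensorFun x Coalgebra.counit T =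
      LinearMap.mul' ℂ ℂ (TensorProduct.map x LinearMap.id
        (LinearMap.lTensor A (Coalgebra.counit (R := ℂ)) T)) := by
    intro T
    induction T with
    | zero => simp
    | tmul a b => simp
    | add s t hs ht => simp only [map_add, hs, ht]
  rw [h, Coalgebra.lTensor_counit_comul]
  simp

theorem tensorFun_counit_left (x : A →ₗ[ℂ] ℂ) (a : A) :
    tensorFun Coalgebra.counit x (Coalgebra.comul (R := ℂ) a) = x a := by
  have h : ∀ T : A ⊗[ℂ] A, tensorFun Coalgebra.counit x T =
      LinearMap.mul' ℂ ℂ (TensorProduct.map LinearMap.id x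
        (LinearMap.rTensor A (Coalgebra.counit (R := ℂ)) T)) := by
    intro T
    induction T with
    | zero => simp
    | tmul a b => simp
    | add s t hs ht => simp only [map_add, hs, ht]
  rw [h, Coalgebra.rTensor_counit_comul]
  simp

/-- `x : A → ℂ` is a derivation at the unit element. -/
def IsPointDerivation (x : A →ₗ[ℂ] ℂ) : Prop :=
  ∀ f g : A, x (f * g) = x f * Coalgebra.counit (R := ℂ) g + Coalgebra.counit (R := ℂ) f * x g

theorem tensorFun_mul {x y : A →ₗ[ℂ] ℂ} (hx : IsPointDerivation x) (hy : IsPointDerivation y)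
    (S T : A ⊗[ℂ] A) :
    tensorFun x y (S * T) =
      tensorFun x y S * tensorFun Coalgebra.counit Coalgebra.counit T
      + tensorFun x Coalgebra.counit S * tensorFun Coalgebra.counit y T
      + tensorFun Coalgebra.counit y S * tensorFun x Coalgebra.counit T
      + tensorFun Coalgebra.counit Coalgebra.counit S * tensorFun x y T := by
  induction S with
  | zero => simp
  | add s t hs ht => simp only [add_mul, map_add, hs, ht]; ring
  | tmul a b =>
    induction T with
    | zero => simp
    | add s t hs ht => simp only [mul_add, map_add, hs, ht]; ring
    | tmul c d =>
      simp only [Algebra.TensorProduct.tmul_mul_tmul, tensorFun_tmul, hx a c, hy b d]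
      ring

theorem convMul_apply (x y : ConvDual A) (f : A) :
    (x * y) f = tensorFun x.ofConv y.ofConv (Coalgebra.comul (R := ℂ) f) := rfl

theorem isPointDerivation_lie {x y : ConvDual A} (hx : IsPointDerivation x.ofConv)
    (hy : IsPointDerivation y.ofConv) : IsPointDerivation (⁅x, y⁆ : ConvDual A).ofConv := by
  intro f g
  have hl : ∀ a : A, (⁅x, y⁆ : ConvDual A) a =
      tensorFun x.ofConv y.ofConv (Coalgebra.comul (R := ℂ) a)
      - tensorFun y.ofConv x.ofConv (Coalgebra.comul (R := ℂ) a) := fun a => rfl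
  rw [hl, hl, hl, Bialgebra.comul_mul, tensorFun_mul hx hy, tensorFun_mul hy hx]
  simp only [tensorFun_counit_left, tensorFun_counit_right]
  ring

variable (A) in
/-- The tangent Lie algebra `𝔤 = Lie(G)`: the derivations `A → ℂ` at the unit element, with the
commutator of the convolution product as bracket. -/
def tangent : LieSubalgebra ℂ (ConvDual A) where
  carrier := {x | IsPointDerivation x.ofConv}
  add_mem' := by
    intro x y hx hy f g
    simp only [WithConv.ofConv_add, LinearMap.add_apply, hx f g, hy f g]
    ring
  zero_mem' := by
    intro f g
    simp
  smul_mem' := by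
    intro c x hx f g
    simp only [WithConv.ofConv_smul, LinearMap.smul_apply, hx f g, smul_eq_mul]
    ring
  lie_mem' := fun hx hy => isPointDerivation_lie hx hy

/-- The differential at the unit element of a regular function, as a functional on `𝔤`. -/
def diff (a : A) : tangent A →ₗ[ℂ] ℂ where
  toFun x := x.1 a
  map_add' _ _ := rfl
  map_smul' _ _ := rfl

theorem diff_apply (a : A) (x : tangent A) : diff a x = x.1 a := rfl

/-- `g = exp x`, where `x ∈ 𝔤` acts on functions through its convolution powers (that is, as a
left invariant differential operator evaluated at the unit element):
`g f = ∑ₙ xⁿ(f) / n!` for all `f ∈ F[G]`. -/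
def IsExp (x : tangent A) (g : Points A) : Prop :=
  ∀ f : A, HasSum (fun n : ℕ => ((n.factorial : ℂ))⁻¹ * ((x : ConvDual A) ^ n) f) (g f)

/-- The set `exp S` for a subset `S` of `𝔤`. -/
def expSet (S : Set (tangent A)) : Set (Points A) :=
  {g | ∃ x ∈ S, IsExp x g}

/-- The Lie algebra of a (not necessarily closed) subgroup `H` of `G`: all `x ∈ 𝔤` whose
one-parameter group `t ↦ exp (t x)` lies in `H`. For a Zariski closed subgroup these are the
`x ∈ 𝔤` which vanish on the ideal of `H`. -/
def lieAlg (H : Subgroup (Points A)) : Set (tangent A) :=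
  {x | ∀ t : ℂ, ∃ g ∈ H, IsExp (t • x) g}

/-- The ideal `𝓘(H)` of the regular functions that vanish on `H`. -/
def vanishingIdeal (H : Subgroup (Points A)) : Ideal A where
  carrier := {f | ∀ g ∈ H, g f = 0}
  add_mem' := by
    intro a b ha hb g hg
    rw [map_add, ha g hg, hb g hg, add_zero]
  zero_mem' := fun g _ => map_zero _
  smul_mem' := by
    intro c a ha g hg
    rw [smul_eq_mul, map_mul, ha g hg, mul_zero]

/-- `H` is Zariski closed, that is, an algebraic subgroup. -/
def IsZariskiClosed (H : Subgroup (Points A)) : Prop :=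
  ∀ g : Points A, (∀ f ∈ vanishingIdeal H, g f = 0) → g ∈ H

/-- `H` is a connected complex Lie subgroup of `G`, not necessarily closed: it is connected, and
generated by the one-parameter groups which it contains. -/
structure IsConnectedLieSubgroup (H : Subgroup (Points A)) : Prop where
  connected : IsConnected (H : Set (Points A))
  generated : Subgroup.closure (expSet (lieAlg H)) = H

end AlgebraicGroup

/-! ### Poisson groups -/

section Poisson

variable (A : Type u) [CommRing A] [HopfAlgebra ℂ A]

/-- A Poisson group structure on `G`: a Poisson bracket on `A = F[G]` for which the coproduct
`A → A ⊗ A` is a Poisson map, where `{a ⊗ b, c ⊗ d} = {a, c} ⊗ b d + a c ⊗ {b, d}`. -/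
structure PoissonStructure where
  /-- The Poisson bracket. -/
  br : A →ₗ[ℂ] A →ₗ[ℂ] A
  self_eq_zero : ∀ a, br a a = 0
  jacobi : ∀ a b c, br a (br b c) + br b (br c a) + br c (br a b) = 0
  leibniz : ∀ a b c, br a (b * c) = br a b * c + b * br a c
  comul_br : ∀ a b, Coalgebra.comul (R := ℂ) (br a b) =
    TensorProduct.map₂ br (LinearMap.mul ℂ A)
        (Coalgebra.comul (R := ℂ) a) (Coalgebra.comul (R := ℂ) b)
    + TensorProduct.map₂ (LinearMap.mul ℂ A) br
        (Coalgebra.comul (R := ℂ) a) (Coalgebra.comul (R := ℂ) b)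

variable {A}

namespace PoissonStructure

variable (P : PoissonStructure A)

theorem br_swap (a b : A) : P.br a b = - P.br b a := by
  have h := P.self_eq_zero (a + b)
  simp only [map_add, LinearMap.add_apply, P.self_eq_zero, zero_add, add_zero] at h
  exact eq_neg_of_add_eq_zero_right h

theorem leibniz_left (a b c : A) : P.br (a * b) c = P.br a c * b + a * P.br b c := by
  rw [P.br_swap, P.leibniz, P.br_swap a c, P.br_swap b c]
  ring

/-- The Poisson bracket vanishes at the unit element. -/
theorem counit_br (a b : A) : Coalgebra.counit (R := ℂ) (P.br a b) = 0 := by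
  let e : A →ₗ[ℂ] ℂ := Coalgebra.counit
  let r : A ⊗[ℂ] A →ₗ[ℂ] A := (TensorProduct.rid ℂ A).toLinearMap ∘ₗ LinearMap.lTensor A e
  let l : A ⊗[ℂ] A →ₗ[ℂ] A := (TensorProduct.lid ℂ A).toLinearMap ∘ₗ LinearMap.rTensor A e
  have h1 : ∀ S T : A ⊗[ℂ] A,
      tensorFun e e (TensorProduct.map₂ P.br (LinearMap.mul ℂ A) S T) = e (P.br (r S) (r T)) := by
    intro S T
    induction S with
    | zero => simp
    | add s t hs ht => simp only [map_add, LinearMap.add_apply, hs, ht]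
    | tmul a b =>
      induction T with
      | zero => simp
      | add s t hs ht => simp only [map_add, hs, ht]
      | tmul c d =>
        simp [r, e]
        ring
  have h2 : ∀ S T : A ⊗[ℂ] A,
      tensorFun e e (TensorProduct.map₂ (LinearMap.mul ℂ A) P.br S T) = e (P.br (l S) (l T)) := by
    intro S T
    induction S with
    | zero => simp
    | add s t hs ht => simp only [map_add, LinearMap.add_apply, hs, ht]
    | tmul a b =>
      induction T with
      | zero => simp
      | add s t hs ht => simp only [map_add, hs, ht]
      | tmul c d =>
        simp [l, e]
        ring
  have hr : ∀ a : A, r (Coalgebra.comul (R := ℂ) a) = a := fun a => by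
    simp [r, e]
  have hl : ∀ a : A, l (Coalgebra.comul (R := ℂ) a) = a := fun a => by
    simp [l, e]
  have h := congrArg (tensorFun e e) (P.comul_br a b)
  rw [map_add, h1, h2, hr, hr, hl, hl, tensorFun_counit_right] at h
  have h' : e (P.br a b) = e (P.br a b) + e (P.br a b) := h
  exact left_eq_add.mp h'

/-- For `x ∈ 𝔤`, the functional `a ↦ x {a, b}` is in `𝔤` as well. -/
def brLeft (x : tangent A) (b : A) : tangent A :=
  ⟨WithConv.toConv (x.1.ofConv ∘ₗ P.br.flip b), by
    intro f g
    have h1 := x.2 (P.br f b) g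
    have h2 := x.2 f (P.br g b)
    have h : x.1.ofConv (P.br (f * g) b) = x.1.ofConv (P.br f b) * Coalgebra.counit (R := ℂ) g
        + Coalgebra.counit (R := ℂ) f * x.1.ofConv (P.br g b) := by
      rw [P.leibniz_left, map_add, h1, h2, P.counit_br, P.counit_br]
      ring
    exact h⟩

/-- For `x ∈ 𝔤`, the functional `b ↦ x {a, b}` is in `𝔤` as well. -/
def brRight (x : tangent A) (a : A) : tangent A :=
  ⟨WithConv.toConv (x.1.ofConv ∘ₗ P.br a), by
    intro f g
    have h1 := x.2 (P.br a f) g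
    have h2 := x.2 f (P.br a g)
    have h : x.1.ofConv (P.br a (f * g)) = x.1.ofConv (P.br a f) * Coalgebra.counit (R := ℂ) g
        + Coalgebra.counit (R := ℂ) f * x.1.ofConv (P.br a g) := by
      rw [P.leibniz, map_add, h1, h2, P.counit_br, P.counit_br]
      ring
    exact h⟩

/-- `H` is coisotropic: its ideal `𝓘(H)` is a Poisson subalgebra of `F[G]`. -/
def IsCoisotropic (H : Subgroup (Points A)) : Prop :=
  ∀ a ∈ vanishingIdeal H, ∀ b ∈ vanishingIdeal H, P.br a b ∈ vanishingIdeal H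

/-- `K₀` is the coisotropic interior of `K`: the largest closed, connected, coisotropic subgroup
of `G` which is contained in `K`. -/
def IsCoisotropicInterior (K K₀ : Subgroup (Points A)) : Prop :=
  IsGreatest {L : Subgroup (Points A) | IsZariskiClosed L ∧ IsConnected (L : Set (Points A)) ∧
    P.IsCoisotropic L ∧ L ≤ K} K₀

end PoissonStructure

theorem finite_tangent [Algebra.FiniteType ℂ A] : Module.Finite ℂ (tangent A) := by
  obtain ⟨s, hs⟩ := (inferInstance : Algebra.FiniteType ℂ A).out
  let φ : tangent A →ₗ[ℂ] (s → ℂ) := LinearMap.pi fun a => diff (a : A)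
  have hφ : Function.Injective φ := by
    rw [← LinearMap.ker_eq_bot, LinearMap.ker_eq_bot']
    intro x hx
    have key : ∀ a : A, x.1 a = 0 := by
      intro a
      have ha : a ∈ Algebra.adjoin ℂ (s : Set A) := by rw [hs]; trivial
      induction ha using Algebra.adjoin_induction with
      | mem b hb => exact congrFun hx ⟨b, hb⟩
      | algebraMap c =>
        have h1 : x.1.ofConv (1 * 1) = _ := x.2 1 1
        simp only [mul_one, Bialgebra.counit_one, one_mul] at h1
        have h2 : x.1.ofConv 1 = 0 := left_eq_add.mp h1
        rw [Algebra.algebraMap_eq_smul_one, map_smul, h2, smul_zero]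
      | add b c _ _ hb hc => rw [map_add, hb, hc, add_zero]
      | mul b c _ _ hb hc =>
        have h1 : x.1.ofConv (b * c) = _ := x.2 b c
        rw [h1, hb, hc, zero_mul, mul_zero, add_zero]
    apply Subtype.ext
    apply WithConv.ext
    exact LinearMap.ext key
  exact Module.Finite.of_injective φ hφ

theorem exists_diff_eq [Algebra.FiniteType ℂ A] (ξ : tangent A →ₗ[ℂ] ℂ) : ∃ a : A, diff a = ξ := by
  have := finite_tangent (A := A)
  let D : A →ₗ[ℂ] Module.Dual ℂ (tangent A) :=
    { toFun := diff
      map_add' := fun a b => LinearMap.ext fun x => map_add x.1.ofConv a b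
      map_smul' := fun c a => LinearMap.ext fun x => map_smul x.1.ofConv c a }
  have h : (LinearMap.range D).dualCoannihilator = ⊥ := by
    rw [eq_bot_iff]
    intro x hx
    rw [Submodule.mem_dualCoannihilator] at hx
    rw [Submodule.mem_bot]
    apply Subtype.ext
    apply WithConv.ext
    exact LinearMap.ext fun a => hx (D a) ⟨a, rfl⟩
  have h2 : LinearMap.range D = ⊤ := by
    rw [← Subspace.dualCoannihilator_dualAnnihilator_eq (W := LinearMap.range D), h,
      Submodule.dualAnnihilator_bot]
  have h3 : ξ ∈ LinearMap.range D := by rw [h2]; trivial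
  exact h3

namespace PoissonStructure

variable (P : PoissonStructure A) [Algebra.FiniteType ℂ A]

theorem existsUnique_cobracket : ∃! δ : tangent A →ₗ[ℂ] tangent A ⊗[ℂ] tangent A,
    ∀ (x : tangent A) (a b : A),
      LinearMap.mul' ℂ ℂ (TensorProduct.map (diff a) (diff b) (δ x)) = x.1 (P.br a b) := by
  have := finite_tangent (A := A)
  let e := Module.finBasis ℂ (tangent A)
  choose c hc using fun i => exists_diff_eq (e.coord i)
  refine ⟨∑ i, ∑ j, (diff (P.br (c i) (c j))).smulRight (e i ⊗ₜ[ℂ] e j), ?_, ?_⟩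
  · intro x a b
    have exp : ∀ (y : tangent A) (a : A), y.1 a = ∑ i, y.1 (c i) * (e i).1 a := by
      intro y a
      have h := congrArg (diff a) (e.sum_repr y)
      rw [map_sum] at h
      refine h.symm.trans (Finset.sum_congr rfl fun i _ => ?_)
      have h2 : y.1 (c i) = e.repr y i := LinearMap.congr_fun (hc i) y
      rw [map_smul, h2]
      rfl
    have h1 : x.1 (P.br a b) = ∑ i, x.1 (P.br (c i) b) * (e i).1 a := exp (P.brLeft x b) a
    have h2 : ∀ i, x.1 (P.br (c i) b) = ∑ j, x.1 (P.br (c i) (c j)) * (e j).1 b :=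
      fun i => exp (P.brRight x (c i)) b
    rw [h1]
    simp only [LinearMap.sum_apply, map_sum]
    refine Finset.sum_congr rfl fun i _ => ?_
    rw [h2, Finset.sum_mul]
    refine Finset.sum_congr rfl fun j _ => ?_
    simp only [LinearMap.smulRight_apply, map_smul, TensorProduct.map_tmul,
      LinearMap.mul'_apply, smul_eq_mul, diff_apply]
    ring
  · intro δ hδ
    have coord : ∀ (t : tangent A ⊗[ℂ] tangent A) i j, (e.tensorProduct e).repr t (i, j) =
        LinearMap.mul' ℂ ℂ (TensorProduct.map (diff (c i)) (diff (c j)) t) := by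
      intro t i j
      induction t with
      | zero => simp
      | add s t hs ht => simp only [map_add, Finsupp.add_apply, hs, ht]
      | tmul x y => simp [hc, mul_comm]
    refine LinearMap.ext fun x => (e.tensorProduct e).repr.injective (Finsupp.ext fun ⟨i, j⟩ => ?_)
    rw [coord, hδ]
    simp only [LinearMap.sum_apply, map_sum, Finsupp.coe_finsetSum, Finset.sum_apply,
      LinearMap.smulRight_apply, map_smul, Finsupp.smul_apply,
      Module.Basis.tensorProduct_repr_tmul_apply, Module.Basis.repr_self, smul_eq_mul]
    simp [Finsupp.single_apply, diff_apply]

/-- The Lie cobracket `δ : 𝔤 → 𝔤 ⊗ 𝔤` of the tangent Lie bialgebra: the linearization at the unit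
element of the Poisson bracket, `⟨δ x, da ⊗ db⟩ = x {a, b}` for all functions `a`, `b`. -/
def cobracket : tangent A →ₗ[ℂ] tangent A ⊗[ℂ] tangent A :=
  P.existsUnique_cobracket.choose

theorem cobracket_spec (x : tangent A) (a b : A) :
    LinearMap.mul' ℂ ℂ (TensorProduct.map (diff a) (diff b) (P.cobracket x)) = x.1 (P.br a b) :=
  P.existsUnique_cobracket.choose_spec.1 x a b

/-- `S ⊆ 𝔤` is a Lie coideal: `δ(S) ⊆ S ∧ 𝔤`. -/
def IsLieCoideal (S : Set (tangent A)) : Prop :=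
  ∀ x ∈ S, P.cobracket x ∈
    Submodule.span ℂ {t | ∃ s ∈ S, ∃ y : tangent A, t = s ⊗ₜ[ℂ] y - y ⊗ₜ[ℂ] s}

end PoissonStructure

end Poisson

/-! ### Poisson duality -/

section Duality

variable {A : Type u} [CommRing A] [HopfAlgebra ℂ A]
variable {B : Type v} [CommRing B] [HopfAlgebra ℂ B]

/-- The Poisson group with function algebra `B` is a Poisson dual `G*` of the Poisson group `G` with
function algebra `A`: its tangent Lie bialgebra is identified, through the perfect pairing `p`,
with the dual Lie bialgebra of `𝔤`, so that the bracket on either side is dual to the cobracket on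
the other. -/
structure IsPoissonDual [Algebra.FiniteType ℂ A] [Algebra.FiniteType ℂ B]
    (P : PoissonStructure A) (Q : PoissonStructure B)
    (p : tangent A →ₗ[ℂ] tangent B →ₗ[ℂ] ℂ) : Prop where
  perfect : p.IsPerfPair
  lie_right : ∀ (x : tangent A) (ξ η : tangent B), p x ⁅ξ, η⁆ =
    LinearMap.mul' ℂ ℂ (TensorProduct.map (p.flip ξ) (p.flip η) (P.cobracket x))
  lie_left : ∀ (x y : tangent A) (ξ : tangent B), p ⁅x, y⁆ ξ =
    LinearMap.mul' ℂ ℂ (TensorProduct.map (p x) (p y) (Q.cobracket ξ))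

/-- The orthogonal `S^⊥ ⊆ 𝔤*` of a subset `S` of `𝔤`. -/
def orthogonal (p : tangent A →ₗ[ℂ] tangent B →ₗ[ℂ] ℂ) (S : Set (tangent A)) : Set (tangent B) :=
  {ξ | ∀ x ∈ S, p x ξ = 0}

/-- `K^⟨⊥⟩`: the subgroup of `G*` generated by `exp (𝔨^⊥)`, where `𝔨 = Lie(K)`. -/
def perpGroup (p : tangent A →ₗ[ℂ] tangent B →ₗ[ℂ] ℂ) (K : Subgroup (Points A)) :
    Subgroup (Points B) :=
  Subgroup.closure (expSet (orthogonal p (lieAlg K)))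

/-- `L` is the complementary dual `K^⊥` of `K`: the connected Lie subgroup of `G*` with
`Lie(L) = 𝔨^⊥`. -/
def IsComplementaryDual (p : tangent A →ₗ[ℂ] tangent B →ₗ[ℂ] ℂ) (K : Subgroup (Points A))
    (L : Subgroup (Points B)) : Prop :=
  IsConnectedLieSubgroup L ∧ lieAlg L = orthogonal p (lieAlg K)

end Duality

end PoissonGroup

end

/-!
The Lie algebra of a subgroup `H`, closed or not, is a Lie subalgebra, and the group generated by
`exp V`, for a cone `V`, has no more one-parameter groups than those of the Lie algebra generated by
`V` (`lieAlg_closure_expSet`). Both facts are local and are proved in a faithful representation by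
matrices: products of exponentials of a basis of a Lie algebra `h` parametrize a leaf of the
foliation by translates of `h` (`exists_leaf_chart`), so that small words in exponentials can be
rewritten in any basis; and a one-parameter group inside the group generated by `exp h` stays in
one leaf for some time, by Baire's theorem, and hence is tangent to `h`
(`mem_of_exp_smul_mem_closure`). This gives the description of the Lie algebra of the dual of `K`.

The Poisson bracket is not invariant under translations, but a left invariant vector field `x` fails
to be a derivation of it exactly by the left invariant bivector field of the cobracket of `x`
(`rightTr_br`). Evaluation at the unit gives the cocycle identity (`lie_br`), which implies that a Lie
coideal generates a Lie algebra that is a Lie coideal (`isLieCoideal_lieSpan`). If `x` runs through a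
Lie coideal, the vector fields `x` preserve the space spanned by the ideal of the generated group and
the Poisson brackets of its elements; the functions in this space vanish at the unit, hence, by
integration, on the whole group, which is therefore coisotropic (`isCoisotropic_closure_expSet`).

Since the cobracket of one Lie bialgebra is dual to the bracket of the other one, orthogonality
exchanges Lie subalgebras and Lie coideals. The orthogonal of `Lie K` is a Lie coideal, the Lie
algebra that it generates is one as well, and so the Lie algebra of the double dual of `K` is the
largest subspace of `Lie K` that is both a Lie subalgebra and a Lie coideal
(`subset_orthogonal_lieAlg_perpGroup`). Zariski closed coisotropic subgroups of `K` have such Lie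
algebras, and by Cartan's theorem (`eventually_exists_isExp`) connected Zariski closed subgroups are
generated by the exponentials of their Lie algebras; so all of those that are contained in `K` are
contained in the double dual.

It remains to see that the double dual is Zariski closed. Its Zariski closure `L` is coisotropic and
contained in `K`, so it has the same Lie algebra. It suffices that the group `M` generated by
`exp (Lie L)` is Zariski closed (`isZariskiClosed_closure_expSet_lieAlg`). Regular functions restrict
to exponential polynomials on one-parameter groups (`exists_expPoly_lift`). Hence the words in the
exponentials of a basis of `Lie L` are among the points of a torus times an affine space, under a
morphism to `G` that is dominant to the Zariski closure of `M` and takes all its values in `M`, because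
`L` is closed and these points can be joined to the unit by scaling logarithms. By Chevalley's theorem
`M` contains a nonempty Zariski open subset of its Zariski closure, and a subgroup with this property
is Zariski closed.
-/

open scoped TensorProduct

noncomputable section

namespace PoissonGroup

universe u v

/-! ### Products of exponentials in a Banach algebra -/

section LieSubspace

open NormedSpace Filter Topology Set

variable {E : Type*} [NormedRing E] [NormedAlgebra ℂ E]

/-- The product `exp (t₁ w₁) ⋯ exp (tₖ wₖ)`. -/
def expWord {k : ℕ} (w : Fin k → E) (t : Fin k → ℂ) : E :=
  (List.ofFn fun i => exp (t i • w i)).prod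

theorem expWord_zero (w : Fin 0 → E) (t : Fin 0 → ℂ) : expWord w t = 1 := by
  simp [expWord]

theorem expWord_succ {k : ℕ} (w : Fin (k + 1) → E) (t : Fin (k + 1) → ℂ) :
    expWord w t = exp (t 0 • w 0) * expWord (fun i => w i.succ) (fun i => t i.succ) := by
  simp [expWord, List.ofFn_succ]

theorem expWord_mem {k : ℕ} {S : Submonoid E} {w : Fin k → E} {t : Fin k → ℂ}
    (h : ∀ i, exp (t i • w i) ∈ S) : expWord w t ∈ S := by
  refine Submonoid.list_prod_mem _ fun x hx => ?_
  obtain ⟨i, rfl⟩ := (List.mem_ofFn' _ _).1 hx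
  exact h i

variable [CompleteSpace E]

theorem exp_mul_exp_neg (x : E) : exp x * exp (-x) = 1 := by
  let _ : NormedAlgebra ℚ E := NormedAlgebra.restrictScalars ℚ ℂ E
  rw [← exp_add_of_commute (Commute.refl x).neg_right, add_neg_cancel, exp_zero]

theorem exp_neg_mul_exp (x : E) : exp (-x) * exp x = 1 := by
  simpa using exp_mul_exp_neg (-x)

theorem exp_add_smul (x : E) (s t : ℂ) : exp ((s + t) • x) = exp (s • x) * exp (t • x) := by
  let _ : NormedAlgebra ℚ E := NormedAlgebra.restrictScalars ℚ ℂ E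
  rw [add_smul, exp_add_of_commute]
  exact ((Commute.refl x).smul_left s).smul_right t

theorem exp_natCast_smul (x : E) (n : ℕ) : exp ((n : ℂ) • x) = exp x ^ n := by
  let _ : NormedAlgebra ℚ E := NormedAlgebra.restrictScalars ℚ ℂ E
  rw [Nat.cast_smul_eq_nsmul, exp_nsmul]

theorem exp_conj_eq {a b : E} (hab : a * b = 1) (hba : b * a = 1) (x : E) :
    exp (a * x * b) = a * exp x * b := by
  let _ : NormedAlgebra ℚ E := NormedAlgebra.restrictScalars ℚ ℂ E
  exact exp_units_conj ⟨a, b, hab, hba⟩ x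

/-- `Ad(exp x) = exp(ad x)` preserves every Lie subalgebra containing `x`. -/
theorem exp_neg_mul_mul_exp_mem [FiniteDimensional ℂ E] {h : Submodule ℂ E}
    (hh : ∀ x ∈ h, ∀ y ∈ h, x * y - y * x ∈ h) {x y : E} (hx : x ∈ h) (hy : y ∈ h) :
    exp (-x) * y * exp x ∈ h := by
  let _ : NormedAlgebra ℚ (E →L[ℂ] E) := NormedAlgebra.restrictScalars ℚ ℂ (E →L[ℂ] E)
  -- `-ad x` is the sum of the commuting operators `y ↦ -x y` and `y ↦ y x`, whose exponentials are
  -- multiplications by `exp (-x)` and `exp x`.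
  let Lx : E →L[ℂ] E := ContinuousLinearMap.mul ℂ E (-x)
  let Rx : E →L[ℂ] E := (ContinuousLinearMap.mul ℂ E).flip x
  have hcomm : Commute Lx Rx := by
    refine ContinuousLinearMap.ext fun z => ?_
    simp [Lx, Rx, mul_assoc]
  have key := exp_add_of_commute hcomm
  have hL : ∀ n z, (Lx ^ n) z = (-x) ^ n * z := by
    intro n
    induction n with
    | zero => intro z; simp
    | succ n ih =>
      intro z
      rw [pow_succ, pow_succ, mul_assoc]
      exact ih (-x * z)
  have hR : ∀ n z, (Rx ^ n) z = z * x ^ n := by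
    intro n
    induction n with
    | zero => intro z; simp
    | succ n ih =>
      intro z
      rw [pow_succ, pow_succ', ← mul_assoc]
      exact ih (z * x)
  have appl : ∀ (T : E →L[ℂ] E) (z : E),
      HasSum (fun n : ℕ => ((n.factorial : ℂ))⁻¹ • (T ^ n) z) ((exp T) z) := by
    intro T z
    have := (exp_series_hasSum_exp' (𝕂 := ℂ) T).mapL (ContinuousLinearMap.apply ℂ E z)
    simpa using this
  have eL : ∀ z, (exp Lx) z = exp (-x) * z := by
    intro z
    refine (appl Lx z).unique ?_
    have := (exp_series_hasSum_exp' (𝕂 := ℂ) (-x)).mul_right z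
    simpa [hL] using this
  have eR : ∀ z, (exp Rx) z = z * exp x := by
    intro z
    refine (appl Rx z).unique ?_
    have := (exp_series_hasSum_exp' (𝕂 := ℂ) x).mul_left z
    simpa [hR] using this
  have e : exp (-x) * y * exp x = (exp (Lx + Rx)) y := by
    rw [key, mul_apply_eq_comp, eR, eL, mul_assoc]
  rw [e]
  have hmem : ∀ n, ((Lx + Rx) ^ n) y ∈ h := by
    intro n
    induction n with
    | zero => simpa using hy
    | succ n ih =>
      rw [pow_succ', mul_apply_eq_comp]
      have := hh _ ih _ hx
      simpa [Lx, Rx, sub_eq_neg_add] using this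
  exact h.closed_of_finiteDimensional.mem_of_tendsto (appl _ y)
    (Eventually.of_forall fun s => Submodule.sum_mem _ fun n _ => h.smul_mem _ (hmem n))

omit [CompleteSpace E] in
theorem expWord_apply_zero {k : ℕ} (w : Fin k → E) : expWord w 0 = 1 := by
  induction k with
  | zero => exact expWord_zero _ _
  | succ k ih =>
    rw [expWord_succ]
    have : (fun i : Fin k => (0 : Fin (k + 1) → ℂ) i.succ) = 0 := rfl
    rw [this, ih]; simp

theorem isUnit_expWord {k : ℕ} (w : Fin k → E) (t : Fin k → ℂ) : IsUnit (expWord w t) :=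
  expWord_mem (S := IsUnit.submonoid E) fun _ => ⟨⟨_, _, exp_mul_exp_neg _, exp_neg_mul_exp _⟩, rfl⟩

theorem contDiff_expWord {k : ℕ} (w : Fin k → E) : ContDiff ℂ 1 (expWord w) := by
  induction k with
  | zero =>
    have : expWord w = fun _ => 1 := funext fun t => expWord_zero w t
    rw [this]; exact contDiff_const
  | succ k ih =>
    have : expWord w = fun t => exp (t 0 • w 0) *
        expWord (fun i => w i.succ) (fun i => t i.succ) := funext fun t => expWord_succ w t
    rw [this]
    have he : ContDiff ℂ 1 (exp : E → E) :=
      contDiff_iff_contDiffAt.2 fun x => (exp_analytic (𝕂 := ℂ) x).contDiffAt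
    refine ContDiff.mul (he.comp ?_) ((ih _).comp ?_)
    · fun_prop
    · fun_prop

/-- The logarithmic derivative of a product of exponentials of elements of a Lie subalgebra `h`
takes values in `h`. -/
theorem hasFDerivAt_expWord [FiniteDimensional ℂ E] {h : Submodule ℂ E}
    (hh : ∀ x ∈ h, ∀ y ∈ h, x * y - y * x ∈ h) {k : ℕ} (w : Fin k → E) (hw : ∀ i, w i ∈ h)
    (t : Fin k → ℂ) :
    (∃ D : (Fin k → ℂ) →L[ℂ] E, HasFDerivAt (expWord w) D t ∧ ∀ v, ∃ η ∈ h,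
      D v = expWord w t * η ∧ (t = 0 → η = ∑ i, v i • w i)) ∧
    ∀ y ∈ h, ∃ y' ∈ h, y * expWord w t = expWord w t * y' ∧ (t = 0 → y' = y) := by
  induction k with
  | zero =>
    have : expWord w = fun _ => 1 := funext fun t => expWord_zero w t
    rw [this]
    exact ⟨⟨0, hasFDerivAt_const _ _, fun v => ⟨0, h.zero_mem, by simp⟩⟩,
      fun y hy => ⟨y, hy, by simp⟩⟩
  | succ k ih =>
    have hfun : expWord w = fun t => exp (t 0 • w 0) *
        expWord (fun i => w i.succ) (fun i => t i.succ) := funext fun t => expWord_succ w t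
    obtain ⟨⟨D, hD, hD'⟩, hA⟩ := ih (fun i => w i.succ) (fun i => hw _) (fun i => t i.succ)
    let tl : (Fin (k + 1) → ℂ) →L[ℂ] (Fin k → ℂ) :=
      ContinuousLinearMap.pi fun i => ContinuousLinearMap.proj i.succ
    have h1 : HasFDerivAt (fun t : Fin (k + 1) → ℂ => expWord (fun i => w i.succ)
        (fun i => t i.succ)) (D ∘L tl) t := by
      have := HasFDerivAt.comp t (f := tl) hD tl.hasFDerivAt
      exact this
    have h2 := ((hasDerivAt_exp_smul_const (w 0) (t 0)).hasFDerivAt).comp t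
      (ContinuousLinearMap.proj (R := ℂ) (φ := fun _ : Fin (k + 1) => ℂ) 0).hasFDerivAt
    have h3 := HasFDerivAt.mul' h2 h1
    constructor
    · rw [hfun]
      refine ⟨_, h3, fun v => ?_⟩
      obtain ⟨η, hη, e1, e2⟩ := hD' (fun i => v i.succ)
      obtain ⟨y', hy', e3, e4⟩ := hA (w 0) (hw 0)
      refine ⟨v 0 • y' + η, h.add_mem (h.smul_mem _ hy') hη, ?_, ?_⟩
      · have e1' : D (tl v) = _ := e1
        simp [e1', mul_add, mul_assoc, add_comm, e3]
      · intro ht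
        have ht' : (fun i : Fin k => t i.succ) = 0 := by rw [ht]; rfl
        rw [Fin.sum_univ_succ, e2 ht', e4 ht']
    · intro y hy
      have h5 := exp_neg_mul_mul_exp_mem hh (h.smul_mem (t 0) (hw 0)) hy
      obtain ⟨y', hy', e3, e4⟩ := hA _ h5
      refine ⟨y', hy', ?_, ?_⟩
      · rw [hfun]
        simp only [mul_assoc]
        rw [← e3]
        simp only [← mul_assoc]
        rw [exp_mul_exp_neg, one_mul]
      · intro ht
        have ht' : (fun i : Fin k => t i.succ) = 0 := by rw [ht]; rfl
        rw [e4 ht', ht]; simp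

end LieSubspace

section ExpCurve

variable {E : Type*} [NormedRing E] [NormedAlgebra ℂ E]

theorem exp_zero_smul (x : E) : NormedSpace.exp ((0 : ℂ) • x) = 1 := by
  rw [zero_smul, NormedSpace.exp_zero]

variable [CompleteSpace E]

theorem hasDerivAt_exp_smul_zero (x : E) :
    HasDerivAt (fun t : ℂ => NormedSpace.exp (t • x)) x 0 := by
  have h := hasDerivAt_exp_smul_const x (0 : ℂ)
  rwa [exp_zero_smul, one_mul] at h

theorem hasDerivAt_exp_ofReal_smul_zero (x : E) :
    HasDerivAt (fun t : ℝ => NormedSpace.exp ((t : ℂ) • x)) x 0 := by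
  have h := (hasDerivAt_exp_smul_zero x).scomp_of_eq (0 : ℝ)
    (Complex.ofRealCLM.hasDerivAt (x := 0)) (by simp)
  exact h.congr_deriv (by simp)

theorem continuous_exp_smul (x : E) : Continuous fun t : ℂ => NormedSpace.exp (t • x) :=
  continuous_iff_continuousAt.2 fun t => (hasDerivAt_exp_smul_const x t).continuousAt

end ExpCurve

/-! ### The leaf of a Lie algebra through the unit -/

section LeafChart

open NormedSpace Filter Topology Set Metric

variable {E : Type*} [NormedRing E] [NormedAlgebra ℂ E] [CompleteSpace E] [FiniteDimensional ℂ E]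

omit [CompleteSpace E] in
/-- A translate of `h` by an element near the unit stays transversal to a complement of `h`. -/
theorem exists_transversal {h m : Submodule ℂ E} (hm : IsCompl h m) :
    ∃ δ > 0, ∀ s : E, ‖s‖ < δ → ∀ ζ ∈ h, (1 + s) * ζ ∈ m → ζ = 0 := by
  let π : E →L[ℂ] E := LinearMap.toContinuousLinearMap
    (h.subtype ∘ₗ Submodule.projectionOnto h m hm)
  have hπh : ∀ ζ ∈ h, π ζ = ζ := fun ζ hζ => by
    have := Submodule.projectionOnto_apply_left hm ⟨ζ, hζ⟩
    change ((Submodule.projectionOnto h m hm ζ : h) : E) = ζ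
    rw [this]
  have hπm : ∀ a ∈ m, π a = 0 := fun a ha => by
    change ((Submodule.projectionOnto h m hm a : h) : E) = 0
    rw [(Submodule.projectionOnto_apply_eq_zero_iff hm).2 ha]; rfl
  refine ⟨(‖π‖ + 1)⁻¹, by positivity, fun s hs ζ hζ hm' => ?_⟩
  by_contra hne
  have h0 : 0 < ‖ζ‖ := norm_pos_iff.2 hne
  have h1 : ζ = - π (s * ζ) := by
    have := hπm _ hm'
    rw [add_mul, one_mul, map_add, hπh ζ hζ] at this
    exact eq_neg_of_add_eq_zero_left this
  have h2 : ‖ζ‖ ≤ ‖π‖ * (‖s‖ * ‖ζ‖) := by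
    calc ‖ζ‖ = ‖π (s * ζ)‖ := by conv_lhs => rw [h1, norm_neg]
      _ ≤ ‖π‖ * ‖s * ζ‖ := π.le_opNorm _
      _ ≤ _ := by gcongr; exact norm_mul_le _ _
  have h3 : ‖π‖ * ‖s‖ < 1 := by
    have : (‖π‖ + 1) * ‖s‖ < 1 := by
      rw [← lt_inv_mul_iff₀ (by positivity), mul_one]; exact hs
    nlinarith [norm_nonneg s]
  nlinarith

/-- Foliation of a neighbourhood of the unit by the translates of the integral submanifold
`t ↦ exp (t₁ w₁) ⋯ exp (tₘ wₘ)` through the unit, for a basis `w` of a Lie subalgebra `h`: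
curves tangent to the left translates of `h` stay in this leaf, and conversely a curve in the leaf
is tangent to them. -/
theorem exists_leaf_chart {h : Submodule ℂ E} (hh : ∀ x ∈ h, ∀ y ∈ h, x * y - y * x ∈ h)
    {k : ℕ} {w : Fin k → E} (hw : LinearIndependent ℂ w)
    (hspan : Submodule.span ℂ (range w) = h) {ε : ℝ} (hε : 0 < ε) :
    ∃ r, 0 < r ∧ r ≤ ε ∧ ∃ W ∈ 𝓝 (1 : E),
      (∀ γ : ℂ → E, (∀ τ ∈ ball (0 : ℂ) 2, γ τ ∈ W ∧ ∃ ξ ∈ h, HasDerivAt γ (γ τ * ξ) τ) →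
        γ 0 = 1 → γ 1 ∈ expWord w '' closedBall 0 r) ∧
      ∀ (γ : ℂ → E) (O : Set ℂ) (x : E), IsOpen O → O.Nonempty →
        (∀ τ ∈ O, γ τ ∈ expWord w '' closedBall 0 r ∧ HasDerivAt γ (γ τ * x) τ) → x ∈ h := by
  obtain ⟨m, hm⟩ := Submodule.exists_isCompl h
  obtain ⟨δ, hδ, htrans⟩ := exists_transversal hm
  have hwh : ∀ i, w i ∈ h := fun i => hspan ▸ Submodule.subset_span ⟨i, rfl⟩
  let Ψ : m × (Fin k → ℂ) → E := fun q => (1 + (q.1 : E)) * expWord w q.2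
  have hΨ : ContDiff ℂ 1 Ψ := by
    refine ContDiff.mul (contDiff_const.add ?_) ((contDiff_expWord w).comp contDiff_snd)
    exact m.subtypeL.contDiff.comp contDiff_fst
  have hW := fun t => (hasFDerivAt_expWord hh w hwh t).1
  have hA := fun t => (hasFDerivAt_expWord hh w hwh t).2
  -- the derivative of `Ψ` at the origin is the sum map of the decomposition `E = m ⊕ h`
  obtain ⟨D, hD, hD'⟩ := hW 0
  let F : m × (Fin k → ℂ) →L[ℂ] E :=
    m.subtypeL.comp (ContinuousLinearMap.fst ℂ m (Fin k → ℂ)) +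
      D.comp (ContinuousLinearMap.snd ℂ m (Fin k → ℂ))
  have hF : HasFDerivAt Ψ F 0 := by
    have h1 : HasFDerivAt (fun q : m × (Fin k → ℂ) => 1 + (q.1 : E))
        (m.subtypeL.comp (ContinuousLinearMap.fst ℂ m (Fin k → ℂ))) 0 :=
      (m.subtypeL.comp (ContinuousLinearMap.fst ℂ m (Fin k → ℂ))).hasFDerivAt.const_add 1
    have h2 : HasFDerivAt (fun q : m × (Fin k → ℂ) => expWord w q.2)
        (D.comp (ContinuousLinearMap.snd ℂ m (Fin k → ℂ))) 0 :=
      HasFDerivAt.comp (0 : m × (Fin k → ℂ)) (f := Prod.snd) hD hasFDerivAt_snd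
    have h3 : HasFDerivAt Ψ _ 0 := h1.mul' h2
    refine h3.congr_fderiv ?_
    ext v <;> simp [F, expWord_apply_zero]
  have hDv : ∀ v, D v = ∑ i, v i • w i := fun v => by
    obtain ⟨η, _, e1, e2⟩ := hD' v
    rw [e1, e2 rfl, expWord_apply_zero, one_mul]
  have hFbij : Function.Bijective F := by
    constructor
    · rw [injective_iff_map_eq_zero]
      rintro ⟨a, v⟩ hav
      have hav' : (a : E) + ∑ i, v i • w i = 0 := by rw [← hDv]; exact hav
      have hv : ∑ i, v i • w i ∈ h := Submodule.sum_mem _ fun i _ => h.smul_mem _ (hwh i)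
      have ha : (a : E) = 0 := by
        have : (a : E) ∈ h := by
          rw [eq_neg_of_add_eq_zero_left hav']; exact h.neg_mem hv
        exact Submodule.disjoint_def.1 hm.disjoint _ this a.2
      rw [ha, zero_add] at hav'
      have := Fintype.linearIndependent_iff.1 hw v hav'
      ext
      · exact ha
      · exact this _
    · intro y
      obtain ⟨b, hb, a, ha, rfl⟩ := Submodule.mem_sup.1
        (show y ∈ h ⊔ m by rw [hm.sup_eq_top]; trivial)
      rw [← hspan, Submodule.mem_span_range_iff_exists_fun] at hb
      obtain ⟨v, rfl⟩ := hb
      refine ⟨(⟨a, ha⟩, v), ?_⟩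
      change a + D v = _
      rw [hDv, add_comm]
  let e : (m × (Fin k → ℂ)) ≃L[ℂ] E :=
    (LinearEquiv.ofBijective F.toLinearMap hFbij).toContinuousLinearEquiv
  have hFe : HasFDerivAt Ψ (e : m × (Fin k → ℂ) →L[ℂ] E) 0 :=
    hF.congr_fderiv (ContinuousLinearMap.ext fun _ => rfl)
  have hΨ0 : ContDiffAt ℂ 1 Ψ 0 := hΨ.contDiffAt
  let φ := hΨ0.toOpenPartialHomeomorph Ψ hFe one_ne_zero
  have hφ : ∀ q, φ q = Ψ q := fun q => rfl
  have hΨ1 : Ψ 0 = 1 := by simp [Ψ, expWord_apply_zero]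
  have h0s : (0 : m × (Fin k → ℂ)) ∈ φ.source :=
    hΨ0.mem_toOpenPartialHomeomorph_source hFe one_ne_zero
  have hsymm : ContDiffAt ℂ 1 φ.symm 1 := by
    have := hΨ0.to_localInverse hFe one_ne_zero
    rw [hΨ1] at this
    exact this
  have hsymm1 : φ.symm 1 = 0 := by rw [← hΨ1]; exact φ.left_inv h0s
  have hN : ∀ᶠ y in 𝓝 (1 : E), DifferentiableAt ℂ φ.symm y :=
    (hsymm.eventually (by simp)).mono fun y hy => hy.differentiableAt (by simp)
  have hN' : ∀ᶠ q in 𝓝 (0 : m × (Fin k → ℂ)), q ∈ φ.source ∧ DifferentiableAt ℂ φ.symm (Ψ q) := by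
    refine (φ.open_source.eventually_mem h0s).and ?_
    have : Tendsto Ψ (𝓝 0) (𝓝 1) := by
      have := hΨ.continuous.tendsto 0
      rwa [hΨ1] at this
    exact this.eventually hN
  obtain ⟨r₀, hr₀, hball⟩ := Metric.eventually_nhds_iff.1 hN'
  let r := min (r₀ / 2) (min ε δ)
  have hr : 0 < r := by positivity
  refine ⟨r, hr, (min_le_right _ _).trans (min_le_left _ _),
    {y | y ∈ φ.target ∧ DifferentiableAt ℂ φ.symm y ∧ φ.symm y ∈ ball 0 r}, ?_, ?_, ?_⟩
  · have ht : ∀ᶠ y in 𝓝 (1 : E), y ∈ φ.target := φ.open_target.eventually_mem (by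
      rw [← hΨ1]; exact φ.map_source h0s)
    refine ht.and (hN.and ?_)
    have := hsymm.continuousAt.tendsto
    rw [hsymm1] at this
    exact this (ball_mem_nhds _ hr)
  · intro γ hγ hγ0
    let σ : ℂ → m := fun τ => (φ.symm (γ τ)).1
    let θ : ℂ → (Fin k → ℂ) := fun τ => (φ.symm (γ τ)).2
    have hrep : ∀ τ ∈ ball (0 : ℂ) 2, γ τ = (1 + (σ τ : E)) * expWord w (θ τ) := fun τ hτ =>
      (φ.right_inv (hγ τ hτ).1.1).symm
    -- the transversal coordinate `σ` of a curve tangent to the leaves is constant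
    have hder : ∀ τ ∈ ball (0 : ℂ) 2, HasDerivAt σ 0 τ := by
      intro τ hτ
      obtain ⟨hW', ξ, hξ, hγ'⟩ := hγ τ hτ
      have hd : HasDerivAt (fun τ => φ.symm (γ τ)) _ τ :=
        hW'.2.1.hasFDerivAt.comp_hasDerivAt τ hγ'
      set q' := fderiv ℂ φ.symm (γ τ) (γ τ * ξ)
      have hσ : HasDerivAt σ q'.1 τ :=
        (ContinuousLinearMap.fst ℂ m (Fin k → ℂ)).hasFDerivAt.comp_hasDerivAt τ hd
      have hθ : HasDerivAt θ q'.2 τ :=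
        (ContinuousLinearMap.snd ℂ m (Fin k → ℂ)).hasFDerivAt.comp_hasDerivAt τ hd
      have hσ' : HasDerivAt (fun τ => 1 + (σ τ : E)) (q'.1 : E) τ :=
        (m.subtypeL.hasFDerivAt.comp_hasDerivAt τ hσ).const_add 1
      obtain ⟨D₁, hD₁, hD₁'⟩ := hW (θ τ)
      obtain ⟨η, hη, e1, -⟩ := hD₁' q'.2
      have hprod := hσ'.mul (hD₁.comp_hasDerivAt τ hθ)
      have heq : HasDerivAt γ (γ τ * ξ) τ := hγ'
      have heq2 : γ =ᶠ[𝓝 τ] fun τ => (1 + (σ τ : E)) * expWord w (θ τ) :=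
        (isOpen_ball.eventually_mem hτ).mono hrep
      have huniq := heq.unique (HasDerivAt.congr_of_eventuallyEq hprod heq2)
      rw [e1, hrep τ hτ] at huniq
      -- conjugating back, the transversal velocity lies in `(1 + σ) h`
      obtain ⟨u, hu⟩ := isUnit_expWord w (θ τ)
      have hAu : ∀ y ∈ h, expWord w (θ τ) * y * (↑u⁻¹ : E) ∈ h := by
        intro y hy
        let ad : h →ₗ[ℂ] h := LinearMap.restrict (p := h) (q := h)
          (LinearMap.mulLeft ℂ (↑u⁻¹ : E) ∘ₗ LinearMap.mulRight ℂ (u : E)) (fun z hz => by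
            obtain ⟨z', hz', e, -⟩ := hA (θ τ) z hz
            change (↑u⁻¹ : E) * (z * u) ∈ h
            rw [hu, e, ← hu, ← mul_assoc, Units.inv_mul, one_mul]; exact hz')
        -- `ad` is surjective as `h` is finite dimensional, so conjugation by `u` also preserves `h`
        have hinj : Function.Injective ad := by
          rw [injective_iff_map_eq_zero]
          intro z hz
          have : (↑u⁻¹ : E) * (z * u) = 0 := congrArg Subtype.val hz
          ext
          have h2 : (u : E) * (↑u⁻¹ * (z * u)) * ↑u⁻¹ = 0 := by rw [this]; simp
          simpa [mul_assoc] using h2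
        obtain ⟨z, hz⟩ := LinearMap.injective_iff_surjective.1 hinj ⟨y, hy⟩
        have hz' : (↑u⁻¹ : E) * (z * u) = y := congrArg Subtype.val hz
        rw [← hz', ← hu]
        simp [mul_assoc]
      have hζ := hAu _ (h.sub_mem hξ hη)
      set ζ := expWord w (θ τ) * (ξ - η) * (↑u⁻¹ : E) with hζdef
      have hq : (q'.1 : E) = (1 + (σ τ : E)) * ζ := by
        have h1 : (q'.1 : E) * u = (1 + (σ τ : E)) * (u * (ξ - η)) := by
          have huniq' : (1 + (σ τ : E)) * expWord w (θ τ) * ξ =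
            q'.1 * expWord w (θ τ) + (1 + (σ τ : E)) * (expWord w (θ τ) * η) := huniq
          rw [hu, mul_sub, mul_sub, ← mul_assoc _ _ ξ, huniq', add_sub_cancel_right]
        calc (q'.1 : E) = (q'.1 : E) * u * (↑u⁻¹ : E) := by simp [mul_assoc]
          _ = _ := by rw [h1, hζdef, ← hu]; simp [mul_assoc]
      have hσr : ‖(σ τ : E)‖ < δ := by
        have h1 : ‖φ.symm (γ τ)‖ < r := by simpa using hW'.2.2
        have h2 : ‖σ τ‖ ≤ ‖φ.symm (γ τ)‖ := norm_fst_le _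
        have h3 : r ≤ δ := (min_le_right _ _).trans (min_le_right _ _)
        exact (h2.trans_lt h1).trans_le h3
      have hζ0 := htrans _ hσr ζ hζ (hq ▸ q'.1.2)
      have hq0 : q'.1 = 0 := by
        ext; rw [hq, hζ0, mul_zero]; rfl
      rwa [hq0] at hσ
    have hconst : σ 1 = σ 0 :=
      isOpen_ball.is_const_of_deriv_eq_zero (convex_ball (0 : ℂ) 2).isPreconnected
        (fun τ hτ => (hder τ hτ).differentiableAt.differentiableWithinAt)
        (fun τ hτ => (hder τ hτ).deriv) (by simp) (by simp)
    have hσ0 : σ 0 = 0 := by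
      change (φ.symm (γ 0)).1 = 0
      rw [hγ0, hsymm1]; rfl
    have h1 : (1 : ℂ) ∈ ball (0 : ℂ) 2 := by simp
    refine ⟨θ 1, ?_, ?_⟩
    · have h2 : ‖φ.symm (γ 1)‖ < r := by simpa using (hγ 1 h1).1.2.2
      rw [mem_closedBall_zero_iff]
      exact (norm_snd_le (φ.symm (γ 1))).trans h2.le
    · rw [hrep 1 h1, hconst, hσ0]; simp
  · rintro γ O x hO ⟨τ, hτ⟩ hγ
    have hsrc : ∀ t ∈ closedBall (0 : Fin k → ℂ) r, ((0 : m), t) ∈ φ.source ∧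
        DifferentiableAt ℂ φ.symm (Ψ (0, t)) := by
      intro t ht
      apply hball
      rw [dist_zero_right, Prod.norm_mk, norm_zero]
      have : ‖t‖ ≤ r := by simpa using ht
      have h2 : r ≤ r₀ / 2 := min_le_left _ _
      rw [max_lt_iff]
      exact ⟨hr₀, by linarith⟩
    have hΨt : ∀ t, Ψ (0, t) = expWord w t := fun t => by simp [Ψ]
    let θ : ℂ → (Fin k → ℂ) := fun τ => (φ.symm (γ τ)).2
    have hrep : ∀ τ ∈ O, γ τ = expWord w (θ τ) ∧ DifferentiableAt ℂ φ.symm (γ τ) := by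
      intro τ hτ
      obtain ⟨⟨t, ht, e⟩, -⟩ := hγ τ hτ
      obtain ⟨h1, h2⟩ := hsrc t ht
      have h3 : φ.symm (γ τ) = (0, t) := by
        rw [← e, ← hΨt]; exact φ.left_inv h1
      refine ⟨?_, ?_⟩
      · change γ τ = expWord w (φ.symm (γ τ)).2
        rw [h3, e]
      · rw [hΨt, e] at h2; exact h2
    obtain ⟨-, hγ'⟩ := hγ τ hτ
    have hd := (hrep τ hτ).2.hasFDerivAt.comp_hasDerivAt τ hγ'
    set q' := fderiv ℂ φ.symm (γ τ) (γ τ * x)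
    have hθ : HasDerivAt θ q'.2 τ :=
      (ContinuousLinearMap.snd ℂ m (Fin k → ℂ)).hasFDerivAt.comp_hasDerivAt τ hd
    obtain ⟨D₁, hD₁, hD₁'⟩ := hW (θ τ)
    obtain ⟨η, hη, e1, -⟩ := hD₁' q'.2
    have heq2 : γ =ᶠ[𝓝 τ] fun τ => expWord w (θ τ) :=
      (hO.eventually_mem hτ).mono fun τ' h => (hrep τ' h).1
    have huniq := hγ'.unique (HasDerivAt.congr_of_eventuallyEq
      (hD₁.comp_hasDerivAt τ hθ) heq2)
    rw [e1, (hrep τ hτ).1] at huniq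
    rwa [(isUnit_expWord w (θ τ)).mul_left_cancel huniq]

end LeafChart

/-! ### One-parameter subgroups of matrix groups -/

section OneParameter

open NormedSpace Filter Topology Set Metric

variable {E : Type*} [NormedRing E] [NormedAlgebra ℂ E] [CompleteSpace E]

/-- A one-parameter group that is contained in `S` for small times is contained in `S`. -/
theorem exp_smul_mem_of_small {S : Submonoid E} {x : E} {δ : ℝ} (hδ : 0 < δ)
    (h : ∀ t : ℂ, ‖t‖ < δ → exp (t • x) ∈ S) (t : ℂ) : exp (t • x) ∈ S := by
  obtain ⟨n, hn⟩ := exists_nat_gt (‖t‖ / δ)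
  have hn0 : 0 < (n : ℝ) := lt_of_le_of_lt (by positivity) hn
  have hn1 : (n : ℂ) ≠ 0 := by
    have := hn0.ne'
    exact_mod_cast this
  have h1 : exp (((t / n : ℂ)) • x) ∈ S := h _ (by
    rw [norm_div, Complex.norm_natCast, div_lt_iff₀ hn0, mul_comm]
    rwa [div_lt_iff₀ hδ] at hn)
  have h2 : t • x = (n : ℂ) • ((t / n : ℂ) • x) := by
    rw [smul_smul, mul_div_cancel₀ _ hn1]
  rw [h2, exp_natCast_smul]
  exact S.pow_mem h1 n

variable [FiniteDimensional ℂ E]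

/-- Products of exponentials of elements of `h` move only inside a leaf when their parameters
move slightly. -/
theorem eventually_expWord_mem_leaf {h : Submodule ℂ E}
    (hh : ∀ x ∈ h, ∀ y ∈ h, x * y - y * x ∈ h) {W P : Set E} (hW : W ∈ 𝓝 (1 : E))
    (hP : ∀ γ : ℂ → E, (∀ τ ∈ ball (0 : ℂ) 2, γ τ ∈ W ∧ ∃ ξ ∈ h, HasDerivAt γ (γ τ * ξ) τ) →
        γ 0 = 1 → γ 1 ∈ P) {l : ℕ} {y : Fin l → E} (hy : ∀ i, y i ∈ h) (a₀ : Fin l → ℂ) :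
    ∀ᶠ a in 𝓝 a₀, ∃ q ∈ P, expWord y a = expWord y a₀ * q := by
  obtain ⟨u, hu⟩ := isUnit_expWord y a₀
  have hlim : Tendsto (fun a => (↑u⁻¹ : E) * expWord y a) (𝓝 a₀) (𝓝 1) := by
    have h1 : Tendsto (fun a => (↑u⁻¹ : E) * expWord y a) (𝓝 a₀)
        (𝓝 ((↑u⁻¹ : E) * expWord y a₀)) :=
      ((contDiff_expWord y).continuous.tendsto a₀).const_mul _
    rwa [← hu, Units.inv_mul] at h1
  obtain ⟨δ, hδ, hball⟩ := Metric.eventually_nhds_iff.1 (hlim.eventually hW)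
  filter_upwards [Metric.ball_mem_nhds a₀ (half_pos hδ)] with a ha
  have hγ := hP (fun τ => (↑u⁻¹ : E) * expWord y (a₀ + τ • (a - a₀))) (fun τ hτ => ?_) (by
    rw [zero_smul, add_zero, ← hu, Units.inv_mul])
  · refine ⟨_, hγ, ?_⟩
    rw [← hu, ← mul_assoc, Units.mul_inv, one_mul, one_smul, add_sub_cancel]
  · refine ⟨hball ?_, ?_⟩
    · rw [dist_eq_norm, add_sub_cancel_left, norm_smul]
      have h1 : ‖a - a₀‖ < δ / 2 := by rwa [mem_ball, dist_eq_norm] at ha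
      have h2 : ‖τ‖ < 2 := by simpa using hτ
      nlinarith [norm_nonneg τ, norm_nonneg (a - a₀)]
    · obtain ⟨D, hD, hD'⟩ := (hasFDerivAt_expWord hh y hy (a₀ + τ • (a - a₀))).1
      obtain ⟨η, hη, e, -⟩ := hD' (a - a₀)
      refine ⟨η, hη, ?_⟩
      have h1 : HasDerivAt (fun τ : ℂ => a₀ + τ • (a - a₀)) (a - a₀) τ := by
        simpa using ((hasDerivAt_id τ).smul_const (a - a₀)).const_add a₀
      have h2 := (hD.comp_hasDerivAt τ h1).const_mul (↑u⁻¹ : E)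
      rw [e, ← mul_assoc] at h2
      exact h2

/-- A product of exponentials of small multiples of arbitrary elements of `h` is a product of
exponentials of small multiples of the basis `w`: both lie in the leaf through the unit. -/
theorem exists_expWord_eq_of_small {h : Submodule ℂ E}
    (hh : ∀ x ∈ h, ∀ y ∈ h, x * y - y * x ∈ h) {k : ℕ} {w : Fin k → E}
    (hw : LinearIndependent ℂ w) (hspan : Submodule.span ℂ (range w) = h) {ε : ℝ} (hε : 0 < ε)
    {l : ℕ} {y : Fin l → E} (hy : ∀ i, y i ∈ h) :
    ∀ᶠ a in 𝓝 (0 : Fin l → ℂ), ∃ t ∈ closedBall (0 : Fin k → ℂ) ε,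
      expWord y a = expWord w t := by
  obtain ⟨r, -, hrε, W, hW, hP, -⟩ := exists_leaf_chart hh hw hspan hε
  filter_upwards [eventually_expWord_mem_leaf hh hW hP hy 0] with a ⟨q, ⟨t, ht, e⟩, e'⟩
  refine ⟨t, closedBall_subset_closedBall hrε ht, ?_⟩
  rw [e', expWord_apply_zero, one_mul, e]

theorem exists_exp_smul_eq_expWord {h : Submodule ℂ E}
    (hh : ∀ x ∈ h, ∀ y ∈ h, x * y - y * x ∈ h) {k : ℕ} {w : Fin k → E}
    (hw : LinearIndependent ℂ w) (hspan : Submodule.span ℂ (range w) = h) {x : E} (hx : x ∈ h) :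
    ∃ δ > 0, ∀ s : ℂ, ‖s‖ < δ → ∃ t, exp (s • x) = expWord w t := by
  have h1 := exists_expWord_eq_of_small hh hw hspan one_pos (y := fun _ : Fin 1 => x)
    (fun _ => hx)
  obtain ⟨δ, hδ, hball⟩ := Metric.eventually_nhds_iff.1 h1
  refine ⟨δ, hδ, fun s hs => ?_⟩
  obtain ⟨t, -, e⟩ := hball (y := fun _ => s) (by
    rw [dist_zero_right]
    exact (pi_norm_lt_iff hδ).2 fun _ => hs)
  refine ⟨t, ?_⟩
  rw [← e, expWord_succ, expWord_zero, mul_one]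

/-- The one-parameter subgroups of an arbitrary submonoid are those of a Lie algebra. -/
theorem exists_lie_oneParam (S : Submonoid E) :
    ∃ h : Submodule ℂ E, (∀ x ∈ h, ∀ y ∈ h, x * y - y * x ∈ h) ∧
      ∀ x, x ∈ h ↔ ∀ t : ℂ, exp (t • x) ∈ S := by
  let T : Set E := {x | ∀ t : ℂ, exp (t • x) ∈ S}
  have hTsmul : ∀ x ∈ T, ∀ c : ℂ, c • x ∈ T := fun x hx c t => by
    rw [smul_smul]; exact hx _
  have hT1 : ∀ x ∈ T, exp x ∈ S ∧ exp (-x) ∈ S := fun x hx => by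
    have h1 := hx 1
    have h2 := hx (-1)
    rw [one_smul] at h1
    rw [neg_one_smul] at h2
    exact ⟨h1, h2⟩
  have hconj : ∀ x ∈ T, ∀ y ∈ T, exp x * y * exp (-x) ∈ T := fun x hx y hy t => by
    have : t • (exp x * y * exp (-x)) = exp x * (t • y) * exp (-x) := by
      rw [mul_smul_comm, smul_mul_assoc]
    rw [this, exp_conj_eq (exp_mul_exp_neg x) (exp_neg_mul_exp x)]
    exact S.mul_mem (S.mul_mem (hT1 x hx).1 (hy t)) (hT1 x hx).2
  -- `T` is not yet known to be a subspace, so the Lie algebra is built from its span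
  let h := Submodule.span ℂ T
  have hAd : ∀ x ∈ T, ∀ y ∈ h, exp x * y * exp (-x) ∈ h := by
    intro x hx y hy
    induction hy using Submodule.span_induction with
    | mem y hy => exact Submodule.subset_span (hconj x hx y hy)
    | zero => simp
    | add y z _ _ hy hz => rw [mul_add, add_mul]; exact h.add_mem hy hz
    | smul c y _ hy => rw [mul_smul_comm, smul_mul_assoc]; exact h.smul_mem c hy
  have had : ∀ x ∈ T, ∀ y ∈ h, x * y - y * x ∈ h := by
    intro x hx y hy
    have h1 : HasDerivAt (fun t : ℂ => exp (t • x) * y * exp (t • -x)) (x * y - y * x) 0 := by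
      have h2 := ((hasDerivAt_exp_smul_const x (0 : ℂ)).mul_const y).mul
        (hasDerivAt_exp_smul_const (-x) (0 : ℂ))
      refine HasDerivAt.congr_deriv h2 ?_
      simp [sub_eq_add_neg]
    refine h.closed_of_finiteDimensional.mem_of_tendsto h1.tendsto_slope_zero
      (Eventually.of_forall fun t => h.smul_mem _ (h.sub_mem ?_ ?_))
    · rw [zero_add, smul_neg]
      exact hAd _ (hTsmul x hx t) y hy
    · simpa using hy
  have hh : ∀ x ∈ h, ∀ y ∈ h, x * y - y * x ∈ h := by
    intro x hx y hy
    induction hx using Submodule.span_induction with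
    | mem x hx => exact had x hx y hy
    | zero => simp
    | add x z _ _ hx hz =>
      have : (x + z) * y - y * (x + z) = (x * y - y * x) + (z * y - y * z) := by noncomm_ring
      rw [this]; exact h.add_mem hx hz
    | smul c x _ hx =>
      rw [smul_mul_assoc, mul_smul_comm, ← smul_sub]; exact h.smul_mem c hx
  refine ⟨h, hh, fun x => ⟨fun hx => ?_, fun hx => Submodule.subset_span hx⟩⟩
  -- a basis of the span chosen in `T`: small `exp (s x)` are products of the `exp (tᵢ wᵢ)`
  obtain ⟨w, hwT, hwspan, hw⟩ := Submodule.exists_fun_fin_finrank_span_eq ℂ T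
  obtain ⟨δ, hδ, hsmall⟩ := exists_exp_smul_eq_expWord hh hw hwspan hx
  refine exp_smul_mem_of_small hδ fun s hs => ?_
  obtain ⟨t, e⟩ := hsmall s hs
  rw [e]
  exact expWord_mem fun i => hwT i (t i)

/-- The subgroup generated by `exp h` has no other one-parameter subgroups than those of `h`:
it is a countable union of translates of a compact piece of the leaf through the unit, so by
Baire's theorem such a one-parameter subgroup runs inside one of them for some time. -/
theorem mem_of_exp_smul_mem_closure {h : Submodule ℂ E}
    (hh : ∀ x ∈ h, ∀ y ∈ h, x * y - y * x ∈ h) {x : E}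
    (hx : ∀ t : ℂ, exp (t • x) ∈ Submonoid.closure (exp '' (h : Set E))) : x ∈ h := by
  obtain ⟨k, w, hwT, hwspan, hw⟩ : ∃ (k : ℕ) (w : Fin k → E), (∀ i, w i ∈ h) ∧
      Submodule.span ℂ (range w) = h ∧ LinearIndependent ℂ w := by
    obtain ⟨w, hwT, hwspan, hw⟩ := Submodule.exists_fun_fin_finrank_span_eq ℂ (h : Set E)
    exact ⟨_, w, hwT, hwspan.trans h.span_eq, hw⟩
  obtain ⟨r, hr, -, W, hW, hP1, hP2⟩ := exists_leaf_chart hh hw hwspan one_pos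
  set P := expWord w '' closedBall 0 r with hPdef
  have hPc : IsCompact P := (isCompact_closedBall _ _).image (contDiff_expWord w).continuous
  -- `exp h` generates words in the finitely many one-parameter groups of the basis, and there are
  -- only countably many shapes `i` of such words
  let G : Submonoid E :=
    { carrier := {g | ∃ (l : ℕ) (i : Fin l → Fin k) (a : Fin l → ℂ),
        g = expWord (fun j => w (i j)) a}
      one_mem' := ⟨0, Fin.elim0, Fin.elim0, (expWord_zero _ _).symm⟩
      mul_mem' := by
        rintro _ _ ⟨l, i, a, rfl⟩ ⟨l', i', a', rfl⟩
        refine ⟨l + l', Fin.append i i', Fin.append a a', ?_⟩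
        have : (fun j => exp (Fin.append a a' j • w (Fin.append i i' j))) =
            Fin.append (fun j => exp (a j • w (i j))) (fun j => exp (a' j • w (i' j))) := by
          funext j
          refine Fin.addCases (fun j => ?_) (fun j => ?_) j <;> simp
        rw [expWord, expWord, expWord, this, List.ofFn_fin_append, List.prod_append] }
  have hSG : Submonoid.closure (exp '' (h : Set E)) ≤ G := by
    rw [Submonoid.closure_le]
    rintro _ ⟨y, hy, rfl⟩
    obtain ⟨δ, hδ, hsmall⟩ := exists_exp_smul_eq_expWord hh hw hwspan hy
    have := exp_smul_mem_of_small (S := G) hδ (fun s hs => by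
      obtain ⟨t, e⟩ := hsmall s hs
      exact ⟨k, id, t, e⟩) 1
    rwa [one_smul] at this
  have hnear := fun (q : Σ l : ℕ, Fin l → Fin k) (a : Fin q.1 → ℂ) =>
    eventually_expWord_mem_leaf hh hW hP1 (y := fun j => w (q.2 j)) (fun j => hwT _) a
  -- by the Lindelöf property, countably many translates `d P` cover the words of each shape
  choose s hs hcover using fun q : Σ l : ℕ, Fin l → Fin k =>
    TopologicalSpace.countable_cover_nhds (hnear q)
  let D : Set E := ⋃ q : Σ l : ℕ, Fin l → Fin k, (expWord fun j => w (q.2 j)) '' s q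
  have hDc : D.Countable := countable_iUnion fun q => (hs q).image _
  have hcov : ⋃ d ∈ D, (fun τ : ℂ => exp (τ • x)) ⁻¹' ((fun y => d * y) '' P) = univ := by
    rw [eq_univ_iff_forall]
    intro τ
    obtain ⟨l, i, a, e⟩ := hSG (hx τ)
    have ha := (hcover ⟨l, i⟩).ge (mem_univ a)
    simp only [mem_iUnion] at ha
    obtain ⟨b, hb, q, hq, e'⟩ := ha
    refine mem_biUnion (x := expWord (fun j => w (i j)) b)
      (mem_iUnion.2 ⟨⟨l, i⟩, mem_image_of_mem _ hb⟩) ⟨q, hq, ?_⟩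
    change _ = exp (τ • x)
    rw [e, e']
  have hcont : Continuous fun τ : ℂ => exp (τ • x) :=
    (differentiable_exp_smul_const ℂ x).continuous
  have := hDc.to_subtype
  rw [biUnion_eq_iUnion] at hcov
  -- Baire's theorem
  obtain ⟨⟨d, hd⟩, hint⟩ := nonempty_interior_of_iUnion_of_closed
    (fun d : D => ((hPc.image (continuous_const_mul (d : E))).isClosed).preimage hcont) hcov
  obtain ⟨q, hq⟩ := mem_iUnion.1 hd
  obtain ⟨b, -, hb⟩ := hq
  obtain ⟨u, hu⟩ := isUnit_expWord (fun j => w (q.2 j)) b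
  have hu' : (u : E) = d := hu.trans hb
  refine hP2 (fun τ => (↑u⁻¹ : E) * exp (τ • x)) _ x isOpen_interior hint fun τ hτ => ⟨?_, ?_⟩
  · obtain ⟨y, hy, e⟩ := interior_subset hτ
    have e' : d * y = exp (τ • x) := e
    rw [← e', ← hu', ← mul_assoc, Units.inv_mul, one_mul]
    exact hy
  · have := (hasDerivAt_exp_smul_const x τ).const_mul (↑u⁻¹ : E)
    rwa [← mul_assoc] at this

/-- Cartan's theorem: near the unit, a closed group `G` of invertible elements consists of the
exponentials of the elements of its Lie algebra `k`. -/
theorem eventually_mem_exp_of_isClosed {G : Submonoid E} (hG : IsClosed (G : Set E))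
    (hinv : ∀ x, exp x ∈ G → exp (-x) ∈ G) {k : Submodule ℂ E} (hk : ∀ x ∈ k, exp x ∈ G)
    (hk' : ∀ x, (∀ τ : ℝ, exp ((τ : ℂ) • x) ∈ G) → x ∈ k) :
    ∀ᶠ g in 𝓝 (1 : E), g ∈ G → ∃ x ∈ k, exp x = g := by
  obtain ⟨m, hm⟩ := Submodule.exists_isCompl k
  -- a sequence of small elements of `m` with exponential in `G` would have a limit direction in `k`
  have claim : ∃ ε > 0, ∀ y ∈ m, ‖y‖ < ε → exp y ∈ G → y = 0 := by
    by_contra! hcon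
    choose y hym hy hyG hy0 using fun n : ℕ => hcon (1 / (n + 1)) Nat.one_div_pos_of_nat
    have hylim : Tendsto (fun n => ‖y n‖) atTop (𝓝 0) :=
      squeeze_zero (fun n => norm_nonneg _) (fun n => (hy n).le)
        tendsto_one_div_add_atTop_nhds_zero_nat
    have hpos : ∀ n, 0 < ‖y n‖ := fun n => norm_pos_iff.2 (hy0 n)
    let z : ℕ → E := fun n => ((‖y n‖⁻¹ : ℝ) : ℂ) • y n
    have hz : ∀ n, z n ∈ sphere (0 : E) 1 := fun n => by
      rw [mem_sphere_zero_iff_norm, norm_smul, Complex.norm_real, norm_inv, norm_norm,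
        inv_mul_cancel₀ (hpos n).ne']
    have : ProperSpace E := FiniteDimensional.proper ℂ E
    obtain ⟨Y, hY, φ, hφ, hlim⟩ := (isCompact_sphere (0 : E) 1).tendsto_subseq hz
    have hYm : Y ∈ m := m.closed_of_finiteDimensional.mem_of_tendsto hlim
      (Eventually.of_forall fun n => m.smul_mem _ (hym _))
    have hpow : ∀ τ : ℝ, 0 ≤ τ → exp ((τ : ℂ) • Y) ∈ G := by
      intro τ hτ
      -- `N n • y (φ n)` tends to `τ Y`, and its exponential is a power of an element of `G`
      let N : ℕ → ℕ := fun n => ⌊τ / ‖y (φ n)‖⌋₊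
      have hN : Tendsto (fun n => (N n : ℝ) * ‖y (φ n)‖) atTop (𝓝 τ) := by
        have h0 : Tendsto (fun n => ‖y (φ n)‖) atTop (𝓝 0) := hylim.comp hφ.tendsto_atTop
        have h1 : Tendsto (fun n => τ - ‖y (φ n)‖) atTop (𝓝 τ) := by
          simpa using h0.const_sub τ
        refine tendsto_of_tendsto_of_tendsto_of_le_of_le h1 tendsto_const_nhds
          (fun n => ?_) (fun n => ?_)
        · have := Nat.lt_floor_add_one (τ / ‖y (φ n)‖)
          rw [div_lt_iff₀ (hpos _)] at this
          simp only [N]; linarith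
        · have := Nat.floor_le (show 0 ≤ τ / ‖y (φ n)‖ by positivity)
          rw [le_div_iff₀ (hpos _)] at this
          exact this
      have h2 : Tendsto (fun n => (((N n : ℝ) * ‖y (φ n)‖ : ℝ) : ℂ) • z (φ n)) atTop
          (𝓝 ((τ : ℂ) • Y)) :=
        ((Complex.continuous_ofReal.tendsto τ).comp hN).smul hlim
      let _ : NormedAlgebra ℚ E := NormedAlgebra.restrictScalars ℚ ℂ E
      refine hG.mem_of_tendsto ((exp_continuous.tendsto _).comp h2)
        (Eventually.of_forall fun n => ?_)
      have h3 : (((N n : ℝ) * ‖y (φ n)‖ : ℝ) : ℂ) • z (φ n) = (N n : ℂ) • y (φ n) := by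
        simp only [z]
        rw [smul_smul, ← Complex.ofReal_mul, mul_assoc, mul_inv_cancel₀ (hpos _).ne', mul_one]
        simp
      change exp ((((N n : ℝ) * ‖y (φ n)‖ : ℝ) : ℂ) • z (φ n)) ∈ G
      rw [h3, exp_natCast_smul]
      exact G.pow_mem (hyG _) _
    have hYk : Y ∈ k := by
      refine hk' Y fun τ => ?_
      rcases le_total 0 τ with h | h
      · exact hpow τ h
      · have := hinv _ (hpow (-τ) (by linarith))
        simpa using this
    have hY0 := Submodule.disjoint_def.1 hm.disjoint Y hYk hYm
    rw [hY0] at hY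
    simp at hY
  obtain ⟨ε, hε, hclaim⟩ := claim
  -- `(x, y) ↦ exp x exp y` is a submersion at the origin of `k × m`
  let Ψ : k × m → E := fun q => exp (q.1 : E) * exp (q.2 : E)
  let F : k × m →L[ℂ] E :=
    k.subtypeL.comp (ContinuousLinearMap.fst ℂ k m) +
      m.subtypeL.comp (ContinuousLinearMap.snd ℂ k m)
  have hF : HasStrictFDerivAt Ψ F 0 := by
    have h0 : HasStrictFDerivAt (exp : E → E) (1 : E →L[ℂ] E) 0 := hasStrictFDerivAt_exp_zero
    have h1 : HasStrictFDerivAt (fun q : k × m => exp (q.1 : E))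
        (k.subtypeL.comp (ContinuousLinearMap.fst ℂ k m)) 0 :=
      HasStrictFDerivAt.comp (0 : k × m)
        (f := fun q => (k.subtypeL.comp (ContinuousLinearMap.fst ℂ k m)) q)
        (by simpa using h0) (ContinuousLinearMap.hasStrictFDerivAt _)
    have h2 : HasStrictFDerivAt (fun q : k × m => exp (q.2 : E))
        (m.subtypeL.comp (ContinuousLinearMap.snd ℂ k m)) 0 :=
      HasStrictFDerivAt.comp (0 : k × m)
        (f := fun q => (m.subtypeL.comp (ContinuousLinearMap.snd ℂ k m)) q)
        (by simpa using h0) (ContinuousLinearMap.hasStrictFDerivAt _)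
    have h3 : HasStrictFDerivAt Ψ _ 0 := h1.mul' h2
    refine h3.congr_fderiv ?_
    ext v <;> simp [F]
  have hsurj : F.range = ⊤ := by
    rw [eq_top_iff]
    intro y _
    obtain ⟨b, hb, a, ha, rfl⟩ := Submodule.mem_sup.1
      (show y ∈ k ⊔ m by rw [hm.sup_eq_top]; trivial)
    exact ⟨(⟨b, hb⟩, ⟨a, ha⟩), rfl⟩
  have hmap := hF.map_nhds_eq_of_surj hsurj
  have hΨ0 : Ψ 0 = 1 := by simp [Ψ]
  rw [hΨ0] at hmap
  rw [← hmap]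
  have hball : ∀ᶠ q in 𝓝 (0 : k × m), ‖(q.2 : E)‖ < ε := by
    have : Tendsto (fun q : k × m => ‖(q.2 : E)‖) (𝓝 0) (𝓝 0) := by
      have h := (show Continuous fun q : k × m => ‖(q.2 : E)‖ by fun_prop).tendsto 0
      simpa using h
    exact this.eventually (gt_mem_nhds hε)
  refine eventually_map.2 (hball.mono fun q hq hqG => ⟨q.1, q.1.2, ?_⟩)
  have h1 : exp (q.2 : E) ∈ G := by
    have := G.mul_mem (hinv _ (hk _ q.1.2)) hqG
    simp only [Ψ] at this
    rwa [← mul_assoc, exp_neg_mul_exp, one_mul] at this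
  have h2 := hclaim _ q.2.2 hq h1
  simp [Ψ, h2]

end OneParameter

/-! ### Translations and representations -/

section Translations

variable {A : Type u} [CommRing A] [HopfAlgebra ℂ A]

theorem eq_of_forall_dual {a b : A} (h : ∀ m : ConvDual A, m a = m b) : a = b := by
  rw [← sub_eq_zero, ← Module.forall_dual_apply_eq_zero_iff ℂ]
  intro φ
  have := h (WithConv.toConv φ)
  rw [map_sub, sub_eq_zero]
  exact this

/-- Right translation of functions by a functional `m`: `f ↦ f₍₁₎ m(f₍₂₎)`. For a point this is
the translation action, for a tangent vector the left invariant vector field. -/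
def rightTr (m : ConvDual A) : A →ₗ[ℂ] A :=
  (TensorProduct.rid ℂ A).toLinearMap ∘ₗ LinearMap.lTensor A m.ofConv ∘ₗ Coalgebra.comul

/-- Left translation of functions by a functional `m`: `f ↦ m(f₍₁₎) f₍₂₎`. -/
def leftTr (m : ConvDual A) : A →ₗ[ℂ] A :=
  (TensorProduct.lid ℂ A).toLinearMap ∘ₗ LinearMap.rTensor A m.ofConv ∘ₗ Coalgebra.comul

theorem conv_apply_rightTr (l m : ConvDual A) (f : A) : (l * m) f = l (rightTr m f) := by
  have h : ∀ T : A ⊗[ℂ] A, tensorFun l.ofConv m.ofConv T =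
      l.ofConv (TensorProduct.rid ℂ A (LinearMap.lTensor A m.ofConv T)) := by
    intro T
    induction T with
    | zero => simp
    | tmul a b => simp [mul_comm]
    | add s t hs ht => simp only [map_add, hs, ht]
  exact h _

theorem conv_apply_leftTr (l m : ConvDual A) (f : A) : (l * m) f = m (leftTr l f) := by
  have h : ∀ T : A ⊗[ℂ] A, tensorFun l.ofConv m.ofConv T =
      m.ofConv (TensorProduct.lid ℂ A (LinearMap.rTensor A l.ofConv T)) := by
    intro T
    induction T with
    | zero => simp
    | tmul a b => simp
    | add s t hs ht => simp only [map_add, hs, ht]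
  exact h _

theorem conv_one_apply (f : A) : (1 : ConvDual A) f = Coalgebra.counit (R := ℂ) f := rfl

theorem conv_add_apply (l m : ConvDual A) (f : A) : (l + m) f = l f + m f := rfl

theorem conv_smul_apply (c : ℂ) (m : ConvDual A) (f : A) : (c • m) f = c * m f := rfl

theorem rightTr_one : rightTr (1 : ConvDual A) = LinearMap.id :=
  LinearMap.ext fun f => eq_of_forall_dual fun l => by
    rw [← conv_apply_rightTr, mul_one, LinearMap.id_apply]

theorem rightTr_mul (l m : ConvDual A) (f : A) : rightTr (l * m) f = rightTr l (rightTr m f) :=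
  eq_of_forall_dual fun k => by
    rw [← conv_apply_rightTr, ← conv_apply_rightTr, ← conv_apply_rightTr, mul_assoc]

theorem rightTr_add (l m : ConvDual A) (f : A) :
    rightTr (l + m) f = rightTr l f + rightTr m f :=
  eq_of_forall_dual fun k => by
    have : k (rightTr l f + rightTr m f) = k (rightTr l f) + k (rightTr m f) := map_add k.ofConv _ _
    rw [this, ← conv_apply_rightTr, ← conv_apply_rightTr, ← conv_apply_rightTr, mul_add,
      conv_add_apply]

theorem rightTr_smul (c : ℂ) (m : ConvDual A) (f : A) :
    rightTr (c • m) f = c • rightTr m f :=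
  eq_of_forall_dual fun k => by
    have : k (c • rightTr m f) = c * k (rightTr m f) := map_smul k.ofConv _ _
    rw [this, ← conv_apply_rightTr, ← conv_apply_rightTr, mul_smul_comm, conv_smul_apply]

variable (A) in
/-- The convolution algebra acts on functions by right translations. -/
def rightTrHom : ConvDual A →ₐ[ℂ] Module.End ℂ A :=
  AlgHom.ofLinearMap
    { toFun := rightTr
      map_add' := fun l m => LinearMap.ext fun f => rightTr_add l m f
      map_smul' := fun c m => LinearMap.ext fun f => rightTr_smul c m f }
    rightTr_one (fun l m => LinearMap.ext fun f => rightTr_mul l m f)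

theorem rightTrHom_apply (m : ConvDual A) (f : A) : rightTrHom A m f = rightTr m f := rfl

theorem conv_pow_apply (x : ConvDual A) (n : ℕ) (f : A) :
    (x ^ n) f = Coalgebra.counit (R := ℂ) ((rightTrHom A x ^ n) f) := by
  have h := conv_apply_rightTr 1 (x ^ n) f
  rw [one_mul, conv_one_apply, ← rightTrHom_apply, map_pow] at h
  exact h

/-- The action of `G` on its regular functions by right translations is locally finite. -/
theorem exists_finite_rightTr_stable (f : A) : ∃ V : Submodule ℂ A, Module.Finite ℂ V ∧ f ∈ V ∧
    ∀ m : ConvDual A, ∀ v ∈ V, rightTr m v ∈ V := by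
  let V : Submodule ℂ A := LinearMap.range ((rightTrHom A).toLinearMap.flip f)
  refine ⟨V, ?_, ⟨1, ?_⟩, ?_⟩
  · have h : ∀ T : A ⊗[ℂ] A, ∃ W : Submodule ℂ A, FiniteDimensional ℂ W ∧ ∀ φ : A →ₗ[ℂ] ℂ,
        TensorProduct.rid ℂ A (LinearMap.lTensor A φ T) ∈ W := by
      intro T
      induction T with
      | zero => exact ⟨⊥, inferInstance, by simp⟩
      | tmul a b =>
        exact ⟨Submodule.span ℂ {a}, inferInstance, fun φ => by
          simpa using Submodule.smul_mem _ (φ b) (Submodule.mem_span_singleton_self a)⟩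
      | add S T hS hT =>
        obtain ⟨W₁, _, h₁⟩ := hS
        obtain ⟨W₂, _, h₂⟩ := hT
        refine ⟨W₁ ⊔ W₂, inferInstance, fun φ => ?_⟩
        rw [map_add, map_add]
        exact Submodule.add_mem_sup (h₁ φ) (h₂ φ)
    obtain ⟨W, hW, hW'⟩ := h (Coalgebra.comul (R := ℂ) f)
    refine Submodule.finiteDimensional_of_le (S₂ := W) ?_
    rintro _ ⟨m, rfl⟩
    exact hW' m.ofConv
  · change rightTr 1 f = f
    rw [rightTr_one]; rfl
  · rintro m _ ⟨l, rfl⟩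
    exact ⟨m * l, rightTr_mul m l f⟩

/-- The endomorphisms of `ℂⁿ`, with the operator norm. -/
abbrev Mat (n : ℕ) := (Fin n → ℂ) →L[ℂ] (Fin n → ℂ)

/-- A finite dimensional representation of the convolution algebra whose matrix coefficients are
given by regular functions. -/
def HasRegularCoeffs {n : ℕ} (ρ : ConvDual A →ₐ[ℂ] Mat n) : Prop :=
  ∀ (v : Fin n → ℂ) (i : Fin n), ∃ f : A, ∀ m : ConvDual A, ρ m v i = m f

/-- Evaluation at `f` factors through the representation `ρ`. -/
def IsCoeff {n : ℕ} (ρ : ConvDual A →ₐ[ℂ] Mat n) (f : A) : Prop :=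
  ∃ ℓ : Mat n →L[ℂ] ℂ, ∀ m : ConvDual A, m f = ℓ (ρ m)

/-- Finitely many regular functions are matrix coefficients of a common finite dimensional
representation. -/
theorem exists_rep (s : Finset A) : ∃ (n : ℕ) (ρ : ConvDual A →ₐ[ℂ] Mat n),
    HasRegularCoeffs ρ ∧ ∀ f ∈ s, IsCoeff ρ f := by
  choose V hfin hmem hstab using exists_finite_rightTr_stable (A := A)
  let U : Submodule ℂ A := ⨆ f : s, V f
  have hU : Module.Finite ℂ U := by
    have := fun f : s => hfin f
    exact Submodule.finite_iSup _
  have hUs : ∀ m : ConvDual A, ∀ v ∈ U, rightTrHom A m v ∈ U := by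
    intro m v hv
    have h1 : U ≤ U.comap (rightTr m) := iSup_le fun f v hv =>
      (le_iSup (fun f : s => V f) f) (hstab f m v hv)
    exact h1 hv
  let b := (Module.finBasis ℂ U).equivFun
  let ρ₀ : ConvDual A →ₐ[ℂ] Module.End ℂ U := AlgHom.ofLinearMap
    { toFun := fun m => (rightTrHom A m).restrict (hUs m)
      map_add' := fun l m => by ext; simp
      map_smul' := fun c m => by ext; simp }
    (by ext; simp) (fun l m => by ext; simp)
  let ρ : ConvDual A →ₐ[ℂ] Mat (Module.finrank ℂ U) :=
    (Module.End.toContinuousLinearMap (Fin (Module.finrank ℂ U) → ℂ)).toAlgHom.comp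
      (b.conjAlgEquiv ℂ |>.toAlgHom.comp ρ₀)
  have hρ : ∀ m v, ρ m v = b ⟨rightTr m (b.symm v), hUs m _ (b.symm v).2⟩ := fun m v => rfl
  refine ⟨_, ρ, ?_, ?_⟩
  · intro v i
    obtain ⟨ξ, hξ⟩ := LinearMap.exists_extend (LinearMap.proj i ∘ₗ b.toLinearMap)
    refine ⟨leftTr (WithConv.toConv ξ) (b.symm v), fun m => ?_⟩
    rw [hρ, ← conv_apply_leftTr, conv_apply_rightTr]
    exact (LinearMap.congr_fun hξ _).symm
  · intro f hf
    have hfU : f ∈ U := (le_iSup (fun f : s => V f) ⟨f, hf⟩) (hmem f)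
    let ℓ : Mat (Module.finrank ℂ U) →ₗ[ℂ] ℂ :=
      { toFun := fun T => Coalgebra.counit (R := ℂ) (b.symm (T (b ⟨f, hfU⟩)) : A)
        map_add' := fun S T => by simp
        map_smul' := fun c T => by simp }
    refine ⟨LinearMap.toContinuousLinearMap ℓ, fun m => ?_⟩
    have h1 : m f = Coalgebra.counit (R := ℂ) (rightTr m f) := by
      rw [← conv_one_apply, ← conv_apply_rightTr, one_mul]
    rw [h1]
    change _ = Coalgebra.counit (R := ℂ) (b.symm (ρ m (b ⟨f, hfU⟩)) : A)
    rw [hρ]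
    simp

end Translations

/-! ### Points and the exponential map -/

section Exponential

open Filter Topology

variable {A : Type u} [CommRing A] [HopfAlgebra ℂ A]

/-- A point of `G`, as an element of the convolution algebra. -/
def pointFun (g : Points A) : ConvDual A := WithConv.toConv g.ofConv.toLinearMap

theorem pointFun_one : pointFun (1 : Points A) = 1 := rfl

theorem pointFun_mul (g h : Points A) : pointFun (g * h) = pointFun g * pointFun h := rfl

theorem points_one_apply (f : A) : (1 : Points A) f = Coalgebra.counit (R := ℂ) f := rfl

theorem points_mul_apply_rightTr (g h : Points A) (f : A) :
    (g * h) f = g (rightTr (pointFun h) f) :=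
  conv_apply_rightTr (pointFun g) (pointFun h) f

theorem points_mul_apply_leftTr (g h : Points A) (f : A) :
    (g * h) f = h (leftTr (pointFun g) f) :=
  conv_apply_leftTr (pointFun g) (pointFun h) f

theorem points_ext {g h : Points A} (e : ∀ f, g f = h f) : g = h :=
  WithConv.ext (AlgHom.ext e)

theorem continuous_points_eval (f : A) : Continuous fun g : Points A => g f :=
  (continuous_apply f).comp continuous_induced_dom

theorem continuous_points_of_eval {X : Type*} [TopologicalSpace X] {φ : X → Points A}
    (h : ∀ f, Continuous fun x => φ x f) : Continuous φ :=
  continuous_induced_rng.2 (continuous_pi h)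

theorem continuous_points_mul_left (g : Points A) : Continuous fun h : Points A => g * h :=
  continuous_points_of_eval fun f => by
    simp only [points_mul_apply_leftTr]
    exact continuous_points_eval _

/-- A tangent vector acts by a derivation, the corresponding left invariant vector field. -/
theorem rightTr_leibniz {x : ConvDual A} (hx : IsPointDerivation x.ofConv) (f g : A) :
    rightTr x (f * g) = rightTr x f * g + f * rightTr x g := by
  let r : ConvDual A → A ⊗[ℂ] A →ₗ[ℂ] A := fun m =>
    (TensorProduct.rid ℂ A).toLinearMap ∘ₗ LinearMap.lTensor A m.ofConv
  have h : ∀ S T : A ⊗[ℂ] A, r x (S * T) = r x S * r 1 T + r 1 S * r x T := by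
    intro S T
    induction S with
    | zero => simp
    | add s t hs ht => simp only [add_mul, map_add, hs, ht]; ring
    | tmul a b =>
      induction T with
      | zero => simp
      | add s t hs ht => simp only [mul_add, map_add, hs, ht]; ring
      | tmul c d =>
        have e1 : ∀ b : A, (1 : ConvDual A).ofConv b = Coalgebra.counit (R := ℂ) b := fun _ => rfl
        simp only [r, Algebra.TensorProduct.tmul_mul_tmul, LinearMap.comp_apply,
          LinearMap.lTensor_tmul, hx b d, LinearEquiv.coe_coe, TensorProduct.rid_tmul, e1,
          Algebra.smul_def, map_add, map_mul]
        ring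
  have h1 : ∀ f : A, r 1 (Coalgebra.comul (R := ℂ) f) = f := fun f =>
    LinearMap.congr_fun rightTr_one f
  have h2 := h (Coalgebra.comul (R := ℂ) f) (Coalgebra.comul (R := ℂ) g)
  rw [h1, h1, ← Bialgebra.comul_mul] at h2
  exact h2

/-- Leibniz's formula for the powers of a derivation. -/
theorem derivation_pow_mul {D : Module.End ℂ A} (hD : ∀ f g, D (f * g) = D f * g + f * D g)
    (n : ℕ) (f g : A) : (D ^ n) (f * g) =
      ∑ q ∈ Finset.HasAntidiagonal.antidiagonal n, n.choose q.1 • ((D ^ q.1) f * (D ^ q.2) g) := by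
  let L : Module.End ℂ (A ⊗[ℂ] A) := LinearMap.rTensor A D
  let R : Module.End ℂ (A ⊗[ℂ] A) := LinearMap.lTensor A D
  have hc : Commute L R := by
    change L * R = R * L
    ext a b
    simp [L, R]
  have hL : ∀ n a b, (L ^ n) (a ⊗ₜ[ℂ] b) = ((D ^ n) a) ⊗ₜ b := by
    intro n a b
    induction n with
    | zero => simp
    | succ n ih => rw [pow_succ', Module.End.mul_apply, ih, pow_succ']; rfl
  have hR : ∀ n a b, (R ^ n) (a ⊗ₜ[ℂ] b) = a ⊗ₜ ((D ^ n) b) := by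
    intro n a b
    induction n with
    | zero => simp
    | succ n ih => rw [pow_succ', Module.End.mul_apply, ih, pow_succ']; rfl
  have hmul : ∀ T, D (LinearMap.mul' ℂ A T) = LinearMap.mul' ℂ A ((L + R) T) := by
    intro T
    induction T with
    | zero => simp
    | tmul a b => simp [L, R, hD]
    | add s t hs ht => rw [map_add, map_add, hs, ht, map_add, map_add]
  have hpow : ∀ n T, (D ^ n) (LinearMap.mul' ℂ A T) = LinearMap.mul' ℂ A (((L + R) ^ n) T) := by
    intro n T
    induction n with
    | zero => simp
    | succ n ih =>
      rw [pow_succ', Module.End.mul_apply, ih, hmul, pow_succ' (L + R), Module.End.mul_apply]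
  have h1 := hpow n (f ⊗ₜ g)
  rw [LinearMap.mul'_apply] at h1
  rw [h1, hc.add_pow']
  simp only [LinearMap.sum_apply, map_sum]
  refine Finset.sum_congr rfl fun q _ => ?_
  rw [LinearMap.smul_apply, map_nsmul, Module.End.mul_apply, hR, hL, LinearMap.mul'_apply]

theorem tangent_pow_mul (x : tangent A) (n : ℕ) (f g : A) : ((x : ConvDual A) ^ n) (f * g) =
    ∑ q ∈ Finset.HasAntidiagonal.antidiagonal n, (n.choose q.1 : ℂ) *
      (((x : ConvDual A) ^ q.1) f * ((x : ConvDual A) ^ q.2) g) := by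
  simp only [conv_pow_apply]
  rw [derivation_pow_mul (D := rightTrHom A (x : ConvDual A))
    (fun f g => rightTr_leibniz x.2 f g), map_sum]
  refine Finset.sum_congr rfl fun q _ => ?_
  rw [map_nsmul, Bialgebra.counit_mul, nsmul_eq_mul]

theorem tangent_pow_one (x : tangent A) (n : ℕ) (hn : n ≠ 0) :
    ((x : ConvDual A) ^ n) (1 : A) = 0 := by
  have h1 : rightTr (x : ConvDual A) (1 : A) = 0 := by
    have := rightTr_leibniz x.2 (1 : A) 1
    rw [mul_one, mul_one, one_mul] at this
    exact left_eq_add.mp this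
  obtain ⟨n, rfl⟩ := Nat.exists_eq_succ_of_ne_zero hn
  rw [Nat.succ_eq_add_one, pow_succ, conv_apply_rightTr, h1]
  exact map_zero ((x : ConvDual A) ^ n).ofConv

/-- The Taylor expansion at `t = 0` of `t ↦ f (exp (t x))`, as a linear map in `f`. -/
def expTaylorLin (x : tangent A) : A →ₗ[ℂ] PowerSeries ℂ where
  toFun f := PowerSeries.mk fun n => ((n.factorial : ℂ))⁻¹ * ((x : ConvDual A) ^ n) f
  map_add' f g := by
    ext n
    simp only [PowerSeries.coeff_mk, map_add, mul_add]
  map_smul' c f := by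
    ext n
    simp only [PowerSeries.coeff_mk, map_smul, smul_eq_mul, RingHom.id_apply]
    ring

theorem coeff_expTaylorLin (x : tangent A) (f : A) (n : ℕ) :
    PowerSeries.coeff n (expTaylorLin x f) = ((n.factorial : ℂ))⁻¹ * ((x : ConvDual A) ^ n) f := by
  change PowerSeries.coeff n (PowerSeries.mk fun n =>
    ((n.factorial : ℂ))⁻¹ * ((x : ConvDual A) ^ n) f) = _
  rw [PowerSeries.coeff_mk]

/-- The Taylor expansion at `t = 0` of `t ↦ f (exp (t x))`, an algebra homomorphism in `f`. -/
def expTaylor (x : tangent A) : A →ₐ[ℂ] PowerSeries ℂ :=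
  AlgHom.ofLinearMap (expTaylorLin x)
    (by
      ext n
      rw [coeff_expTaylorLin, PowerSeries.coeff_one]
      split_ifs with hn
      · subst hn
        simp
      · rw [tangent_pow_one x n hn, mul_zero])
    (fun f g => by
      ext n
      rw [coeff_expTaylorLin, PowerSeries.coeff_mul, tangent_pow_mul, Finset.mul_sum]
      refine Finset.sum_congr rfl fun q hq => ?_
      rw [coeff_expTaylorLin, coeff_expTaylorLin]
      have hq' := Finset.HasAntidiagonal.mem_antidiagonal.1 hq
      have h1 : q.1.factorial * q.2.factorial * n.choose q.1 = n.factorial := by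
        have := Nat.choose_mul_factorial_mul_factorial (Nat.le_add_right q.1 q.2)
        rw [Nat.add_sub_cancel_left, hq'] at this
        rw [← this]; ring
      have h2 : (q.1.factorial : ℂ) * q.2.factorial * n.choose q.1 = n.factorial := by
        exact_mod_cast h1
      have h3 : (q.1.factorial : ℂ) ≠ 0 := by exact_mod_cast q.1.factorial_ne_zero
      have h4 : (q.2.factorial : ℂ) ≠ 0 := by exact_mod_cast q.2.factorial_ne_zero
      have h5 : (n.factorial : ℂ) ≠ 0 := by exact_mod_cast n.factorial_ne_zero
      field_simp
      rw [← h2]; ring)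

theorem coeff_expTaylor (x : tangent A) (f : A) (n : ℕ) :
    PowerSeries.coeff n (expTaylor x f) = ((n.factorial : ℂ))⁻¹ * ((x : ConvDual A) ^ n) f :=
  coeff_expTaylorLin x f n

theorem HasRegularCoeffs.eq_of_forall {n : ℕ} {ρ : ConvDual A →ₐ[ℂ] Mat n}
    (hρ : HasRegularCoeffs ρ) {m : ConvDual A} {T : Mat n}
    (h : ∀ v i f, (∀ m : ConvDual A, ρ m v i = m f) → m f = T v i) : ρ m = T := by
  ext v i
  obtain ⟨f, hf⟩ := hρ v i
  rw [hf, h v i f hf]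

theorem IsCoeff.hasSum {n : ℕ} {ρ : ConvDual A →ₐ[ℂ] Mat n} {f : A} {ℓ : Mat n →L[ℂ] ℂ}
    (hℓ : ∀ m : ConvDual A, m f = ℓ (ρ m)) (x : ConvDual A) :
    HasSum (fun n : ℕ => ((n.factorial : ℂ))⁻¹ * (x ^ n) f) (ℓ (NormedSpace.exp (ρ x))) := by
  have := (NormedSpace.exp_series_hasSum_exp' (𝕂 := ℂ) (ρ x)).mapL ℓ
  refine this.congr_fun fun n => ?_
  rw [map_smul, ← map_pow, ← hℓ, smul_eq_mul]

theorem IsExp.rep_eq {n : ℕ} {ρ : ConvDual A →ₐ[ℂ] Mat n} (hρ : HasRegularCoeffs ρ)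
    {x : tangent A} {g : Points A} (h : IsExp x g) :
    ρ (pointFun g) = NormedSpace.exp (ρ x) := by
  refine hρ.eq_of_forall fun v i f hf => ?_
  let ℓ : Mat n →L[ℂ] ℂ :=
    (ContinuousLinearMap.proj i).comp (ContinuousLinearMap.apply ℂ (Fin n → ℂ) v)
  exact (h f).unique (IsCoeff.hasSum (ℓ := ℓ) (fun m => (hf m).symm) x)

theorem summable_expTaylor (x : ConvDual A) (f : A) :
    Summable fun n : ℕ => ((n.factorial : ℂ))⁻¹ * (x ^ n) f := by
  obtain ⟨n, ρ, -, hs⟩ := exists_rep {f}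
  obtain ⟨ℓ, hℓ⟩ := hs f (Finset.mem_singleton_self f)
  exact (IsCoeff.hasSum hℓ x).summable

/-- Exponentials exist: the sum of the exponential series at `f` converges because `f` is a matrix
coefficient, and it is multiplicative in `f` because the Taylor expansion is. -/
theorem exists_isExp (x : tangent A) : ∃ g : Points A, IsExp x g := by
  have hs := fun f : A => summable_expTaylor (x : ConvDual A) f
  have hs' : ∀ f, Summable fun n => PowerSeries.coeff n (expTaylor x f) := fun f => by
    simpa only [coeff_expTaylor] using hs f
  let φ : A →ₗ[ℂ] ℂ :=
    { toFun := fun f => ∑' n, PowerSeries.coeff n (expTaylor x f)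
      map_add' := fun f g => by
        simp only [map_add]
        exact (hs' f).tsum_add (hs' g)
      map_smul' := fun c f => by
        simp only [map_smul, smul_eq_mul, RingHom.id_apply]
        exact tsum_mul_left }
  let g : A →ₐ[ℂ] ℂ := AlgHom.ofLinearMap φ (by
      change ∑' n, PowerSeries.coeff n (expTaylor x 1) = 1
      rw [map_one, tsum_eq_single 0]
      · simp
      · intro n hn; rw [PowerSeries.coeff_one, if_neg hn])
    (fun f g => by
      change ∑' n, PowerSeries.coeff n (expTaylor x (f * g)) =
        (∑' n, PowerSeries.coeff n (expTaylor x f)) * ∑' n, PowerSeries.coeff n (expTaylor x g)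
      rw [tsum_mul_tsum_eq_tsum_sum_antidiagonal_of_summable_norm (hs' f).norm (hs' g).norm]
      simp only [map_mul, PowerSeries.coeff_mul])
  refine ⟨WithConv.toConv g, fun f => ?_⟩
  have h1 : HasSum (fun n => PowerSeries.coeff n (expTaylor x f)) (g f) := (hs' f).hasSum
  exact h1.congr_fun fun n => (coeff_expTaylor x f n).symm

theorem IsExp.unique {x : tangent A} {g h : Points A} (hg : IsExp x g) (hh : IsExp x h) : g = h :=
  points_ext fun f => (hg f).unique (hh f)

/-- A representation whose coefficients generate the algebra of functions; it embeds both `G` and its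
Lie algebra in a matrix algebra. -/
theorem exists_faithful_rep [Algebra.FiniteType ℂ A] : ∃ (n : ℕ) (ρ : ConvDual A →ₐ[ℂ] Mat n),
    HasRegularCoeffs ρ ∧ Algebra.adjoin ℂ {f | IsCoeff ρ f} = ⊤ := by
  obtain ⟨s, hs⟩ := (inferInstance : Algebra.FiniteType ℂ A).out
  obtain ⟨n, ρ, hρ, h⟩ := exists_rep s
  exact ⟨n, ρ, hρ, top_unique (hs ▸ Algebra.adjoin_mono h)⟩

variable {n : ℕ} {ρ : ConvDual A →ₐ[ℂ] Mat n}

theorem points_eq_of_rep_eq (hgen : Algebra.adjoin ℂ {f | IsCoeff ρ f} = ⊤) {g h : Points A}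
    (e : ρ (pointFun g) = ρ (pointFun h)) : g = h := by
  refine WithConv.ext (AlgHom.ext_of_adjoin_eq_top hgen ?_)
  rintro f ⟨ℓ, hℓ⟩
  have h1 := hℓ (pointFun g)
  rw [e, ← hℓ] at h1
  exact h1

/-- A tangent vector is determined by its values on generators. -/
theorem tangent_eq_zero_of_adjoin {s : Set A} (hs : Algebra.adjoin ℂ s = ⊤) {x : tangent A}
    (h : ∀ f ∈ s, x.1 f = 0) : x = 0 := by
  have key : ∀ a : A, x.1.ofConv a = 0 := by
    intro a
    have ha : a ∈ Algebra.adjoin ℂ s := by rw [hs]; trivial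
    induction ha using Algebra.adjoin_induction with
    | mem b hb => exact h b hb
    | algebraMap c =>
      have h1 := tangent_pow_one x 1 one_ne_zero
      rw [pow_one] at h1
      have h2 : x.1.ofConv 1 = 0 := h1
      rw [Algebra.algebraMap_eq_smul_one, map_smul, h2, smul_zero]
    | add b c _ _ hb hc => rw [map_add, hb, hc, add_zero]
    | mul b c _ _ hb hc =>
      have h1 : x.1.ofConv (b * c) = _ := x.2 b c
      rw [h1, hb, hc, zero_mul, mul_zero, add_zero]
  exact Subtype.ext (WithConv.ext (LinearMap.ext key))

theorem tangent_eq_of_rep_eq (hgen : Algebra.adjoin ℂ {f | IsCoeff ρ f} = ⊤) {x y : tangent A}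
    (e : ρ x = ρ y) : x = y := by
  rw [← sub_eq_zero]
  refine tangent_eq_zero_of_adjoin hgen ?_
  rintro f ⟨ℓ, hℓ⟩
  change ((x : ConvDual A) - (y : ConvDual A)) f = 0
  rw [hℓ, map_sub, e, sub_self, map_zero]

theorem isExp_of_rep_eq (hρ : HasRegularCoeffs ρ)
    (hgen : Algebra.adjoin ℂ {f | IsCoeff ρ f} = ⊤) {x : tangent A} {g : Points A}
    (h : ρ (pointFun g) = NormedSpace.exp (ρ x)) : IsExp x g := by
  obtain ⟨g', hg'⟩ := exists_isExp x
  have : g = g' := points_eq_of_rep_eq hgen (h.trans (hg'.rep_eq hρ).symm)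
  rwa [this]

theorem rep_smul (t : ℂ) (x : tangent A) : ρ (t • x : tangent A) = t • ρ x := map_smul ρ t _

/-- Limits of points of `G` in the matrix algebra are points of `G`. -/
theorem exists_point_of_tendsto (hρ : HasRegularCoeffs ρ)
    (hgen : Algebra.adjoin ℂ {f | IsCoeff ρ f} = ⊤) {α : Type*} {l : Filter α} [l.NeBot]
    {g : α → Points A} {T : Mat n} (h : Tendsto (fun a => ρ (pointFun (g a))) l (𝓝 T)) :
    ∃ g₀ : Points A, ρ (pointFun g₀) = T ∧ ∀ f, Tendsto (fun a => g a f) l (𝓝 (g₀ f)) := by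
  have hlim : ∀ f : A, ∃ c : ℂ, Tendsto (fun a => g a f) l (𝓝 c) := by
    intro f
    have ha : f ∈ Algebra.adjoin ℂ {f | IsCoeff ρ f} := by rw [hgen]; trivial
    induction ha using Algebra.adjoin_induction with
    | mem b hb =>
      obtain ⟨ℓ, hℓ⟩ := hb
      refine ⟨ℓ T, ((ℓ.continuous.tendsto T).comp h).congr fun a => ?_⟩
      exact (hℓ (pointFun (g a))).symm
    | algebraMap c => exact ⟨c, by simp⟩
    | add b c _ _ hb hc =>
      obtain ⟨p, hp⟩ := hb
      obtain ⟨q, hq⟩ := hc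
      exact ⟨p + q, by simpa only [map_add] using hp.add hq⟩
    | mul b c _ _ hb hc =>
      obtain ⟨p, hp⟩ := hb
      obtain ⟨q, hq⟩ := hc
      exact ⟨p * q, by simpa only [map_mul] using hp.mul hq⟩
  choose c hc using hlim
  let φ : A →ₐ[ℂ] ℂ :=
    { toFun := c
      map_one' := tendsto_nhds_unique (hc 1) (by simp)
      map_mul' := fun f k => tendsto_nhds_unique (hc _)
        (by simpa only [map_mul] using (hc f).mul (hc k))
      map_zero' := tendsto_nhds_unique (hc 0) (by simp)
      map_add' := fun f k => tendsto_nhds_unique (hc _)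
        (by simpa only [map_add] using (hc f).add (hc k))
      commutes' := fun r => tendsto_nhds_unique (hc _) (by simp) }
  refine ⟨WithConv.toConv φ, hρ.eq_of_forall fun v i f hf => ?_, hc⟩
  refine tendsto_nhds_unique (hc f) ?_
  let ℓ : Mat n →L[ℂ] ℂ :=
    (ContinuousLinearMap.proj i).comp (ContinuousLinearMap.apply ℂ (Fin n → ℂ) v)
  exact ((ℓ.continuous.tendsto T).comp h).congr fun a => hf (pointFun (g a))

theorem continuous_rep_pointFun (hρ : HasRegularCoeffs ρ) :
    Continuous fun g : Points A => ρ (pointFun g) := by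
  rw [continuous_clm_apply]
  refine fun v => continuous_pi fun i => ?_
  obtain ⟨f, hf⟩ := hρ v i
  simp only [hf]
  exact continuous_points_eval f

end Exponential

/-! ### The Lie correspondence -/

section LieCorrespondence

open Filter Topology

variable {A : Type u} [CommRing A] [HopfAlgebra ℂ A]

theorem IsExp.hasDerivAt {x : tangent A} {g : ℂ → Points A} (h : ∀ t, IsExp (t • x) (g t))
    (f : A) : HasDerivAt (fun t => g t f) (x.1 f) 0 := by
  obtain ⟨n, ρ, -, hs⟩ := exists_rep {f}
  obtain ⟨ℓ, hℓ⟩ := hs f (Finset.mem_singleton_self f)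
  have h1 : ∀ t, g t f = ℓ (NormedSpace.exp (t • ρ x)) := fun t => by
    rw [← rep_smul]
    exact (h t f).unique (IsCoeff.hasSum hℓ _)
  have h2 := ℓ.hasFDerivAt.comp_hasDerivAt (0 : ℂ) (hasDerivAt_exp_smul_zero (ρ x))
  have h3 : x.1 f = ℓ (ρ x) := hℓ x
  rw [h3]
  exact h2.congr_of_eventuallyEq (Eventually.of_forall h1)

theorem IsExp.continuous {x : tangent A} {g : ℂ → Points A} (h : ∀ t, IsExp (t • x) (g t)) :
    Continuous g := by
  refine continuous_points_of_eval fun f => ?_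
  obtain ⟨n, ρ, -, hs⟩ := exists_rep {f}
  obtain ⟨ℓ, hℓ⟩ := hs f (Finset.mem_singleton_self f)
  have h1 : ∀ t, g t f = ℓ (NormedSpace.exp (t • ρ x)) := fun t => by
    rw [← rep_smul]
    exact (h t f).unique (IsCoeff.hasSum hℓ _)
  simp only [h1]
  exact ℓ.continuous.comp (continuous_exp_smul (ρ x))

/-- A space of functions that is stable under a vector field is stable under its flow. -/
theorem rightTr_mem_of_isExp {N : Submodule ℂ A} {x : tangent A} {g : Points A}
    (hx : ∀ f ∈ N, rightTr (x : ConvDual A) f ∈ N) (hg : IsExp x g) {f : A} (hf : f ∈ N) :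
    rightTr (pointFun g) f ∈ N := by
  rw [← Submodule.Quotient.mk_eq_zero, ← Module.forall_dual_apply_eq_zero_iff ℂ]
  intro ψ
  let φ : ConvDual A := WithConv.toConv (ψ ∘ₗ N.mkQ)
  have hφ : ∀ f ∈ N, φ f = 0 := fun f hf => by
    change ψ (Submodule.Quotient.mk f) = 0
    rw [(Submodule.Quotient.mk_eq_zero N).2 hf, map_zero]
  change φ (rightTr (pointFun g) f) = 0
  rw [← conv_apply_rightTr, conv_apply_leftTr]
  have hpow : ∀ n : ℕ, rightTr ((x : ConvDual A) ^ n) f ∈ N := by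
    intro n
    induction n with
    | zero => rw [pow_zero, rightTr_one]; exact hf
    | succ n ih => rw [pow_succ', rightTr_mul]; exact hx _ ih
  refine (hg (leftTr φ f)).unique ?_
  convert! hasSum_zero with n
  rw [← conv_apply_leftTr, conv_apply_rightTr, hφ _ (hpow n), mul_zero]

variable (A) in
theorem isExp_zero : IsExp (0 : tangent A) 1 := by
  intro f
  have h : ∀ n : ℕ, n ≠ 0 →
      ((n.factorial : ℂ))⁻¹ * (((0 : tangent A) : ConvDual A) ^ n) f = 0 := fun n hn => by
    have h0 : ((0 : tangent A) : ConvDual A) = 0 := rfl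
    rw [h0, zero_pow hn]
    exact mul_zero _
  have h1 := hasSum_single 0 h
  rwa [pow_zero, Nat.factorial_zero, Nat.cast_one, inv_one, one_mul, conv_one_apply,
    ← points_one_apply] at h1

theorem zero_mem_lieAlg (H : Subgroup (Points A)) : 0 ∈ lieAlg H := fun t =>
  ⟨1, H.one_mem, by rw [smul_zero]; exact isExp_zero A⟩

theorem smul_mem_lieAlg {H : Subgroup (Points A)} {x : tangent A} (hx : x ∈ lieAlg H) (c : ℂ) :
    c • x ∈ lieAlg H := fun t => by
  rw [smul_smul]; exact hx _

theorem lieAlg_mono {H K : Subgroup (Points A)} (h : H ≤ K) : lieAlg H ⊆ lieAlg K :=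
  fun _ hx t => (hx t).imp fun _ hg => ⟨h hg.1, hg.2⟩

theorem expSet_lieAlg_subset (H : Subgroup (Points A)) : expSet (lieAlg H) ⊆ H := by
  rintro g ⟨x, hx, hg⟩
  obtain ⟨g', hg', h⟩ := hx 1
  rw [one_smul] at h
  rwa [hg.unique h]

theorem expSet_mono {S T : Set (tangent A)} (h : S ⊆ T) : expSet S ⊆ expSet T :=
  fun _ ⟨x, hx, hg⟩ => ⟨x, h hx, hg⟩

theorem subset_lieAlg_closure {V : Set (tangent A)} (hV : ∀ c : ℂ, ∀ x ∈ V, c • x ∈ V) :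
    V ⊆ lieAlg (Subgroup.closure (expSet V)) := fun x hx t => by
  obtain ⟨g, hg⟩ := exists_isExp (t • x)
  exact ⟨g, Subgroup.subset_closure ⟨_, hV t x hx, hg⟩, hg⟩

theorem mul_apply_eq_zero_of_mem_vanishingIdeal {K : Subgroup (Points A)} {f : A}
    (hf : f ∈ vanishingIdeal K) {g : Points A} (hg : g ∈ K) :
    rightTr (pointFun g) f ∈ vanishingIdeal K ∧ leftTr (pointFun g) f ∈ vanishingIdeal K :=
  ⟨fun h hh => by rw [← points_mul_apply_rightTr]; exact hf _ (K.mul_mem hh hg),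
    fun h hh => by rw [← points_mul_apply_leftTr]; exact hf _ (K.mul_mem hg hh)⟩

theorem apply_eq_zero_of_mem_lieAlg {K : Subgroup (Points A)} {x : tangent A}
    (hx : x ∈ lieAlg K) {f : A} (hf : f ∈ vanishingIdeal K) : x.1 f = 0 := by
  choose g hgK hg using hx
  have h := IsExp.hasDerivAt hg f
  have h0 : (fun t => g t f) = fun _ => 0 := funext fun t => hf _ (hgK t)
  rw [h0] at h
  exact h.unique (hasDerivAt_const _ _)

theorem rightTr_mem_vanishingIdeal {K : Subgroup (Points A)} {x : tangent A}
    (hx : ∀ f ∈ vanishingIdeal K, x.1 f = 0) {f : A} (hf : f ∈ vanishingIdeal K) :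
    rightTr (x : ConvDual A) f ∈ vanishingIdeal K := fun g hg => by
  change pointFun g _ = 0
  rw [← conv_apply_rightTr, conv_apply_leftTr]
  exact hx _ (mul_apply_eq_zero_of_mem_vanishingIdeal hf hg).2

/-- The Lie algebra of a Zariski closed subgroup is given by the linearized equations. -/
theorem mem_lieAlg_iff {K : Subgroup (Points A)} (hK : IsZariskiClosed K) {x : tangent A} :
    x ∈ lieAlg K ↔ ∀ f ∈ vanishingIdeal K, x.1 f = 0 := by
  refine ⟨fun hx f hf => apply_eq_zero_of_mem_lieAlg hx hf, fun hx t => ?_⟩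
  obtain ⟨g, hg⟩ := exists_isExp (t • x)
  refine ⟨g, hK g fun f hf => ?_, hg⟩
  have hN : ∀ f ∈ (vanishingIdeal K).restrictScalars ℂ,
      rightTr ((t • x : tangent A) : ConvDual A) f ∈ (vanishingIdeal K).restrictScalars ℂ := by
    intro f hf
    have h2 : rightTr ((t • x : tangent A) : ConvDual A) f = t • rightTr (x : ConvDual A) f :=
      rightTr_smul t x.1 f
    rw [h2]
    exact Submodule.smul_mem _ t (rightTr_mem_vanishingIdeal hx hf)
  have h1 : rightTr (pointFun g) f ∈ vanishingIdeal K := rightTr_mem_of_isExp hN hg hf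
  have h3 := h1 1 K.one_mem
  rwa [← points_mul_apply_rightTr, one_mul] at h3

variable {n : ℕ} {ρ : ConvDual A →ₐ[ℂ] Mat n}

/-- The representation of the group of points. -/
def pointRep (ρ : ConvDual A →ₐ[ℂ] Mat n) : Points A →* Mat n where
  toFun g := ρ (pointFun g)
  map_one' := by rw [pointFun_one, map_one]
  map_mul' g h := by rw [pointFun_mul, map_mul]

theorem pointRep_apply (g : Points A) : pointRep ρ g = ρ (pointFun g) := rfl

theorem exp_rep_mem_iff (hρ : HasRegularCoeffs ρ)
    (hgen : Algebra.adjoin ℂ {f | IsCoeff ρ f} = ⊤) {H : Subgroup (Points A)} {x : tangent A} :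
    NormedSpace.exp (ρ x) ∈ H.toSubmonoid.map (pointRep ρ) ↔ ∃ g ∈ H, IsExp x g :=
  ⟨fun ⟨g, hg, e⟩ => ⟨g, hg, isExp_of_rep_eq hρ hgen e⟩, fun ⟨g, hg, e⟩ => ⟨g, hg, e.rep_eq hρ⟩⟩

/-- In a faithful representation, the Lie algebra of `H` consists of the tangent vectors whose
one-parameter group lies in the image of `H`. -/
theorem mem_lieAlg_iff_rep (hρ : HasRegularCoeffs ρ)
    (hgen : Algebra.adjoin ℂ {f | IsCoeff ρ f} = ⊤) {H : Subgroup (Points A)} {x : tangent A} :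
    x ∈ lieAlg H ↔
      ∀ t : ℂ, NormedSpace.exp (t • ρ x) ∈ H.toSubmonoid.map (pointRep ρ) := by
  refine forall_congr' fun t => ?_
  rw [← rep_smul, exp_rep_mem_iff hρ hgen]

theorem rep_lie (x y : tangent A) :
    ρ ((⁅x, y⁆ : tangent A) : ConvDual A) = ρ x * ρ y - ρ y * ρ x := by
  change ρ ((x : ConvDual A) * y - y * x) = _
  rw [map_sub, map_mul, map_mul]

theorem closure_expSet_lieAlg_le (H : Subgroup (Points A)) :
    Subgroup.closure (expSet (lieAlg H)) ≤ H :=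
  (Subgroup.closure_le _).2 (expSet_lieAlg_subset H)

/-- Each element of the group generated by `exp V` is joined to the unit by a product of
one-parameter groups. -/
theorem isConnected_closure_expSet {V : Set (tangent A)} (hV : ∀ c : ℂ, ∀ x ∈ V, c • x ∈ V) :
    IsConnected (Subgroup.closure (expSet V) : Set (Points A)) := by
  refine ⟨⟨1, Subgroup.one_mem _⟩, isPreconnected_of_forall 1 fun h hh => ?_⟩
  induction hh using Subgroup.closure_induction with
  | mem g hg =>
    obtain ⟨x, hx, hgx⟩ := hg
    choose c hc using fun t : ℂ => exists_isExp (t • x)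
    refine ⟨Set.range c, ?_, ⟨0, ?_⟩, ⟨1, ?_⟩, isPreconnected_range (IsExp.continuous hc)⟩
    · rintro _ ⟨t, rfl⟩
      exact Subgroup.subset_closure ⟨_, hV t x hx, hc t⟩
    · have := hc 0
      rw [zero_smul] at this
      exact this.unique (isExp_zero A)
    · have := hc 1
      rw [one_smul] at this
      exact this.unique hgx
  | one => exact ⟨{1}, by simp, rfl, rfl, isPreconnected_singleton⟩
  | mul a b ha hb iha ihb =>
    obtain ⟨s, hs, h1, h2, h3⟩ := iha
    obtain ⟨t, ht, k1, k2, k3⟩ := ihb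
    refine ⟨s ∪ (fun y => a * y) '' t, Set.union_subset hs ?_, Or.inl h1, Or.inr ⟨b, k2, rfl⟩,
      h3.union a h2 ⟨1, k1, mul_one a⟩ (k3.image _ (continuous_points_mul_left a).continuousOn)⟩
    rintro _ ⟨y, hy, rfl⟩
    exact Subgroup.mul_mem _ ha (ht hy)
  | inv a ha iha =>
    obtain ⟨s, hs, h1, h2, h3⟩ := iha
    refine ⟨(fun y => a⁻¹ * y) '' s, ?_, ⟨a, h2, inv_mul_cancel a⟩, ⟨1, h1, mul_one _⟩,
      h3.image _ (continuous_points_mul_left a⁻¹).continuousOn⟩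
    rintro _ ⟨y, hy, rfl⟩
    exact Subgroup.mul_mem _ (Subgroup.inv_mem _ ha) (hs hy)

variable [Algebra.FiniteType ℂ A]

theorem IsExp.mul {x : tangent A} {s t : ℂ} {g h : Points A} (hg : IsExp (s • x) g)
    (hh : IsExp (t • x) h) : IsExp ((s + t) • x) (g * h) := by
  obtain ⟨n, ρ, hρ, hgen⟩ := exists_faithful_rep (A := A)
  refine isExp_of_rep_eq hρ hgen ?_
  rw [pointFun_mul, map_mul, hg.rep_eq hρ, hh.rep_eq hρ, rep_smul, rep_smul, rep_smul]
  exact (exp_add_smul (ρ x) s t).symm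

theorem IsExp.inv {x : tangent A} {g : Points A} (hg : IsExp x g) : IsExp (-x) g⁻¹ := by
  obtain ⟨h, hh⟩ := exists_isExp (-x)
  have h1 := IsExp.mul (x := x) (s := 1) (t := -1) (g := g) (h := h) (by rwa [one_smul])
    (by rwa [neg_one_smul])
  rw [add_neg_cancel, zero_smul] at h1
  rw [inv_eq_of_mul_eq_one_right (h1.unique (isExp_zero A))]
  exact hh

/-- The Lie algebra of an arbitrary subgroup is a Lie subalgebra. -/
theorem exists_lieSubalgebra_eq_lieAlg (H : Subgroup (Points A)) :
    ∃ l : LieSubalgebra ℂ (tangent A), (l : Set (tangent A)) = lieAlg H := by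
  obtain ⟨n, ρ, hρ, hgen⟩ := exists_faithful_rep (A := A)
  obtain ⟨h, hh, hmem⟩ := exists_lie_oneParam (H.toSubmonoid.map (pointRep ρ))
  have key : ∀ x : tangent A, x ∈ lieAlg H ↔ ρ x ∈ h := fun x => by
    rw [hmem, mem_lieAlg_iff_rep hρ hgen]
  refine ⟨{ carrier := lieAlg H
            add_mem' := fun {x y} hx hy => ?_
            zero_mem' := zero_mem_lieAlg H
            smul_mem' := fun c x hx => smul_mem_lieAlg hx c
            lie_mem' := fun {x y} hx hy => ?_ }, rfl⟩
  · rw [key] at hx hy ⊢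
    have : ρ ((x + y : tangent A) : ConvDual A) = ρ x + ρ y := map_add ρ _ _
    rw [this]; exact h.add_mem hx hy
  · replace hx : x ∈ lieAlg H := hx
    replace hy : y ∈ lieAlg H := hy
    rw [key] at hx hy ⊢
    rw [rep_lie]
    exact hh _ hx _ hy

/-- The group generated by `exp l` for a Lie subalgebra `l` has no larger Lie algebra than `l`,
although it need not be closed. -/
theorem lieAlg_closure_expSet_subset (l : LieSubalgebra ℂ (tangent A)) :
    lieAlg (Subgroup.closure (expSet (l : Set (tangent A)))) ⊆ l := by
  obtain ⟨n, ρ, hρ, hgen⟩ := exists_faithful_rep (A := A)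
  let h : Submodule ℂ (Mat n) := l.toSubmodule.map (ρ.toLinearMap ∘ₗ (tangent A).toSubmodule.subtype)
  have hmem : ∀ T, T ∈ h ↔ ∃ x : tangent A, x ∈ l ∧ ρ (x : ConvDual A) = T := fun T => Iff.rfl
  have hh : ∀ X ∈ h, ∀ Y ∈ h, X * Y - Y * X ∈ h := by
    intro X hX Y hY
    obtain ⟨x, hx, rfl⟩ := (hmem _).1 hX
    obtain ⟨y, hy, rfl⟩ := (hmem _).1 hY
    exact (hmem _).2 ⟨⁅x, y⁆, l.lie_mem hx hy, rep_lie x y⟩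
  have hle : ∀ g ∈ Subgroup.closure (expSet (l : Set (tangent A))),
      ρ (pointFun g) ∈ Submonoid.closure (NormedSpace.exp '' (h : Set (Mat n))) ∧
      ρ (pointFun g⁻¹) ∈ Submonoid.closure (NormedSpace.exp '' (h : Set (Mat n))) := by
    intro g hg
    induction hg using Subgroup.closure_induction with
    | mem g hg =>
      obtain ⟨x, hx, hgx⟩ := hg
      refine ⟨Submonoid.subset_closure ⟨ρ x, ⟨x, hx, rfl⟩, (hgx.rep_eq hρ).symm⟩,
        Submonoid.subset_closure ⟨ρ (-x : tangent A), ⟨-x, l.neg_mem hx, rfl⟩,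
          (hgx.inv.rep_eq hρ).symm⟩⟩
    | one =>
      rw [inv_one, pointFun_one, map_one]
      exact ⟨Submonoid.one_mem _, Submonoid.one_mem _⟩
    | mul a b _ _ ha hb =>
      rw [mul_inv_rev, pointFun_mul, pointFun_mul, map_mul, map_mul]
      exact ⟨Submonoid.mul_mem _ ha.1 hb.1, Submonoid.mul_mem _ hb.2 ha.2⟩
    | inv a _ ha => rw [inv_inv]; exact ⟨ha.2, ha.1⟩
  intro x hx
  rw [mem_lieAlg_iff_rep hρ hgen] at hx
  have h1 : ρ x ∈ h := mem_of_exp_smul_mem_closure hh fun t => by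
    obtain ⟨g, hg, e⟩ := hx t
    rw [← e]
    exact (hle g hg).1
  obtain ⟨y, hy, e⟩ := (hmem _).1 h1
  rwa [← tangent_eq_of_rep_eq hgen e]

theorem lieSpan_subset_lieAlg_closure {V : Set (tangent A)}
    (hV : ∀ c : ℂ, ∀ x ∈ V, c • x ∈ V) :
    (LieSubalgebra.lieSpan ℂ (tangent A) V : Set (tangent A)) ⊆
      lieAlg (Subgroup.closure (expSet V)) := by
  obtain ⟨l, hl⟩ := exists_lieSubalgebra_eq_lieAlg (Subgroup.closure (expSet V))
  rw [← hl]
  refine LieSubalgebra.lieSpan_le.2 ?_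
  rw [hl]
  exact subset_lieAlg_closure hV

/-- The group generated by `exp V` is the one generated by `exp` of the Lie algebra generated
by `V`. -/
theorem closure_expSet_lieSpan {V : Set (tangent A)} (hV : ∀ c : ℂ, ∀ x ∈ V, c • x ∈ V) :
    Subgroup.closure (expSet (LieSubalgebra.lieSpan ℂ (tangent A) V : Set (tangent A))) =
      Subgroup.closure (expSet V) := by
  refine le_antisymm ((Subgroup.closure_le _).2 ?_)
    (Subgroup.closure_mono (expSet_mono LieSubalgebra.subset_lieSpan))
  exact (expSet_mono (lieSpan_subset_lieAlg_closure hV)).trans (expSet_lieAlg_subset _)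

/-- The Lie algebra of the group generated by `exp V` is the Lie algebra generated by `V`. -/
theorem lieAlg_closure_expSet {V : Set (tangent A)} (hV : ∀ c : ℂ, ∀ x ∈ V, c • x ∈ V) :
    lieAlg (Subgroup.closure (expSet V)) = LieSubalgebra.lieSpan ℂ (tangent A) V := by
  refine subset_antisymm ?_ (lieSpan_subset_lieAlg_closure hV)
  rw [← closure_expSet_lieSpan hV]
  exact lieAlg_closure_expSet_subset _

theorem isConnectedLieSubgroup_closure_expSet {V : Set (tangent A)}
    (hV : ∀ c : ℂ, ∀ x ∈ V, c • x ∈ V) :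
    IsConnectedLieSubgroup (Subgroup.closure (expSet V)) :=
  ⟨isConnected_closure_expSet hV, by rw [lieAlg_closure_expSet hV, closure_expSet_lieSpan hV]⟩

/-- A Zariski closed subgroup is a Lie subgroup: near the unit it is given by the exponentials of
the elements of its Lie algebra. -/
theorem eventually_exists_isExp {K : Subgroup (Points A)} (hK : IsZariskiClosed K) :
    ∀ᶠ g in 𝓝 (1 : Points A), g ∈ K → ∃ x ∈ lieAlg K, IsExp x g := by
  obtain ⟨n, ρ, hρ, hgen⟩ := exists_faithful_rep (A := A)
  obtain ⟨l, hl⟩ := exists_lieSubalgebra_eq_lieAlg K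
  have hl' : ∀ x, x ∈ l ↔ x ∈ lieAlg K := fun x => by rw [← hl]; rfl
  let k : Submodule ℂ (Mat n) :=
    l.toSubmodule.map (ρ.toLinearMap ∘ₗ (tangent A).toSubmodule.subtype)
  have hmem : ∀ T, T ∈ k ↔ ∃ x : tangent A, x ∈ l ∧ ρ (x : ConvDual A) = T := fun T => Iff.rfl
  let G := K.toSubmonoid.map (pointRep ρ)
  have hcl : IsClosed (G : Set (Mat n)) := by
    rw [← isSeqClosed_iff_isClosed]
    intro T T₀ hT hlim
    choose g hg e using hT
    have hlim' : Tendsto (fun a => ρ (pointFun (g a))) atTop (𝓝 T₀) := by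
      have : T = fun a => ρ (pointFun (g a)) := funext fun a => (e a).symm
      rwa [this] at hlim
    obtain ⟨g₀, e₀, hg₀⟩ := exists_point_of_tendsto hρ hgen hlim'
    refine ⟨g₀, hK g₀ fun f hf => ?_, e₀⟩
    refine tendsto_nhds_unique (hg₀ f) ?_
    have : (fun a => g a f) = fun _ => 0 := funext fun a => hf _ (hg a)
    rw [this]
    exact tendsto_const_nhds
  have hev := eventually_mem_exp_of_isClosed hcl (k := k) ?_ ?_ ?_
  · have hlim : Tendsto (fun g : Points A => ρ (pointFun g)) (𝓝 1) (𝓝 1) := by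
      have := (continuous_rep_pointFun hρ).tendsto (1 : Points A)
      rwa [pointFun_one, map_one] at this
    refine (hlim.eventually hev).mono fun g hg hgK => ?_
    obtain ⟨X, hX, e⟩ := hg ⟨g, hgK, rfl⟩
    obtain ⟨x, hx, rfl⟩ := (hmem X).1 hX
    exact ⟨x, (hl' x).1 hx, isExp_of_rep_eq hρ hgen e.symm⟩
  · rintro T ⟨g, hg, e⟩
    refine ⟨g⁻¹, K.inv_mem hg, ?_⟩
    have h1 : pointRep ρ g⁻¹ * NormedSpace.exp T = 1 := by
      rw [← e, ← map_mul, inv_mul_cancel, map_one]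
    exact left_inv_eq_right_inv h1 (exp_mul_exp_neg T)
  · intro X hX
    obtain ⟨x, hx, rfl⟩ := (hmem _).1 hX
    have h1 := (mem_lieAlg_iff_rep hρ hgen).1 ((hl' x).1 hx) 1
    rwa [one_smul] at h1
  · -- a real one-parameter group in `K` is differentiated to a tangent vector
    intro T hT
    choose g hgK hg using hT
    have hg' : ∀ τ, ρ (pointFun (g τ)) = NormedSpace.exp ((τ : ℂ) • T) := hg
    have hcurve := hasDerivAt_exp_ofReal_smul_zero T
    have hcoeff : ∀ {f : A} {ℓ : Mat n →L[ℂ] ℂ}, (∀ m : ConvDual A, m f = ℓ (ρ m)) →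
        HasDerivAt (fun τ => g τ f) (ℓ T) 0 := by
      intro f ℓ hℓ
      have h1 := (ℓ.restrictScalars ℝ).hasFDerivAt.comp_hasDerivAt (0 : ℝ) hcurve
      refine HasDerivAt.congr_of_eventuallyEq h1 (Eventually.of_forall fun τ => ?_)
      change pointFun (g τ) f = ℓ (NormedSpace.exp ((τ : ℂ) • T))
      rw [hℓ, hg']
    have hg0 : g 0 = 1 := points_eq_of_rep_eq hgen (by
      rw [hg', pointFun_one, map_one]; exact exp_zero_smul T)
    have hmul : ∀ {a b : A} {p q : ℂ}, HasDerivAt (fun τ => g τ a) p 0 →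
        HasDerivAt (fun τ => g τ b) q 0 →
        HasDerivAt (fun τ => g τ (a * b)) (p * g 0 b + g 0 a * q) 0 := by
      intro a b p q hp hq
      have : (fun τ => g τ (a * b)) = (fun τ => g τ a) * fun τ => g τ b :=
        funext fun τ => map_mul _ _ _
      rw [this]
      exact hp.mul hq
    have hder : ∀ f : A, ∃ c : ℂ, HasDerivAt (fun τ => g τ f) c 0 := by
      intro f
      have ha : f ∈ Algebra.adjoin ℂ {f | IsCoeff ρ f} := by rw [hgen]; trivial
      induction ha using Algebra.adjoin_induction with
      | mem b hb =>
        obtain ⟨ℓ, hℓ⟩ := hb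
        exact ⟨_, hcoeff hℓ⟩
      | algebraMap c =>
        refine ⟨0, ?_⟩
        have : (fun τ => g τ (algebraMap ℂ A c)) = fun _ => c := funext fun τ => by simp
        rw [this]
        exact hasDerivAt_const _ _
      | add b c _ _ hb hc =>
        obtain ⟨p, hp⟩ := hb
        obtain ⟨q, hq⟩ := hc
        refine ⟨p + q, ?_⟩
        have : (fun τ => g τ (b + c)) = (fun τ => g τ b) + fun τ => g τ c :=
          funext fun τ => map_add _ _ _
        rw [this]
        exact hp.add hq
      | mul b c _ _ hb hc =>
        obtain ⟨p, hp⟩ := hb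
        obtain ⟨q, hq⟩ := hc
        exact ⟨_, hmul hp hq⟩
    choose d hd using hder
    let y : A →ₗ[ℂ] ℂ :=
      { toFun := d
        map_add' := fun a b => (hd _).unique (by
          have : (fun τ => g τ (a + b)) = (fun τ => g τ a) + fun τ => g τ b :=
            funext fun τ => map_add _ _ _
          rw [this]
          exact (hd a).add (hd b))
        map_smul' := fun c a => (hd _).unique (by
          have : (fun τ => g τ (c • a)) = c • fun τ => g τ a :=
            funext fun τ => map_smul (g τ).ofConv c a
          rw [this]
          exact (hd a).const_smul c) }
    have hy : IsPointDerivation y := by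
      intro a b
      have h2 := (hd (a * b)).unique (hmul (hd a) (hd b))
      rw [hg0] at h2
      exact h2
    refine ⟨⟨WithConv.toConv y, hy⟩, ?_, ?_⟩
    · refine (hl' _).2 ((mem_lieAlg_iff hK).2 fun f hf => ?_)
      have h0 : (fun τ => g τ f) = fun _ => 0 := funext fun τ => hf _ (hgK τ)
      have h1 := hd f
      rw [h0] at h1
      exact h1.unique (hasDerivAt_const _ _)
    · refine hρ.eq_of_forall fun v i f hf => ?_
      let ℓ : Mat n →L[ℂ] ℂ :=
        (ContinuousLinearMap.proj i).comp (ContinuousLinearMap.apply ℂ (Fin n → ℂ) v)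
      exact (hd f).unique (hcoeff (ℓ := ℓ) fun m => (hf m).symm)

/-- The group generated by `exp (Lie K)` contains every connected subset of `K` through the unit:
its cosets are open in `K`. -/
theorem subset_closure_expSet_of_isPreconnected {K : Subgroup (Points A)}
    (hK : IsZariskiClosed K) {C : Set (Points A)} (hC : IsPreconnected C) (hCK : C ⊆ K)
    (h1 : 1 ∈ C) : C ⊆ Subgroup.closure (expSet (lieAlg K)) := by
  intro g hg
  have h := hC.induction₂' (fun a b => a⁻¹ * b ∈ Subgroup.closure (expSet (lieAlg K)))
    (fun a ha => ?_) (fun a b c _ _ _ hab hbc => ?_) h1 hg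
  · simpa using h
  · have hlim : Tendsto (fun b => a⁻¹ * b) (𝓝 a) (𝓝 1) := by
      have := (continuous_points_mul_left a⁻¹).tendsto a
      rwa [inv_mul_cancel] at this
    have hev := (hlim.eventually (eventually_exists_isExp hK)).filter_mono
      (nhdsWithin_le_nhds (s := C))
    filter_upwards [hev, self_mem_nhdsWithin] with b hb hbC
    obtain ⟨x, hx, hxb⟩ := hb (K.mul_mem (K.inv_mem (hCK ha)) (hCK hbC))
    have h2 : a⁻¹ * b ∈ Subgroup.closure (expSet (lieAlg K)) :=
      Subgroup.subset_closure ⟨x, hx, hxb⟩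
    refine ⟨h2, ?_⟩
    have h3 := Subgroup.inv_mem _ h2
    rwa [mul_inv_rev, inv_inv] at h3
  · have := Subgroup.mul_mem _ hab hbc
    rwa [mul_assoc, mul_inv_cancel_left] at this

/-- A connected Zariski closed subgroup is generated by the exponentials of its Lie algebra. -/
theorem closure_expSet_lieAlg_eq {K : Subgroup (Points A)} (hK : IsZariskiClosed K)
    (hc : IsConnected (K : Set (Points A))) : Subgroup.closure (expSet (lieAlg K)) = K :=
  le_antisymm (closure_expSet_lieAlg_le K)
    (subset_closure_expSet_of_isPreconnected hK hc.isPreconnected subset_rfl K.one_mem)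

theorem closure_expSet_lieAlg_eq_component {K : Subgroup (Points A)} (hK : IsZariskiClosed K) :
    (Subgroup.closure (expSet (lieAlg K)) : Set (Points A)) =
      connectedComponentIn (K : Set (Points A)) 1 := by
  refine subset_antisymm ?_ ?_
  · exact (isConnected_closure_expSet fun c x hx => smul_mem_lieAlg hx c).isPreconnected
      |>.subset_connectedComponentIn (Subgroup.one_mem _) (closure_expSet_lieAlg_le K)
  · exact subset_closure_expSet_of_isPreconnected hK isPreconnected_connectedComponentIn
      (connectedComponentIn_subset _ _) (mem_connectedComponentIn K.one_mem)

end LieCorrespondence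

/-! ### Lie coideals and coisotropic subgroups -/

section TensorSquare

variable {V : Type*} [AddCommGroup V] [Module ℂ V]

/-- The value of the functional `ξ ⊗ η` on `V ⊗ V`. -/
def evalTensor (ξ η : V →ₗ[ℂ] ℂ) : V ⊗[ℂ] V →ₗ[ℂ] ℂ :=
  LinearMap.mul' ℂ ℂ ∘ₗ TensorProduct.map ξ η

@[simp] theorem evalTensor_tmul (ξ η : V →ₗ[ℂ] ℂ) (x y : V) :
    evalTensor ξ η (x ⊗ₜ[ℂ] y) = ξ x * η y := rfl

theorem eq_zero_of_evalTensor [Module.Finite ℂ V] {t : V ⊗[ℂ] V}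
    (h : ∀ ξ η : V →ₗ[ℂ] ℂ, evalTensor ξ η t = 0) : t = 0 := by
  let e := Module.finBasis ℂ V
  have coord : ∀ (t : V ⊗[ℂ] V) i j, (e.tensorProduct e).repr t (i, j) =
      evalTensor (e.coord i) (e.coord j) t := by
    intro t i j
    induction t with
    | zero => simp
    | add s t hs ht => simp only [map_add, Finsupp.add_apply, hs, ht]
    | tmul x y => simp [mul_comm]
  refine (e.tensorProduct e).repr.injective (Finsupp.ext fun ⟨i, j⟩ => ?_)
  rw [coord, h, map_zero, Finsupp.zero_apply]

/-- The subspace `S ∧ V` of `V ⊗ V`. -/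
def wedgeSpan (S : Set V) : Submodule ℂ (V ⊗[ℂ] V) :=
  Submodule.span ℂ {t | ∃ s ∈ S, ∃ y : V, t = s ⊗ₜ[ℂ] y - y ⊗ₜ[ℂ] s}

theorem evalTensor_eq_zero_of_mem_wedgeSpan {S : Set V} {ξ η : V →ₗ[ℂ] ℂ}
    (hξ : ∀ s ∈ S, ξ s = 0) (hη : ∀ s ∈ S, η s = 0) {t : V ⊗[ℂ] V} (ht : t ∈ wedgeSpan S) :
    evalTensor ξ η t = 0 := by
  induction ht using Submodule.span_induction with
  | mem t ht =>
    obtain ⟨s, hs, y, rfl⟩ := ht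
    simp [hξ s hs, hη s hs]
  | zero => simp
  | add a b _ _ ha hb => rw [map_add, ha, hb, add_zero]
  | smul c a _ ha => rw [map_smul, ha, smul_zero]

/-- An antisymmetric tensor lies in `S ∧ V` if all products of two functionals that vanish
on `S` vanish on it. -/
theorem mem_wedgeSpan [Module.Finite ℂ V] {S : Submodule ℂ V} {t : V ⊗[ℂ] V}
    (hanti : ∀ ξ η, evalTensor ξ η t = - evalTensor η ξ t)
    (h : ∀ ξ η : V →ₗ[ℂ] ℂ, (∀ s ∈ S, ξ s = 0) → (∀ s ∈ S, η s = 0) → evalTensor ξ η t = 0) :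
    t ∈ wedgeSpan (S : Set V) := by
  obtain ⟨π, hπ⟩ := S.subtype.exists_leftInverse_of_injective S.ker_subtype
  -- `p` is a projection onto `S` and `q` the complementary one; modulo `S ∧ V`, the
  -- antisymmetrization of `t` is that of `(q ⊗ q) t`
  let p : V →ₗ[ℂ] V := S.subtype ∘ₗ π
  let q : V →ₗ[ℂ] V := LinearMap.id - p
  have hp : ∀ v, p v ∈ S := fun v => (π v).2
  have hq : ∀ s ∈ S, q s = 0 := fun s hs => by
    have : π s = ⟨s, hs⟩ := LinearMap.congr_fun hπ ⟨s, hs⟩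
    simp [q, p, this]
  let σ : V ⊗[ℂ] V →ₗ[ℂ] V ⊗[ℂ] V := (TensorProduct.comm ℂ V V).toLinearMap
  have hσ : t + σ t = 0 := eq_zero_of_evalTensor fun ξ η => by
    have : ∀ t, evalTensor ξ η (σ t) = evalTensor η ξ t := fun t => by
      induction t with
      | zero => simp
      | add a b ha hb => simp only [map_add, ha, hb]
      | tmul a b => simp [σ, mul_comm]
    rw [map_add, this, hanti, neg_add_cancel]
  have hqq : TensorProduct.map q q t = 0 := eq_zero_of_evalTensor fun ξ η => by
    have : ∀ t, evalTensor ξ η (TensorProduct.map q q t) = evalTensor (ξ ∘ₗ q) (η ∘ₗ q) t :=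
      fun t => by
        induction t with
        | zero => simp
        | add a b ha hb => simp only [map_add, ha, hb]
        | tmul a b => simp
    rw [this]
    exact h _ _ (fun s hs => by simp [hq s hs]) (fun s hs => by simp [hq s hs])
  have key : ∀ t : V ⊗[ℂ] V, (t - σ t) - (TensorProduct.map q q t - σ (TensorProduct.map q q t)) ∈
      wedgeSpan (S : Set V) := by
    intro t
    induction t with
    | zero => simp
    | add a b ha hb =>
      convert Submodule.add_mem _ ha hb using 1
      simp only [map_add]
      abel
    | tmul a b =>
      have e : (a ⊗ₜ[ℂ] b - σ (a ⊗ₜ b)) -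
          (TensorProduct.map q q (a ⊗ₜ b) - σ (TensorProduct.map q q (a ⊗ₜ b))) =
          (p a ⊗ₜ b - b ⊗ₜ p a) - (p b ⊗ₜ q a - q a ⊗ₜ p b) := by
        simp only [σ, LinearEquiv.coe_coe, TensorProduct.comm_tmul, TensorProduct.map_tmul, q,
          LinearMap.sub_apply, LinearMap.id_apply, TensorProduct.sub_tmul, TensorProduct.tmul_sub,
          map_sub]
        abel
      rw [e]
      exact Submodule.sub_mem _ (Submodule.subset_span ⟨_, hp a, _, rfl⟩)
        (Submodule.subset_span ⟨_, hp b, _, rfl⟩)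
  have h2 := key t
  rw [hqq, map_zero, sub_zero, sub_zero, eq_neg_of_add_eq_zero_right hσ, sub_neg_eq_add,
    ← two_smul ℂ t] at h2
  exact (Submodule.smul_mem_iff _ two_ne_zero).1 h2

end TensorSquare

section Coideals

variable {A : Type u} [CommRing A] [HopfAlgebra ℂ A] [Algebra.FiniteType ℂ A]

namespace PoissonStructure

variable (P : PoissonStructure A)

theorem evalTensor_cobracket (x : tangent A) (a b : A) :
    evalTensor (diff a) (diff b) (P.cobracket x) = x.1 (P.br a b) :=
  P.cobracket_spec x a b

theorem isLieCoideal_iff_mem {S : Set (tangent A)} :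
    P.IsLieCoideal S ↔ ∀ x ∈ S, P.cobracket x ∈ wedgeSpan S := Iff.rfl

/-- A subspace is a Lie coideal if and only if the differentials that vanish on it are closed
under the linearized Poisson bracket. -/
theorem isLieCoideal_iff {S : Submodule ℂ (tangent A)} :
    P.IsLieCoideal S ↔ ∀ x ∈ S, ∀ a b : A, (∀ s ∈ S, s.1 a = 0) → (∀ s ∈ S, s.1 b = 0) →
      x.1 (P.br a b) = 0 := by
  have := finite_tangent (A := A)
  rw [isLieCoideal_iff_mem]
  constructor
  · intro h x hx a b ha hb
    rw [← P.evalTensor_cobracket]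
    exact evalTensor_eq_zero_of_mem_wedgeSpan (ξ := diff a) (η := diff b) ha hb (h x hx)
  · intro h x hx
    refine mem_wedgeSpan (fun ξ η => ?_) fun ξ η hξ hη => ?_
    · obtain ⟨a, rfl⟩ := exists_diff_eq ξ
      obtain ⟨b, rfl⟩ := exists_diff_eq η
      rw [P.evalTensor_cobracket, P.evalTensor_cobracket, P.br_swap]
      exact map_neg x.1.ofConv _
    · obtain ⟨a, rfl⟩ := exists_diff_eq ξ
      obtain ⟨b, rfl⟩ := exists_diff_eq η
      rw [P.evalTensor_cobracket]
      exact h x hx a b hξ hη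

/-- The map `u ↦ u f` for tangent vectors `u` viewed as left invariant vector fields. -/
def vectorFieldEval (f : A) : tangent A →ₗ[ℂ] A :=
  ((rightTrHom A).toLinearMap.flip f) ∘ₗ (tangent A).toSubmodule.subtype

omit [Algebra.FiniteType ℂ A] in
theorem vectorFieldEval_apply (f : A) (u : tangent A) :
    vectorFieldEval f u = rightTr (u : ConvDual A) f := rfl

/-- The failure of a left invariant vector field to be a derivation of the Poisson bracket is the
left invariant bivector field given by the cobracket. -/
theorem rightTr_br (x : tangent A) (f g : A) :
    rightTr (x : ConvDual A) (P.br f g) =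
      P.br (rightTr (x : ConvDual A) f) g + P.br f (rightTr (x : ConvDual A) g) +
      LinearMap.mul' ℂ A
        (TensorProduct.map (vectorFieldEval f) (vectorFieldEval g) (P.cobracket x)) := by
  let r : ConvDual A → A ⊗[ℂ] A →ₗ[ℂ] A := fun m =>
    (TensorProduct.rid ℂ A).toLinearMap ∘ₗ LinearMap.lTensor A m.ofConv
  have hr1 : ∀ f, r 1 (Coalgebra.comul f) = f := fun f =>
    LinearMap.congr_fun (rightTr_one (A := A)) f
  have hrt : ∀ m a b, r m (a ⊗ₜ b) = m b • a := fun m a b => by simp [r]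
  -- apply `id ⊗ x` to the two summands of `Δ {f, g} = {Δ f, Δ g}`: the derivation rule for `x` splits
  -- the first one, and the second one gives the cobracket
  have h1 : ∀ S T : A ⊗[ℂ] A, r x (TensorProduct.map₂ P.br (LinearMap.mul ℂ A) S T) =
      P.br (r x S) (r 1 T) + P.br (r 1 S) (r x T) := by
    intro S T
    induction S with
    | zero => simp
    | add s t hs ht => simp only [map_add, LinearMap.add_apply, hs, ht]; abel
    | tmul a b =>
      induction T with
      | zero => simp
      | add s t hs ht => simp only [map_add, hs, ht]; abel
      | tmul c d =>
        have hx : (x : ConvDual A) (b * d) = _ := x.2 b d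
        rw [TensorProduct.map₂_apply_tmul, TensorProduct.map_tmul, hrt, hrt, hrt, hrt, hrt,
          LinearMap.mul_apply', hx, conv_one_apply, conv_one_apply]
        simp only [map_smul, LinearMap.smul_apply, smul_smul, add_smul]
        rw [mul_comm (x.1.ofConv b), mul_comm (x.1.ofConv d)]
  let R : (A ⊗[ℂ] A) → tangent A →ₗ[ℂ] A := fun S =>
    { toFun := fun u => r u S
      map_add' := fun u v => by
        change (TensorProduct.rid ℂ A) (LinearMap.lTensor A (u.1.ofConv + v.1.ofConv) S) = _
        rw [LinearMap.lTensor_add, LinearMap.add_apply, map_add]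
        rfl
      map_smul' := fun c u => by
        change (TensorProduct.rid ℂ A) (LinearMap.lTensor A (c • u.1.ofConv) S) = _
        rw [LinearMap.lTensor_smul, LinearMap.smul_apply, map_smul]
        rfl }
  have hRadd : ∀ S T, R (S + T) = R S + R T := fun S T => LinearMap.ext fun u =>
    map_add (r u) S T
  have hR0 : R 0 = 0 := LinearMap.ext fun u => map_zero (r u)
  have h2 : ∀ S T : A ⊗[ℂ] A, r x (TensorProduct.map₂ (LinearMap.mul ℂ A) P.br S T) =
      LinearMap.mul' ℂ A (TensorProduct.map (R S) (R T) (P.cobracket x)) := by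
    intro S T
    induction S with
    | zero => simp [hR0]
    | add s t hs ht =>
      simp only [map_add, LinearMap.add_apply, hs, ht, hRadd, TensorProduct.map_add_left]
    | tmul a b =>
      induction T with
      | zero => simp [hR0]
      | add s t hs ht =>
        simp only [map_add, LinearMap.add_apply, hs, ht, hRadd, TensorProduct.map_add_right]
      | tmul c d =>
        have h3 : ∀ τ : tangent A ⊗[ℂ] tangent A,
            LinearMap.mul' ℂ A (TensorProduct.map (R (a ⊗ₜ b)) (R (c ⊗ₜ d)) τ) =
            evalTensor (diff b) (diff d) τ • (a * c) := by
          intro τ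
          induction τ with
          | zero => simp
          | add s t hs ht => simp only [map_add, hs, ht, add_smul]
          | tmul u v =>
            have hu : R (a ⊗ₜ b) u = u.1 b • a := hrt _ _ _
            have hv : R (c ⊗ₜ d) v = v.1 d • c := hrt _ _ _
            rw [TensorProduct.map_tmul, LinearMap.mul'_apply, hu, hv, evalTensor_tmul,
              diff_apply, diff_apply, smul_mul_smul_comm]
        rw [h3, P.evalTensor_cobracket, TensorProduct.map₂_apply_tmul, TensorProduct.map_tmul, hrt,
          LinearMap.mul_apply']
  have h4 := congrArg (r x) (P.comul_br f g)
  rw [map_add, h1, h2, hr1, hr1] at h4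
  exact h4

omit [Algebra.FiniteType ℂ A] in
/-- Derivative at the unit, in the direction `y`, of the left invariant bivector field `τ` evaluated
on `a` and `b`. -/
theorem apply_vectorFieldEval_mul {y : tangent A} (a b : A) (τ : tangent A ⊗[ℂ] tangent A) :
    y.1 (LinearMap.mul' ℂ A (TensorProduct.map (vectorFieldEval a) (vectorFieldEval b) τ)) =
      evalTensor (diff (leftTr y.1 a)) (diff b) τ + evalTensor (diff a) (diff (leftTr y.1 b)) τ := by
  induction τ with
  | zero =>
    rw [map_zero, map_zero, map_zero (evalTensor _ _), map_zero (evalTensor _ _), zero_add]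
    exact map_zero y.1.ofConv
  | add s t hs ht =>
    have : ∀ c d, y.1 (c + d) = y.1 c + y.1 d := fun c d => map_add y.1.ofConv c d
    simp only [map_add, this, hs, ht]
    ring
  | tmul u v =>
    have h1 : ∀ (w : tangent A) c, Coalgebra.counit (R := ℂ) (rightTr w.1 c) = w.1 c := fun w c => by
      rw [← conv_one_apply, ← conv_apply_rightTr, one_mul]
    have h2 : ∀ (w : tangent A) c, y.1 (rightTr w.1 c) = w.1 (leftTr y.1 c) := fun w c => by
      rw [← conv_apply_rightTr, conv_apply_leftTr]
    have h3 : y.1 (rightTr u.1 a * rightTr v.1 b) = _ := y.2 _ _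
    rw [evalTensor_tmul, evalTensor_tmul, TensorProduct.map_tmul, LinearMap.mul'_apply,
      vectorFieldEval_apply, vectorFieldEval_apply, h3, h1, h1]
    change y.1 _ * _ + _ * y.1 _ = _
    rw [h2, h2]
    rfl

/-- The second order operator `y x` on a Poisson bracket, in terms of linearized brackets only.
The right hand side minus the same with `x` and `y` exchanged is the cocycle identity. -/
theorem conv_mul_br (x y : tangent A) (a b : A) :
    (y.1 * x.1) (P.br a b) =
      y.1 (P.br (rightTr x.1 a) b) + y.1 (P.br a (rightTr x.1 b)) +
      (x.1 (P.br (leftTr y.1 a) b) + x.1 (P.br a (leftTr y.1 b))) := by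
  have hadd : ∀ c d, y.1 (c + d) = y.1 c + y.1 d := fun c d => map_add y.1.ofConv c d
  rw [conv_apply_rightTr, P.rightTr_br, hadd, hadd, apply_vectorFieldEval_mul,
    P.evalTensor_cobracket, P.evalTensor_cobracket]

/-- The cobracket is a cocycle, in terms of functions. -/
theorem lie_br (x y : tangent A) (a b : A) :
    (⁅y, x⁆ : tangent A).1 (P.br a b) =
      y.1 (P.br (rightTr x.1 a - leftTr x.1 a) b) + y.1 (P.br a (rightTr x.1 b - leftTr x.1 b)) -
      (x.1 (P.br (rightTr y.1 a - leftTr y.1 a) b) +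
        x.1 (P.br a (rightTr y.1 b - leftTr y.1 b))) := by
  have hsub : ∀ (z : tangent A) c d, z.1 (c - d) = z.1 c - z.1 d :=
    fun z c d => map_sub z.1.ofConv c d
  change (y.1 * x.1) (P.br a b) - (x.1 * y.1) (P.br a b) = _
  rw [P.conv_mul_br, P.conv_mul_br]
  simp only [map_sub, LinearMap.sub_apply, hsub]
  ring

/-- The Lie subalgebra generated by a Lie coideal is a Lie coideal. -/
theorem isLieCoideal_lieSpan {V : Submodule ℂ (tangent A)} (hV : P.IsLieCoideal V) :
    P.IsLieCoideal (LieSubalgebra.lieSpan ℂ (tangent A) (V : Set (tangent A)) :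
      Set (tangent A)) := by
  set h := LieSubalgebra.lieSpan ℂ (tangent A) (V : Set (tangent A)) with hh
  have hsub : V ≤ h.toSubmodule := LieSubalgebra.subset_lieSpan
  -- differentials that vanish on `h` are stable under the coadjoint action of `h`
  have hJ : ∀ a : A, (∀ s ∈ h, s.1 a = 0) → ∀ x ∈ h, ∀ s ∈ h,
      s.1 (rightTr x.1 a - leftTr x.1 a) = 0 := by
    intro a ha x hx s hs
    have h1 : s.1 (rightTr x.1 a - leftTr x.1 a) = s.1 (rightTr x.1 a) - s.1 (leftTr x.1 a) :=
      map_sub s.1.ofConv _ _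
    rw [h1, ← conv_apply_rightTr, ← conv_apply_leftTr]
    exact ha _ (h.lie_mem hs hx)
  -- the elements of `h` on which the linearized bracket of such differentials vanishes form a Lie
  -- algebra, by the cocycle identity
  let C : LieSubalgebra ℂ (tangent A) :=
    { carrier := {x | x ∈ h ∧ ∀ a b : A, (∀ s ∈ h, s.1 a = 0) → (∀ s ∈ h, s.1 b = 0) →
        x.1 (P.br a b) = 0}
      add_mem' := fun {x y} hx hy => ⟨h.add_mem hx.1 hy.1, fun a b ha hb => by
        have : (x + y).1 (P.br a b) = x.1 (P.br a b) + y.1 (P.br a b) := rfl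
        rw [this, hx.2 a b ha hb, hy.2 a b ha hb, add_zero]⟩
      zero_mem' := ⟨h.zero_mem, fun a b _ _ => rfl⟩
      smul_mem' := fun c x hx => ⟨h.smul_mem c hx.1, fun a b ha hb => by
        have : (c • x).1 (P.br a b) = c * x.1 (P.br a b) := rfl
        rw [this, hx.2 a b ha hb, mul_zero]⟩
      lie_mem' := fun {x y} hx hy => ⟨h.lie_mem hx.1 hy.1, fun a b ha hb => by
        rw [P.lie_br, hx.2 _ _ (hJ a ha y hy.1) hb, hx.2 _ _ ha (hJ b hb y hy.1),
          hy.2 _ _ (hJ a ha x hx.1) hb, hy.2 _ _ ha (hJ b hb x hx.1)]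
        ring⟩ }
  have hC : h ≤ C := LieSubalgebra.lieSpan_le.2 fun x hx => ⟨hsub hx, fun a b ha hb =>
    P.isLieCoideal_iff.1 hV x hx a b (fun s hs => ha s (hsub hs)) fun s hs => hb s (hsub hs)⟩
  exact (P.isLieCoideal_iff (S := h.toSubmodule)).2 fun x hx a b ha hb => (hC hx).2 a b ha hb

/-- The group generated by the exponentials of a Lie coideal is coisotropic: the space spanned
by its ideal and the Poisson brackets of elements of its ideal is stable under the vector fields
in the coideal, and all its elements vanish at the unit. -/
theorem isCoisotropic_closure_expSet {V : Submodule ℂ (tangent A)} (hV : P.IsLieCoideal V) :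
    P.IsCoisotropic (Subgroup.closure (expSet (V : Set (tangent A)))) := by
  set H := Subgroup.closure (expSet (V : Set (tangent A))) with hH
  have hVH : ∀ x ∈ V, x ∈ lieAlg H := subset_lieAlg_closure fun c x hx => V.smul_mem c hx
  have hI : ∀ x ∈ V, ∀ f ∈ vanishingIdeal H, rightTr x.1 f ∈ vanishingIdeal H :=
    fun x hx f hf => rightTr_mem_vanishingIdeal
      (fun f hf => apply_eq_zero_of_mem_lieAlg (hVH x hx) hf) hf
  let N : Submodule ℂ A := Submodule.span ℂ
    ((vanishingIdeal H : Set A) ∪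
      {c | ∃ f ∈ vanishingIdeal H, ∃ g ∈ vanishingIdeal H, c = P.br f g})
  have hIN : ∀ f ∈ vanishingIdeal H, f ∈ N := fun f hf => Submodule.subset_span (Or.inl hf)
  have hbrN : ∀ f ∈ vanishingIdeal H, ∀ g ∈ vanishingIdeal H, P.br f g ∈ N :=
    fun f hf g hg => Submodule.subset_span (Or.inr ⟨f, hf, g, hg, rfl⟩)
  have hN : ∀ x ∈ V, ∀ f ∈ N, rightTr x.1 f ∈ N := by
    intro x hx f hf
    induction hf using Submodule.span_induction with
    | mem f hf =>
      rcases hf with hf | ⟨f, hf, g, hg, rfl⟩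
      · exact hIN _ (hI x hx f hf)
      · rw [P.rightTr_br]
        refine N.add_mem (N.add_mem (hbrN _ (hI x hx f hf) _ hg) (hbrN _ hf _ (hI x hx g hg)))
          (hIN _ ?_)
        have hδ := hV x hx
        generalize P.cobracket x = τ at hδ
        induction hδ using Submodule.span_induction with
        | mem t ht =>
          obtain ⟨s, hs, y, rfl⟩ := ht
          rw [map_sub, map_sub, TensorProduct.map_tmul, TensorProduct.map_tmul,
            LinearMap.mul'_apply, LinearMap.mul'_apply]
          exact Submodule.sub_mem _ (Ideal.mul_mem_right _ _ (hI s hs f hf))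
            (Ideal.mul_mem_left _ _ (hI s hs g hg))
        | zero => rw [map_zero, map_zero]; exact Submodule.zero_mem _
        | add a b _ _ ha hb => rw [map_add, map_add]; exact Submodule.add_mem _ ha hb
        | smul c a _ ha =>
          rw [map_smul, map_smul]
          exact Submodule.smul_mem ((vanishingIdeal H).restrictScalars ℂ) c ha
    | zero => rw [map_zero]; exact N.zero_mem
    | add a b _ _ ha hb => rw [map_add]; exact N.add_mem ha hb
    | smul c a _ ha => rw [map_smul]; exact N.smul_mem c ha
  have hε : ∀ f ∈ N, Coalgebra.counit (R := ℂ) f = 0 := by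
    intro f hf
    induction hf using Submodule.span_induction with
    | mem f hf =>
      rcases hf with hf | ⟨f, hf, g, hg, rfl⟩
      · exact hf 1 H.one_mem
      · exact P.counit_br f g
    | zero => exact map_zero _
    | add a b _ _ ha hb => rw [map_add, ha, hb, add_zero]
    | smul c a _ ha => rw [map_smul, ha, smul_zero]
  have hflow : ∀ g ∈ H, (∀ f ∈ N, rightTr (pointFun g) f ∈ N) ∧
      ∀ f ∈ N, rightTr (pointFun g⁻¹) f ∈ N := by
    intro g hg
    induction hg using Subgroup.closure_induction with
    | mem g hg =>
      obtain ⟨x, hx, hgx⟩ := hg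
      exact ⟨fun f hf => rightTr_mem_of_isExp (hN x hx) hgx hf,
        fun f hf => rightTr_mem_of_isExp (hN (-x) (V.neg_mem hx)) hgx.inv hf⟩
    | one =>
      rw [inv_one, pointFun_one, rightTr_one]
      exact ⟨fun f hf => hf, fun f hf => hf⟩
    | mul a b _ _ ha hb =>
      rw [mul_inv_rev, pointFun_mul, pointFun_mul]
      exact ⟨fun f hf => by rw [rightTr_mul]; exact ha.1 _ (hb.1 _ hf),
        fun f hf => by rw [rightTr_mul]; exact hb.2 _ (ha.2 _ hf)⟩
    | inv a _ ha => rw [inv_inv]; exact ⟨ha.2, ha.1⟩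
  intro a ha b hb g hg
  have h1 := hε _ ((hflow g hg).1 _ (hbrN a ha b hb))
  rwa [← conv_one_apply, ← conv_apply_rightTr, one_mul] at h1

/-- The Lie algebra of a Zariski closed coisotropic subgroup is a Lie coideal. -/
theorem IsCoisotropic.isLieCoideal {P : PoissonStructure A} {K : Subgroup (Points A)}
    (h : P.IsCoisotropic K) (hK : IsZariskiClosed K) : P.IsLieCoideal (lieAlg K) := by
  have := finite_tangent (A := A)
  obtain ⟨l, hl⟩ := exists_lieSubalgebra_eq_lieAlg K
  have hl' : ∀ x, x ∈ l ↔ x ∈ lieAlg K := fun x => by rw [← hl]; rfl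
  let D : A →ₗ[ℂ] Module.Dual ℂ (tangent A) :=
    { toFun := diff
      map_add' := fun a b => LinearMap.ext fun x => map_add x.1.ofConv a b
      map_smul' := fun c a => LinearMap.ext fun x => map_smul x.1.ofConv c a }
  -- every differential that vanishes on `Lie K` is that of a function in the ideal
  have key : ∀ a : A, (∀ s ∈ l, s.1 a = 0) → ∃ a' ∈ vanishingIdeal K, diff a' = diff a := by
    intro a ha
    let W := ((vanishingIdeal K).restrictScalars ℂ).map D
    have hW : diff a ∈ W.dualCoannihilator.dualAnnihilator := by
      rw [Submodule.mem_dualAnnihilator]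
      intro s hs
      rw [Submodule.mem_dualCoannihilator] at hs
      exact ha s ((hl' s).2 ((mem_lieAlg_iff hK).2 fun f hf => hs (D f) ⟨f, hf, rfl⟩))
    rw [Subspace.dualCoannihilator_dualAnnihilator_eq] at hW
    exact hW
  rw [← hl]
  refine (P.isLieCoideal_iff (S := l.toSubmodule)).2 fun x hx a b ha hb => ?_
  obtain ⟨a', ha', ea⟩ := key a ha
  obtain ⟨b', hb', eb⟩ := key b hb
  rw [← P.evalTensor_cobracket, ← ea, ← eb, P.evalTensor_cobracket]
  exact apply_eq_zero_of_mem_lieAlg ((hl' x).1 hx) (h a' ha' b' hb')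

end PoissonStructure

end Coideals

section DualCoideals

variable {A : Type u} [CommRing A] [HopfAlgebra ℂ A] [Algebra.FiniteType ℂ A]
variable {B : Type v} [CommRing B] [HopfAlgebra ℂ B] [Algebra.FiniteType ℂ B]
variable {P : PoissonStructure A} {Q : PoissonStructure B}
variable {p : tangent A →ₗ[ℂ] tangent B →ₗ[ℂ] ℂ}

theorem IsPoissonDual.symm (hp : IsPoissonDual P Q p) : IsPoissonDual Q P p.flip where
  perfect := have := hp.perfect; inferInstance
  lie_right ξ x y := hp.lie_left x y ξ
  lie_left ξ η x := hp.lie_right x ξ η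

omit [Algebra.FiniteType ℂ A] [Algebra.FiniteType ℂ B] in
theorem orthogonal_anti {S T : Set (tangent A)} (h : S ⊆ T) : orthogonal p T ⊆ orthogonal p S :=
  fun _ hξ x hx => hξ x (h hx)

/-- The orthogonal of a set, as a subspace. -/
def orthogonalSubmodule (p : tangent A →ₗ[ℂ] tangent B →ₗ[ℂ] ℂ) (S : Set (tangent A)) :
    Submodule ℂ (tangent B) where
  carrier := orthogonal p S
  add_mem' := fun hξ hη x hx => by rw [map_add, hξ x hx, hη x hx, add_zero]
  zero_mem' := fun x _ => map_zero _
  smul_mem' := fun c ξ hξ x hx => by rw [map_smul, hξ x hx, smul_zero]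

theorem IsPoissonDual.exists_eq (hp : IsPoissonDual P Q p) (φ : tangent A →ₗ[ℂ] ℂ) :
    ∃ ξ, p.flip ξ = φ :=
  have := hp.symm.perfect
  (LinearMap.IsPerfPair.bijective_left p.flip).2 φ

theorem IsPoissonDual.orthogonal_orthogonal (hp : IsPoissonDual P Q p)
    (S : Submodule ℂ (tangent A)) : orthogonal p.flip (orthogonal p S) = S := by
  refine subset_antisymm (fun x hx => ?_) fun x hx ξ hξ => hξ x hx
  by_contra hxS
  obtain ⟨φ, hφx, hφ⟩ := Submodule.exists_le_ker_of_notMem (p := S) (v := x) hxS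
  obtain ⟨ξ, rfl⟩ := hp.exists_eq φ
  exact hφx (hx ξ fun s hs => hφ hs)

/-- The orthogonal of a Lie subalgebra is a Lie coideal. -/
theorem IsPoissonDual.isLieCoideal_orthogonal (hp : IsPoissonDual P Q p)
    (l : LieSubalgebra ℂ (tangent A)) : Q.IsLieCoideal (orthogonal p (l : Set (tangent A))) := by
  refine (Q.isLieCoideal_iff (S := orthogonalSubmodule p l)).2 fun ξ hξ a b ha hb => ?_
  have key : ∀ a : B, (∀ s ∈ orthogonalSubmodule p (l : Set (tangent A)), s.1 a = 0) →
      ∃ x ∈ l, p x = diff a := by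
    intro a ha
    obtain ⟨x, hx⟩ := hp.symm.exists_eq (diff a)
    refine ⟨x, ?_, hx⟩
    have h1 : x ∈ orthogonal p.flip (orthogonal p (l.toSubmodule : Set (tangent A))) :=
      fun η hη => (LinearMap.congr_fun hx η).trans (ha η hη)
    rw [hp.orthogonal_orthogonal] at h1
    exact h1
  obtain ⟨x, hx, ea⟩ := key a ha
  obtain ⟨y, hy, eb⟩ := key b hb
  rw [← Q.cobracket_spec, ← ea, ← eb, ← hp.lie_left]
  exact hξ _ (l.lie_mem hx hy)

/-- The orthogonal of a Lie coideal is a Lie subalgebra. -/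
theorem IsPoissonDual.lie_mem_orthogonal (hp : IsPoissonDual P Q p) {S : Set (tangent A)}
    (hS : P.IsLieCoideal S) {ξ η : tangent B} (hξ : ξ ∈ orthogonal p S)
    (hη : η ∈ orthogonal p S) : ⁅ξ, η⁆ ∈ orthogonal p S := fun x hx => by
  rw [hp.lie_right]
  exact evalTensor_eq_zero_of_mem_wedgeSpan (ξ := p.flip ξ) (η := p.flip η) hξ hη (hS x hx)

/-- The orthogonal of a Lie coideal, as a Lie subalgebra. -/
def IsPoissonDual.orthogonalLie (hp : IsPoissonDual P Q p) {S : Set (tangent A)}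
    (hS : P.IsLieCoideal S) : LieSubalgebra ℂ (tangent B) :=
  { orthogonalSubmodule p S with lie_mem' := fun hξ hη => hp.lie_mem_orthogonal hS hξ hη }

end DualCoideals

/-! ### Complex points of affine varieties -/

section ComplexPoints

variable {R S : Type*} [CommRing R] [Algebra ℂ R] [CommRing S] [Algebra ℂ S]

theorem algebraMap_bijective_of_finiteType_field (F : Type*) [Field F] [Algebra ℂ F]
    [Algebra.FiniteType ℂ F] : Function.Bijective (algebraMap ℂ F) :=
  have := finite_of_finite_type_of_isJacobsonRing ℂ F
  IsAlgClosed.algebraMap_bijective_of_isIntegral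

/-- Every maximal ideal of a finitely generated algebra is the kernel of a complex point. -/
theorem exists_algHom_ker_eq [Algebra.FiniteType ℂ R] (m : Ideal R) [hm : m.IsMaximal] :
    ∃ χ : R →ₐ[ℂ] ℂ, ∀ r, χ r = 0 ↔ r ∈ m := by
  let _ : Field (R ⧸ m) := Ideal.Quotient.field m
  have : Algebra.FiniteType ℂ (R ⧸ m) :=
    Algebra.FiniteType.of_surjective (Ideal.Quotient.mkₐ ℂ m) (Ideal.Quotient.mkₐ_surjective ℂ m)
  let e := AlgEquiv.ofBijective (Algebra.ofId ℂ (R ⧸ m))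
    (algebraMap_bijective_of_finiteType_field (R ⧸ m))
  refine ⟨e.symm.toAlgHom.comp (Ideal.Quotient.mkₐ ℂ m), fun r => ?_⟩
  rw [← Ideal.Quotient.eq_zero_iff_mem]
  exact map_eq_zero_iff e.symm e.symm.injective

/-- A nonzero element of a finitely generated domain is nonzero at some complex point. -/
theorem exists_algHom_apply_ne_zero [IsDomain R] [Algebra.FiniteType ℂ R] {r : R} (hr : r ≠ 0) :
    ∃ χ : R →ₐ[ℂ] ℂ, χ r ≠ 0 := by
  have : IsJacobsonRing R := isJacobsonRing_of_finiteType (A := ℂ)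
  have h : (⊥ : Ideal R).jacobson = ⊥ :=
    IsJacobsonRing.out this Ideal.isRadical_bot
  have hr' : r ∉ (⊥ : Ideal R).jacobson := by rwa [h, Ideal.mem_bot]
  rw [Ideal.jacobson, Ideal.mem_sInf] at hr'
  push Not at hr'
  obtain ⟨m, ⟨-, hm⟩, hrm⟩ := hr'
  obtain ⟨χ, hχ⟩ := exists_algHom_ker_eq m
  exact ⟨χ, fun h0 => hrm ((hχ r).1 h0)⟩

/-- An injective homomorphism between finitely generated domains is, on complex points, onto a
nonempty Zariski open set. -/
theorem exists_extension_of_injective [IsDomain R] [IsDomain S] [Algebra.FiniteType ℂ R]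
    [Algebra.FiniteType ℂ S] {φ : R →ₐ[ℂ] S} (hφ : Function.Injective φ) :
    ∃ r : R, r ≠ 0 ∧ ∀ g : R →ₐ[ℂ] ℂ, g r ≠ 0 → ∃ χ : S →ₐ[ℂ] ℂ, χ.comp φ = g := by
  have : IsNoetherianRing R := Algebra.FiniteType.isNoetherianRing ℂ R
  have hfin : φ.toRingHom.FiniteType := by
    refine RingHom.FiniteType.of_comp_finiteType (f := algebraMap ℂ R) ?_
    have : φ.toRingHom.comp (algebraMap ℂ R) = algebraMap ℂ S := φ.comp_algebraMap
    rw [this]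
    exact RingHom.finiteType_algebraMap.2 inferInstance
  obtain ⟨C, hC⟩ := PrimeSpectrum.exists_constructibleSetData_iff.2
    (PrimeSpectrum.isConstructible_range_comap (RingHom.FinitePresentation.of_finiteType.1 hfin))
  -- by Chevalley's theorem the image is constructible, and it contains the generic point; so one of the
  -- locally closed pieces of the image is a basic open set
  have hbot : (⊥ : PrimeSpectrum R) ∈ Set.range (PrimeSpectrum.comap φ.toRingHom) := by
    refine ⟨⊥, PrimeSpectrum.ext ?_⟩
    ext r
    exact map_eq_zero_iff φ hφ
  rw [← hC] at hbot
  obtain ⟨D, hD, hDbot⟩ := Set.mem_iUnion₂.1 hbot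
  obtain ⟨hg, hf⟩ := hDbot
  have hf0 : D.f ≠ 0 := fun h => hf (by
    rw [PrimeSpectrum.mem_zeroLocus, Set.singleton_subset_iff, h]
    exact Ideal.zero_mem _)
  refine ⟨D.f, hf0, fun g hgf => ?_⟩
  have hker : (RingHom.ker g.toRingHom).IsMaximal :=
    RingHom.ker_isMaximal_of_surjective _ fun c => ⟨algebraMap ℂ R c, g.commutes c⟩
  let q : PrimeSpectrum R := ⟨RingHom.ker g.toRingHom, hker.isPrime⟩
  have hq : q ∈ Set.range (PrimeSpectrum.comap φ.toRingHom) := by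
    rw [← hC]
    refine Set.mem_iUnion₂.2 ⟨D, hD, fun r hr => ?_, fun h => hgf ?_⟩
    · have h0 : r ∈ (⊥ : Ideal R) := hg hr
      rw [Ideal.mem_bot] at h0
      rw [h0]
      exact Ideal.zero_mem _
    · rw [PrimeSpectrum.mem_zeroLocus, Set.singleton_subset_iff] at h
      exact h
  obtain ⟨Q, hQ⟩ := hq
  obtain ⟨m, hm, hle⟩ := Ideal.exists_le_maximal Q.asIdeal Q.isPrime.ne_top
  obtain ⟨χ, hχ⟩ := exists_algHom_ker_eq m
  refine ⟨χ, AlgHom.ext fun r => ?_⟩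
  have h1 : r - algebraMap ℂ R (g r) ∈ q.asIdeal := by
    change g (r - algebraMap ℂ R (g r)) = 0
    rw [map_sub, g.commutes, Algebra.algebraMap_self, RingHom.id_apply, sub_self]
  rw [← hQ] at h1
  have h2 := (hχ _).2 (hle h1)
  change χ (φ (r - algebraMap ℂ R (g r))) = 0 at h2
  rw [map_sub, map_sub, AlgHom.commutes, AlgHom.commutes, sub_eq_zero] at h2
  exact h2

end ComplexPoints

/-! ### Exponential polynomials -/

section ExpPolynomials

open PowerSeries

/-- The power series of `t ↦ exp (μ t)`. -/
def expSeries (μ : ℂ) : PowerSeries ℂ := rescale μ (PowerSeries.exp ℂ)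

theorem coeff_expSeries (μ : ℂ) (n : ℕ) :
    coeff n (expSeries μ) = μ ^ n * ((n.factorial : ℂ))⁻¹ := by
  rw [expSeries, coeff_rescale, coeff_exp]
  simp

theorem expSeries_add (μ ν : ℂ) : expSeries (μ + ν) = expSeries μ * expSeries ν :=
  (exp_mul_exp_eq_exp_add μ ν).symm

theorem expSeries_zero : expSeries 0 = 1 := by
  ext n
  rw [coeff_expSeries, coeff_one]
  split_ifs with h
  · simp [h]
  · rw [zero_pow h, zero_mul]

theorem expSeries_mul_neg (μ : ℂ) : expSeries μ * expSeries (-μ) = 1 := by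
  rw [← expSeries_add, add_neg_cancel, expSeries_zero]

theorem derivative_expSeries (μ : ℂ) : d⁄dX ℂ (expSeries μ) = μ • expSeries μ := by
  ext n
  rw [coeff_derivative, coeff_expSeries, coeff_smul, coeff_expSeries, Nat.factorial_succ, smul_eq_mul]
  have h1 : (n.factorial : ℂ) ≠ 0 := by exact_mod_cast n.factorial_ne_zero
  have h2 : (n : ℂ) + 1 ≠ 0 := by exact_mod_cast n.succ_ne_zero
  push_cast
  field_simp
  ring

/-- The derivation `d/dX` of power series, as an endomorphism. -/
def derivEnd : Module.End ℂ (PowerSeries ℂ) := (d⁄dX ℂ).toLinearMap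

theorem derivEnd_sub_pow_mul_expSeries (μ : ℂ) (n : ℕ) (F : PowerSeries ℂ) :
    ((derivEnd - μ • 1) ^ n) (F * expSeries μ) = (derivEnd ^ n) F * expSeries μ := by
  induction n with
  | zero => rfl
  | succ n ih =>
    rw [pow_succ', Module.End.mul_apply, ih, pow_succ', Module.End.mul_apply]
    change d⁄dX ℂ (_ * _) - μ • (_ * _) = _
    rw [Derivation.leibniz, derivative_expSeries]
    simp only [smul_eq_mul, mul_smul_comm]
    rw [add_sub_cancel_left, mul_comm]
    rfl

theorem derivEnd_pow_eq_zero_iff (n : ℕ) (F : PowerSeries ℂ) :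
    (derivEnd ^ n) F = 0 ↔ ∀ k, n ≤ k → coeff k F = 0 := by
  have h : ∀ k, coeff k ((derivEnd ^ n) F) = ((k + 1).ascFactorial n : ℂ) * coeff (k + n) F := by
    intro k
    rw [Module.End.pow_apply]
    exact coeff_iterate_derivative F n k
  constructor
  · intro h0 k hk
    obtain ⟨j, rfl⟩ := Nat.exists_eq_add_of_le' hk
    have h1 := h j
    rw [h0, map_zero] at h1
    refine (mul_eq_zero.1 h1.symm).resolve_left ?_
    exact_mod_cast (Nat.ascFactorial_pos j n).ne'
  · intro h0
    ext k
    rw [h, h0 _ (Nat.le_add_left n k), mul_zero, map_zero]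

/-- The space of generalized eigenvectors of `d/dX` consists of the products of `exp (μ X)` with
the polynomials. -/
theorem mem_maxGenEigenspace_derivEnd {μ : ℂ} {F : PowerSeries ℂ} :
    F ∈ derivEnd.maxGenEigenspace μ ↔
      ∃ n, ∀ k, n ≤ k → coeff k (F * expSeries (-μ)) = 0 := by
  rw [Module.End.mem_maxGenEigenspace]
  refine exists_congr fun n => ?_
  have h : F = (F * expSeries (-μ)) * expSeries μ := by
    rw [mul_assoc, mul_comm (expSeries (-μ)), expSeries_mul_neg, mul_one]
  have hu : IsUnit (expSeries μ) := IsUnit.of_mul_eq_one _ (expSeries_mul_neg μ)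
  rw [← derivEnd_pow_eq_zero_iff]
  conv_lhs => rw [h, derivEnd_sub_pow_mul_expSeries]
  exact hu.mul_left_eq_zero

/-- The power series `X ^ k exp (μ X)` are linearly independent. -/
theorem linearIndependent_X_pow_mul_expSeries :
    LinearIndependent ℂ fun γ : ℕ × ℂ => (X : PowerSeries ℂ) ^ γ.1 * expSeries γ.2 := by
  have h1 : LinearIndependent ℂ fun p : Σ _ : ℂ, ℕ =>
      (X : PowerSeries ℂ) ^ p.2 * expSeries p.1 := by
    refine linearIndependent_iUnion_finite
      (f := fun (μ : ℂ) (k : ℕ) => (X : PowerSeries ℂ) ^ k * expSeries μ) (fun μ => ?_)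
      fun μ t _ hμ => ?_
    · have h2 : LinearIndependent ℂ fun k : ℕ => (X : PowerSeries ℂ) ^ k := by
        rw [linearIndependent_iff']
        intro s c hc i hi
        have h3 := congrArg (coeff i) hc
        simpa [coeff_X_pow, hi] using h3
      refine h2.map' (LinearMap.mulRight ℂ (expSeries μ)) (LinearMap.ker_eq_bot'.2 fun F hF => ?_)
      have hu : IsUnit (expSeries μ) := IsUnit.of_mul_eq_one _ (expSeries_mul_neg μ)
      exact hu.mul_left_eq_zero.1 hF
    · have hle : ∀ ν : ℂ, Submodule.span ℂ (Set.range fun k : ℕ =>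
          (X : PowerSeries ℂ) ^ k * expSeries ν) ≤ derivEnd.maxGenEigenspace ν := by
        intro ν
        rw [Submodule.span_le]
        rintro _ ⟨k, rfl⟩
        refine mem_maxGenEigenspace_derivEnd.2 ⟨k + 1, fun j hj => ?_⟩
        rw [mul_assoc, expSeries_mul_neg, mul_one, coeff_X_pow, if_neg (by omega)]
      refine ((Module.End.independent_maxGenEigenspace derivEnd) μ).mono (hle μ)
        (iSup₂_mono' fun ν hν => ⟨ν, by rintro rfl; exact hμ hν, hle ν⟩)
  exact h1.comp (fun γ : ℕ × ℂ => (⟨γ.2, γ.1⟩ : Σ _ : ℂ, ℕ)) fun a b h => by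
    simp only [Sigma.mk.injEq, heq_eq_eq] at h
    exact Prod.ext h.2 h.1

variable (Λ : AddSubgroup ℂ)

/-- The algebra of exponential polynomials with frequencies in `Λ`, with basis
`T ^ k exp (μ T)`, `k ∈ ℕ`, `μ ∈ Λ`. -/
abbrev ExpPoly : Type := AddMonoidAlgebra ℂ (ℕ × Λ)

/-- The Taylor expansion of exponential polynomials. -/
def expPolyHom : ExpPoly Λ →ₐ[ℂ] PowerSeries ℂ :=
  AddMonoidAlgebra.lift ℂ _ _
    { toFun := fun γ => X ^ γ.toAdd.1 * expSeries γ.toAdd.2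
      map_one' := by
        change X ^ 0 * expSeries 0 = 1
        rw [expSeries_zero, pow_zero, mul_one]
      map_mul' := fun γ η => by
        change X ^ (γ.toAdd.1 + η.toAdd.1) * expSeries (γ.toAdd.2 + η.toAdd.2) = _
        rw [expSeries_add, pow_add]
        ring }

theorem expPolyHom_single (γ : ℕ × Λ) (c : ℂ) :
    expPolyHom Λ (AddMonoidAlgebra.single γ c) = c • (X ^ γ.1 * expSeries γ.2) :=
  AddMonoidAlgebra.lift_single _ _ _

theorem expPolyHom_injective : Function.Injective (expPolyHom Λ) := by
  have h1 : LinearIndependent ℂ fun γ : ℕ × Λ => (X : PowerSeries ℂ) ^ γ.1 * expSeries γ.2 :=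
    linearIndependent_X_pow_mul_expSeries.comp (fun γ : ℕ × Λ => (γ.1, (γ.2 : ℂ))) fun a b h =>
      Prod.ext (Prod.mk.inj h).1 (Subtype.ext (Prod.mk.inj h).2)
  have h2 : ∀ q : ExpPoly Λ, expPolyHom Λ q = Finsupp.linearCombination ℂ
      (fun γ : ℕ × Λ => (X : PowerSeries ℂ) ^ γ.1 * expSeries γ.2) q.coeff := fun q =>
    AddMonoidAlgebra.lift_apply _ _
  intro q r h
  rw [h2, h2] at h
  exact (AddMonoidAlgebra.coeffLinearEquiv ℂ).injective (h1 h)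

/-- An element of a finite-dimensional space of power series that is stable under `d/dX` is an
exponential polynomial. -/
theorem exists_finset_mem_range_expPolyHom {W : Submodule ℂ (PowerSeries ℂ)}
    [Module.Finite ℂ W] (hW : ∀ F ∈ W, derivEnd F ∈ W) {F : PowerSeries ℂ} (hF : F ∈ W) :
    ∃ s : Finset ℂ, ∀ Λ : AddSubgroup ℂ, (s : Set ℂ) ⊆ Λ → F ∈ (expPolyHom Λ).range := by
  classical
  let D : Module.End ℂ W := derivEnd.restrict hW
  have hmem : (⟨F, hF⟩ : W) ∈ ⨆ μ, D.maxGenEigenspace μ := by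
    rw [Module.End.iSup_maxGenEigenspace_eq_top]
    trivial
  have key : ∀ w : W, w ∈ ⨆ μ, D.maxGenEigenspace μ →
      ∃ s : Finset ℂ, ∀ Λ : AddSubgroup ℂ, (s : Set ℂ) ⊆ Λ → w.1 ∈ (expPolyHom Λ).range := by
    intro w hw
    refine Submodule.iSup_induction _ (motive := fun w : W => ∃ s : Finset ℂ,
      ∀ Λ : AddSubgroup ℂ, (s : Set ℂ) ⊆ Λ → w.1 ∈ (expPolyHom Λ).range) hw
      (fun μ w hw => ?_) ?_ ?_
    · refine ⟨{μ}, fun Λ hΛ => ?_⟩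
      have hμ : μ ∈ Λ := hΛ (by simp)
      rw [Module.End.mem_maxGenEigenspace] at hw
      obtain ⟨n, hn⟩ := hw
      have hpow : ∀ n : ℕ, (((D - μ • 1) ^ n) w).1 = ((derivEnd - μ • 1) ^ n) w.1 := by
        intro n
        induction n with
        | zero => rfl
        | succ n ih =>
          rw [pow_succ', pow_succ', Module.End.mul_apply, Module.End.mul_apply, ← ih]
          rfl
      have h1 : w.1 ∈ derivEnd.maxGenEigenspace μ :=
        (Module.End.mem_maxGenEigenspace _ _ _).2 ⟨n, by rw [← hpow, hn]; rfl⟩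
      obtain ⟨N, hN⟩ := mem_maxGenEigenspace_derivEnd.1 h1
      have h2 : w.1 * expSeries (-μ) =
          ∑ k ∈ Finset.range N, coeff k (w.1 * expSeries (-μ)) • (X : PowerSeries ℂ) ^ k := by
        ext j
        rw [map_sum]
        simp only [coeff_smul, coeff_X_pow, smul_eq_mul, mul_ite, mul_one, mul_zero,
          Finset.sum_ite_eq, Finset.mem_range]
        split_ifs with hj
        · rfl
        · exact hN j (not_lt.1 hj)
      refine ⟨∑ k ∈ Finset.range N,
        AddMonoidAlgebra.single (k, ⟨μ, hμ⟩) (coeff k (w.1 * expSeries (-μ))), ?_⟩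
      have h3 : w.1 = (w.1 * expSeries (-μ)) * expSeries μ := by
        rw [mul_assoc, mul_comm (expSeries (-μ)), expSeries_mul_neg, mul_one]
      conv_rhs => rw [h3, h2, Finset.sum_mul]
      change expPolyHom Λ _ = _
      rw [map_sum]
      exact Finset.sum_congr rfl fun k _ => by rw [expPolyHom_single, smul_mul_assoc]
    · exact ⟨∅, fun Λ _ => Subalgebra.zero_mem _⟩
    · rintro a b ⟨s, hs⟩ ⟨t, ht⟩
      refine ⟨s ∪ t, fun Λ hΛ => ?_⟩
      rw [Finset.coe_union, Set.union_subset_iff] at hΛ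
      exact Subalgebra.add_mem _ (hs Λ hΛ.1) (ht Λ hΛ.2)
  exact key _ hmem

variable {Λ}

/-- The point of the algebra of exponential polynomials where `T = a`, `exp (μ T) = exp (ℓ μ)`. -/
def expPolyEval (a : ℂ) (ℓ : Λ →+ ℂ) : ExpPoly Λ →ₐ[ℂ] ℂ :=
  AddMonoidAlgebra.lift ℂ _ _
    { toFun := fun γ => a ^ γ.toAdd.1 * Complex.exp (ℓ γ.toAdd.2)
      map_one' := by
        change a ^ 0 * Complex.exp (ℓ 0) = 1
        rw [map_zero, Complex.exp_zero, pow_zero, mul_one]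
      map_mul' := fun γ η => by
        change a ^ (γ.toAdd.1 + η.toAdd.1) * Complex.exp (ℓ (γ.toAdd.2 + η.toAdd.2)) = _
        rw [map_add, Complex.exp_add, pow_add]
        ring }

theorem expPolyEval_single (a : ℂ) (ℓ : Λ →+ ℂ) (γ : ℕ × Λ) (c : ℂ) :
    expPolyEval a ℓ (AddMonoidAlgebra.single γ c) = c * (a ^ γ.1 * Complex.exp (ℓ γ.2)) :=
  AddMonoidAlgebra.lift_single _ _ _

theorem continuous_expPolyEval (a : ℂ) (ℓ : Λ →+ ℂ) (q : ExpPoly Λ) :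
    Continuous fun s : ℂ => expPolyEval (s * a) (s • ℓ) q := by
  induction q using AddMonoidAlgebra.induction_linear with
  | zero => simp only [map_zero]; exact continuous_const
  | add p q hp hq => simp only [map_add]; exact hp.add hq
  | single γ c =>
    simp only [expPolyEval_single, AddMonoidHom.smul_apply, smul_eq_mul]
    fun_prop

theorem hasSum_coeff_X_mul {F : PowerSeries ℂ} {t a : ℂ}
    (h : HasSum (fun n => t ^ n * coeff n F) a) :
    HasSum (fun n => t ^ n * coeff n (X * F)) (t * a) := by
  have h1 : HasSum (fun n => t ^ (n + 1) * coeff (n + 1) (X * F)) (t * a) := by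
    refine (h.mul_left t).congr_fun fun n => ?_
    rw [coeff_succ_X_mul, pow_succ']
    ring
  have h2 := HasSum.zero_add (f := fun n => t ^ n * coeff n (X * F)) h1
  simpa using h2

/-- An exponential polynomial is the sum of its Taylor expansion. -/
theorem hasSum_coeff_expPolyHom (t : ℂ) (q : ExpPoly Λ) :
    HasSum (fun n => t ^ n * coeff n (expPolyHom Λ q)) (expPolyEval t (t • Λ.subtype) q) := by
  induction q using AddMonoidAlgebra.induction_linear with
  | zero =>
    simp only [map_zero, mul_zero]
    exact hasSum_zero
  | add p q hp hq =>
    simp only [map_add, mul_add]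
    exact hp.add hq
  | single γ c =>
    have h1 : HasSum (fun n => t ^ n * coeff n (expSeries γ.2)) (Complex.exp (t * γ.2)) := by
      have := NormedSpace.expSeries_div_hasSum_exp (t * (γ.2 : ℂ))
      rw [← Complex.exp_eq_exp_ℂ] at this
      refine this.congr_fun fun n => ?_
      rw [coeff_expSeries, mul_pow, div_eq_mul_inv, mul_assoc]
    have h2 : ∀ k : ℕ, HasSum (fun n => t ^ n * coeff n (X ^ k * expSeries γ.2))
        (t ^ k * Complex.exp (t * γ.2)) := by
      intro k
      induction k with
      | zero => simpa using h1
      | succ k ih =>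
        rw [pow_succ', pow_succ', mul_assoc, mul_assoc]
        exact hasSum_coeff_X_mul ih
    rw [expPolyEval_single]
    refine ((h2 γ.1).mul_left c).congr_fun fun n => ?_
    rw [expPolyHom_single, coeff_smul, smul_eq_mul]
    ring

/-- Every point of the algebra of exponential polynomials arises from logarithms. -/
theorem exists_expPolyEval_eq (hΛ : Λ.FG) (χ : ExpPoly Λ →ₐ[ℂ] ℂ) :
    ∃ a ℓ, χ = expPolyEval a ℓ := by
  have : AddGroup.FG Λ := (AddGroup.fg_iff_addSubgroup_fg Λ).2 hΛ
  let u : Multiplicative Λ →* ℂ :=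
    { toFun := fun μ => χ (AddMonoidAlgebra.single (0, μ.toAdd) 1)
      map_one' := map_one χ
      map_mul' := fun μ ν => by
        rw [← map_mul, AddMonoidAlgebra.single_mul_single, one_mul]
        rfl }
  let u' : Λ →+ Additive ℂˣ := (MonoidHom.toHomUnits u).toAdditiveRight
  have hu' : ∀ μ : Λ, ((u' μ).toMul : ℂ) = χ (AddMonoidAlgebra.single (0, μ) 1) := fun μ => rfl
  let e : ℂ →+ Additive ℂˣ :=
    { toFun := fun z => Additive.ofMul (Units.mk0 (Complex.exp z) (Complex.exp_ne_zero z))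
      map_zero' := by
        apply Additive.toMul.injective
        ext
        exact Complex.exp_zero
      map_add' := fun z w => by
        apply Additive.toMul.injective
        ext
        exact Complex.exp_add z w }
  have he : Function.Surjective e.toIntLinearMap := fun v => by
    obtain ⟨z, hz⟩ : ∃ z, Complex.exp z = (v.toMul : ℂ) :=
      ⟨_, Complex.exp_log v.toMul.ne_zero⟩
    exact ⟨z, Additive.toMul.injective (Units.ext hz)⟩
  -- `Λ` is a finitely generated torsion free group, hence free, so its characters lift along `exp`
  obtain ⟨ℓ, hℓ⟩ := Module.projective_lifting_property e.toIntLinearMap u'.toIntLinearMap he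
  have hℓ' : ∀ μ : Λ, Complex.exp (ℓ μ) = χ (AddMonoidAlgebra.single (0, μ) 1) := fun μ => by
    rw [← hu']
    exact congrArg (fun v : Additive ℂˣ => (v.toMul : ℂ)) (LinearMap.congr_fun hℓ μ)
  refine ⟨χ (AddMonoidAlgebra.single (1, 0) 1), ℓ.toAddMonoidHom, ?_⟩
  refine AlgHom.ext fun q => ?_
  induction q using AddMonoidAlgebra.induction_linear with
  | zero => rw [map_zero, map_zero]
  | add p q hp hq => rw [map_add, map_add, hp, hq]
  | single γ c =>
    rw [expPolyEval_single]
    change _ = c * (_ * Complex.exp (ℓ γ.2))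
    rw [hℓ', ← map_pow, AddMonoidAlgebra.single_pow, one_pow, ← map_mul,
      AddMonoidAlgebra.single_mul_single, one_mul, ← smul_eq_mul, ← map_smul,
      AddMonoidAlgebra.smul_single, smul_eq_mul, mul_one]
    congr 2
    simp

end ExpPolynomials

/-! ### Zariski closed connected subgroups -/

section ZariskiClosure

variable {A : Type u} [CommRing A] [HopfAlgebra ℂ A]

theorem points_inv_apply (g : Points A) (f : A) :
    g⁻¹ f = g (HopfAlgebra.antipode ℂ f) := rfl

theorem antipode_mem_vanishingIdeal {H : Subgroup (Points A)} {f : A}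
    (hf : f ∈ vanishingIdeal H) : HopfAlgebra.antipode ℂ f ∈ vanishingIdeal H := fun g hg => by
  rw [← points_inv_apply]
  exact hf _ (H.inv_mem hg)

/-- The Zariski closure of a subgroup. -/
def zariskiClosure (H : Subgroup (Points A)) : Subgroup (Points A) where
  carrier := {g | ∀ f ∈ vanishingIdeal H, g f = 0}
  one_mem' := fun f hf => hf 1 H.one_mem
  mul_mem' := fun {a b} ha hb f hf => by
    rw [points_mul_apply_rightTr]
    refine ha _ fun h hh => ?_
    rw [← points_mul_apply_rightTr, points_mul_apply_leftTr]
    exact hb _ (mul_apply_eq_zero_of_mem_vanishingIdeal hf hh).2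
  inv_mem' := fun {a} ha f hf => by
    rw [points_inv_apply]
    exact ha _ (antipode_mem_vanishingIdeal hf)

theorem le_zariskiClosure (H : Subgroup (Points A)) : H ≤ zariskiClosure H :=
  fun g hg _ hf => hf g hg

theorem vanishingIdeal_zariskiClosure (H : Subgroup (Points A)) :
    vanishingIdeal (zariskiClosure H) = vanishingIdeal H :=
  le_antisymm (fun _ hf g hg => hf g (le_zariskiClosure H hg)) fun f hf _ hg => hg f hf

theorem isZariskiClosed_zariskiClosure (H : Subgroup (Points A)) :
    IsZariskiClosed (zariskiClosure H) := fun g hg => by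
  rw [vanishingIdeal_zariskiClosure] at hg
  exact hg

theorem zariskiClosure_le {H K : Subgroup (Points A)} (hK : IsZariskiClosed K) (h : H ≤ K) :
    zariskiClosure H ≤ K :=
  fun g hg => hK g fun f hf => hg f fun g' hg' => hf g' (h hg')

end ZariskiClosure

section OneParameter

variable {A : Type u} [CommRing A] [HopfAlgebra ℂ A]

theorem derivEnd_expTaylor (x : tangent A) (f : A) :
    derivEnd (expTaylor x f) = expTaylor x (rightTr (x : ConvDual A) f) := by
  ext n
  change PowerSeries.coeff n (PowerSeries.derivative ℂ _) = _
  rw [PowerSeries.coeff_derivative, coeff_expTaylor, coeff_expTaylor, ← conv_apply_rightTr,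
    ← pow_succ, Nat.factorial_succ]
  have h1 : (n.factorial : ℂ) ≠ 0 := by exact_mod_cast n.factorial_ne_zero
  have h2 : (n : ℂ) + 1 ≠ 0 := by exact_mod_cast n.succ_ne_zero
  push_cast
  field_simp

/-- The Taylor expansion of `t ↦ f (exp (t x))` is an exponential polynomial, since `f` lies in a
finite dimensional space of functions that is stable under `x`. -/
theorem exists_finset_expTaylor_mem_range (x : tangent A) (f : A) : ∃ s : Finset ℂ,
    ∀ Λ : AddSubgroup ℂ, (s : Set ℂ) ⊆ Λ → expTaylor x f ∈ (expPolyHom Λ).range := by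
  obtain ⟨V, hV, hf, hst⟩ := exists_finite_rightTr_stable f
  refine exists_finset_mem_range_expPolyHom (W := V.map (expTaylor x).toLinearMap) ?_ ⟨f, hf, rfl⟩
  rintro _ ⟨v, hv, rfl⟩
  exact ⟨_, hst x v hv, (derivEnd_expTaylor x v).symm⟩

/-- Regular functions restricted to a one-parameter group are exponential polynomials. -/
theorem exists_expPoly_lift [Algebra.FiniteType ℂ A] (x : tangent A) : ∃ s : Finset ℂ,
    ∀ Λ : AddSubgroup ℂ, (s : Set ℂ) ⊆ Λ →
      ∃ Φ : A →ₐ[ℂ] ExpPoly Λ, ∀ f, expPolyHom Λ (Φ f) = expTaylor x f := by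
  classical
  obtain ⟨S, hS⟩ := (inferInstance : Algebra.FiniteType ℂ A).out
  choose s hs using exists_finset_expTaylor_mem_range x
  refine ⟨S.biUnion s, fun Λ hΛ => ?_⟩
  have hrange : ∀ f, expTaylor x f ∈ (expPolyHom Λ).range := by
    intro f
    have hf : f ∈ Algebra.adjoin ℂ (S : Set A) := by rw [hS]; trivial
    have hle : Algebra.adjoin ℂ (S : Set A) ≤ (expPolyHom Λ).range.comap (expTaylor x) :=
      Algebra.adjoin_le fun a ha => hs a Λ fun μ hμ =>
        hΛ (Finset.mem_coe.2 (Finset.mem_biUnion.2 ⟨a, ha, hμ⟩))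
    exact hle hf
  let e := AlgEquiv.ofInjective (expPolyHom Λ) (expPolyHom_injective Λ)
  refine ⟨e.symm.toAlgHom.comp ((expTaylor x).codRestrict _ hrange), fun f => ?_⟩
  exact congrArg Subtype.val (e.apply_symm_apply ⟨expTaylor x f, hrange f⟩)

variable {x : tangent A} {Λ : AddSubgroup ℂ} {Φ : A →ₐ[ℂ] ExpPoly Λ}

theorem isExp_expPolyEval (hΦ : ∀ f, expPolyHom Λ (Φ f) = expTaylor x f) (t : ℂ) :
    IsExp (t • x) (WithConv.toConv ((expPolyEval t (t • Λ.subtype)).comp Φ)) := fun f => by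
  refine (hasSum_coeff_expPolyHom t (Φ f)).congr_fun fun n => ?_
  have h1 : (((t • x : tangent A) : ConvDual A) ^ n) f = t ^ n * ((x : ConvDual A) ^ n) f := by
    have : ((t • x : tangent A) : ConvDual A) = t • (x : ConvDual A) := rfl
    rw [this, smul_pow, conv_smul_apply]
  rw [hΦ, coeff_expTaylor, h1]
  ring

/-- A function that vanishes on `L` vanishes to all orders along the one-parameter groups in `L`. -/
theorem expTaylor_eq_zero {L : Subgroup (Points A)} (hx : x ∈ lieAlg L) {f : A}
    (hf : f ∈ vanishingIdeal L) : expTaylor x f = 0 := by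
  have hpow : ∀ n : ℕ, ∀ f ∈ vanishingIdeal L, ((x : ConvDual A) ^ n) f = 0 := by
    intro n
    induction n with
    | zero =>
      intro f hf
      rw [pow_zero, conv_one_apply]
      exact hf 1 L.one_mem
    | succ n ih =>
      intro f hf
      rw [pow_succ, conv_apply_rightTr]
      exact ih _ (rightTr_mem_vanishingIdeal (fun f hf => apply_eq_zero_of_mem_lieAlg hx hf) hf)
  ext n
  rw [coeff_expTaylor, hpow n f hf, mul_zero, map_zero]

/-- The Zariski closure of a one-parameter group in `L` is contained in the group generated by
`exp (Lie L)`: it consists of points of an algebra of exponential polynomials, which are joined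
to the unit by scaling their logarithms. -/
theorem comp_mem_closure_expSet [Algebra.FiniteType ℂ A] {L : Subgroup (Points A)}
    (hL : IsZariskiClosed L) (hx : x ∈ lieAlg L) (hΛ : Λ.FG)
    (hΦ : ∀ f, expPolyHom Λ (Φ f) = expTaylor x f) (χ : ExpPoly Λ →ₐ[ℂ] ℂ) :
    WithConv.toConv (χ.comp Φ) ∈ Subgroup.closure (expSet (lieAlg L)) := by
  obtain ⟨a, ℓ, rfl⟩ := exists_expPolyEval_eq hΛ χ
  let c : ℂ → Points A := fun s => WithConv.toConv ((expPolyEval (s * a) (s • ℓ)).comp Φ)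
  have hc : Continuous c := continuous_points_of_eval fun f => continuous_expPolyEval a ℓ (Φ f)
  have hcL : Set.range c ⊆ L := by
    rintro _ ⟨s, rfl⟩
    refine hL _ fun f hf => ?_
    have h0 : Φ f = 0 := expPolyHom_injective Λ (by
      rw [hΦ, expTaylor_eq_zero hx hf, map_zero])
    change expPolyEval _ _ (Φ f) = 0
    rw [h0, map_zero]
  have hc0 : c 0 = 1 := by
    have h1 := isExp_expPolyEval hΦ 0
    rw [zero_smul ℂ x, zero_smul ℂ Λ.subtype] at h1
    refine Eq.trans ?_ (h1.unique (isExp_zero A))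
    simp only [c, zero_smul, zero_mul]
  have h1 := subset_closure_expSet_of_isPreconnected hL (isPreconnected_range hc) hcL ⟨0, hc0⟩
    ⟨1, rfl⟩
  simpa only [c, one_mul, one_smul, SetLike.mem_coe] using h1

end OneParameter

section Words

variable {A : Type u} [CommRing A] [HopfAlgebra ℂ A]

/-- The exponential map `𝔤 → G`. -/
def expPoint (x : tangent A) : Points A := (exists_isExp x).choose

theorem isExp_expPoint (x : tangent A) : IsExp x (expPoint x) := (exists_isExp x).choose_spec

/-- The product `exp (t₁ x₁) ⋯ exp (tₖ xₖ)` in the group of points. -/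
def pointWord {k : ℕ} (x : Fin k → tangent A) (t : Fin k → ℂ) : Points A :=
  (List.ofFn fun i => expPoint (t i • x i)).prod

theorem rep_pointWord {n : ℕ} {ρ : ConvDual A →ₐ[ℂ] Mat n} (hρ : HasRegularCoeffs ρ) {k : ℕ}
    (x : Fin k → tangent A) (t : Fin k → ℂ) :
    ρ (pointFun (pointWord x t)) = expWord (fun i => ρ (x i)) t := by
  rw [← pointRep_apply, pointWord, map_list_prod, List.map_ofFn, expWord]
  congr 2
  funext i
  rw [Function.comp_apply, pointRep_apply, (isExp_expPoint _).rep_eq hρ, rep_smul]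

/-- The elements of the group generated by `exp V` are products of exponentials, as inverses of
exponentials are exponentials. -/
theorem exists_pointWord_eq [Algebra.FiniteType ℂ A] {V : Submodule ℂ (tangent A)} {g : Points A}
    (hg : g ∈ Subgroup.closure (expSet (V : Set (tangent A)))) :
    ∃ (l : ℕ) (y : Fin l → tangent A), (∀ j, y j ∈ V) ∧ pointWord y (fun _ => 1) = g := by
  have key : ∃ ys : List (tangent A), (∀ y ∈ ys, y ∈ V) ∧ (ys.map expPoint).prod = g := by
    induction hg using Subgroup.closure_induction with
    | mem g hg =>
      obtain ⟨x, hx, hgx⟩ := hg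
      exact ⟨[x], by simpa using hx, by simpa using (isExp_expPoint x).unique hgx⟩
    | one => exact ⟨[], by simp, rfl⟩
    | mul a b _ _ ha hb =>
      obtain ⟨ys, hys, rfl⟩ := ha
      obtain ⟨zs, hzs, rfl⟩ := hb
      refine ⟨ys ++ zs, fun y hy => ?_, by simp⟩
      exact (List.mem_append.1 hy).elim (hys y) (hzs y)
    | inv a _ ha =>
      obtain ⟨ys, hys, rfl⟩ := ha
      refine ⟨(ys.map Neg.neg).reverse, fun y hy => ?_, ?_⟩
      · obtain ⟨z, hz, rfl⟩ := List.mem_map.1 (List.mem_reverse.1 hy)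
        exact V.neg_mem (hys z hz)
      · rw [List.prod_inv_reverse, List.map_reverse, List.map_map, List.map_map]
        congr 3
        funext y
        exact (isExp_expPoint (-y)).unique (isExp_expPoint y).inv
  obtain ⟨ys, hys, rfl⟩ := key
  refine ⟨ys.length, ys.get, fun j => hys _ (List.get_mem ys j), ?_⟩
  rw [pointWord]
  congr 1
  simp only [one_smul]
  conv_rhs => rw [← List.ofFn_get ys, List.map_ofFn]
  rfl

/-- The words in the exponentials of a basis of a Lie algebra are Zariski dense in the group which
it generates: a function that vanishes on them vanishes, by the identity theorem, on all words. -/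
theorem mem_vanishingIdeal_of_pointWord [Algebra.FiniteType ℂ A] (l : LieSubalgebra ℂ (tangent A))
    {k : ℕ} {x : Fin k → tangent A} (hx : LinearIndependent ℂ x)
    (hspan : Submodule.span ℂ (Set.range x) = l.toSubmodule) {f : A}
    (hf : ∀ t, pointWord x t f = 0) :
    f ∈ vanishingIdeal (Subgroup.closure (expSet (l : Set (tangent A)))) := by
  intro g hg
  obtain ⟨m, y, hy, rfl⟩ := exists_pointWord_eq (V := l.toSubmodule) hg
  obtain ⟨n, ρ, hρ, hgen⟩ := exists_faithful_rep (A := A)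
  let R : tangent A →ₗ[ℂ] Mat n := ρ.toLinearMap ∘ₗ (tangent A).toSubmodule.subtype
  have hRinj : LinearMap.ker R = ⊥ :=
    LinearMap.ker_eq_bot.2 fun x y e => tangent_eq_of_rep_eq hgen e
  have hev := exists_expWord_eq_of_small (h := l.toSubmodule.map R) (w := fun i => R (x i)) ?_
    (hx.map' R hRinj) ?_ one_pos (y := fun j => R (y j)) fun j => ⟨y j, hy j, rfl⟩
  · have hev0 : ∀ᶠ s in nhds (0 : ℂ), pointWord y (fun _ => s) f = 0 := by
      have hlim : Filter.Tendsto (fun s : ℂ => fun _ : Fin m => s) (nhds 0) (nhds 0) :=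
        (continuous_pi fun _ => continuous_id).tendsto' _ _ rfl
      refine (hlim.eventually hev).mono fun s hs => ?_
      obtain ⟨t, -, e⟩ := hs
      have h1 : pointWord y (fun _ => s) = pointWord x t := points_eq_of_rep_eq hgen (by
        rw [rep_pointWord hρ, rep_pointWord hρ]
        exact e)
      rw [h1, hf]
    obtain ⟨n', ρ', hρ', hs'⟩ := exists_rep {f}
    obtain ⟨ℓ, hℓ⟩ := hs' f (Finset.mem_singleton_self f)
    have h2 : ∀ s : ℂ, pointWord y (fun _ => s) f =
        ℓ (expWord (fun j => ρ' (y j)) fun _ => s) := fun s => by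
      rw [← rep_pointWord hρ']
      exact hℓ (pointFun _)
    have hdiff : Differentiable ℂ fun s : ℂ => pointWord y (fun _ => s) f := by
      simp only [h2]
      refine ℓ.differentiable.comp (Differentiable.comp (g := expWord fun j => ρ' (y j))
        ((contDiff_expWord _).differentiable one_ne_zero) ?_)
      exact differentiable_pi.2 fun _ => differentiable_id
    have han : AnalyticOnNhd ℂ (fun s : ℂ => pointWord y (fun _ => s) f) Set.univ :=
      fun s _ => hdiff.analyticAt s
    exact han.eqOn_zero_of_preconnected_of_eventuallyEq_zero isPreconnected_univ
      (Set.mem_univ 0) hev0 (Set.mem_univ 1)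
  · rintro _ ⟨a, ha, rfl⟩ _ ⟨b, hb, rfl⟩
    exact ⟨⁅a, b⁆, l.lie_mem ha hb, rep_lie a b⟩
  · rw [← hspan, Submodule.map_span, ← Set.range_comp]
    rfl

end Words

section AlgebraicHull

/-- Points of the algebras of exponential polynomials in one variable define a point of the algebra
of exponential polynomials in several variables. -/
theorem exists_algHom_comp_mapDomain {Γ : Type*} [AddCommMonoid Γ] {k : ℕ}
    (ψ : Fin k → AddMonoidAlgebra ℂ Γ →ₐ[ℂ] ℂ) :
    ∃ χ : AddMonoidAlgebra ℂ (Fin k → Γ) →ₐ[ℂ] ℂ, ∀ i,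
      χ.comp (AddMonoidAlgebra.mapDomainAlgHom ℂ ℂ (AddMonoidHom.single (fun _ => Γ) i)) = ψ i := by
  have h1 : ∀ i, ψ i (AddMonoidAlgebra.single 0 1) = 1 := fun i => map_one (ψ i)
  refine ⟨AddMonoidAlgebra.lift ℂ _ _
    { toFun := fun γ => ∏ i, ψ i (AddMonoidAlgebra.single (γ.toAdd i) 1)
      map_one' := Finset.prod_eq_one fun i _ => h1 i
      map_mul' := fun γ η => by
        rw [← Finset.prod_mul_distrib]
        refine Finset.prod_congr rfl fun i _ => ?_
        rw [← map_mul, AddMonoidAlgebra.single_mul_single, one_mul]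
        rfl }, fun i => AlgHom.ext fun q => ?_⟩
  induction q using AddMonoidAlgebra.induction_linear with
  | zero => rw [map_zero, map_zero]
  | add p q hp hq => rw [map_add, map_add, hp, hq]
  | single γ c =>
    rw [AlgHom.comp_apply, AddMonoidAlgebra.mapDomainAlgHom_apply, AddMonoidAlgebra.mapDomain_single,
      AddMonoidAlgebra.lift_single]
    change c • ∏ j, ψ j (AddMonoidAlgebra.single (Pi.single (M := fun _ => Γ) i γ j) 1) = _
    rw [Finset.prod_eq_single i, Pi.single_eq_same, ← map_smul, AddMonoidAlgebra.smul_single,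
      smul_eq_mul, mul_one]
    · intro j _ hj
      rw [Pi.single_eq_of_ne hj, h1]
    · intro hi
      exact absurd (Finset.mem_univ i) hi

variable {A : Type u} [CommRing A] [HopfAlgebra ℂ A]

/-- Evaluation at a point `χ` of `R` is a homomorphism from the group of `R`-points. -/
def evalPoint {R : Type*} [CommRing R] [Algebra ℂ R] (χ : R →ₐ[ℂ] ℂ) :
    WithConv (A →ₐ[ℂ] R) →* Points A where
  toFun Φ := WithConv.toConv (χ.comp Φ.ofConv)
  map_one' := WithConv.ext (AlgHom.ext fun _ => χ.commutes _)
  map_mul' Φ Ψ := WithConv.ext (AlgHom.comp_convMul_distrib χ Φ Ψ)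

variable [Algebra.FiniteType ℂ A]

/-- The group generated by `exp (Lie L)` contains a nonempty Zariski open subset of its Zariski
closure. The words in the exponentials of a basis of `Lie L` are parametrized by a dominant
morphism from the product of a torus and an affine space. -/
theorem exists_ne_zero_of_mem_zariskiClosure {L : Subgroup (Points A)} (hL : IsZariskiClosed L) :
    ∃ f : A, f ∉ vanishingIdeal (Subgroup.closure (expSet (lieAlg L))) ∧
      ∀ g ∈ zariskiClosure (Subgroup.closure (expSet (lieAlg L))), g f ≠ 0 →
        g ∈ Subgroup.closure (expSet (lieAlg L)) := by
  classical
  set M := Subgroup.closure (expSet (lieAlg L)) with hM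
  have := finite_tangent (A := A)
  obtain ⟨l, hl⟩ := exists_lieSubalgebra_eq_lieAlg L
  have hlmem : ∀ x, x ∈ l → x ∈ lieAlg L := fun x hx => by rw [← hl]; exact hx
  let b := Module.finBasis ℂ l.toSubmodule
  let k := Module.finrank ℂ l.toSubmodule
  let x : Fin k → tangent A := fun i => b i
  have hx : LinearIndependent ℂ x := b.linearIndependent.map' l.toSubmodule.subtype
    (Submodule.ker_subtype _)
  have hspan : Submodule.span ℂ (Set.range x) = l.toSubmodule := by
    have : Set.range x = l.toSubmodule.subtype '' Set.range b := by rw [← Set.range_comp]; rfl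
    rw [this, ← Submodule.map_span, b.span_eq, Submodule.map_top, Submodule.range_subtype]
  have hxL : ∀ i, x i ∈ lieAlg L := fun i => hlmem _ (b i).2
  choose s hs using fun i => exists_expPoly_lift (x i)
  let Λ : AddSubgroup ℂ := AddSubgroup.closure ((Finset.univ.biUnion s : Finset ℂ) : Set ℂ)
  have hΛ : Λ.FG := ⟨_, rfl⟩
  have : AddGroup.FG Λ := (AddGroup.fg_iff_addSubgroup_fg Λ).2 hΛ
  -- an ordering of the group of frequencies makes the algebra `R` below a domain
  have : TwoUniqueSums Λ :=
    TwoUniqueSums.of_injective_addHom Λ.subtype.toAddHom Subtype.val_injective inferInstance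
  choose Φ hΦ using fun i => hs i Λ fun μ hμ => AddSubgroup.subset_closure
    (Finset.mem_coe.2 (Finset.mem_biUnion.2 ⟨i, Finset.mem_univ i, hμ⟩))
  -- exponential polynomials in `k` variables, one for each factor of a word; `Ψ` is the generic word
  let R := AddMonoidAlgebra ℂ (Fin k → ℕ × Λ)
  let ι : Fin k → ExpPoly Λ →ₐ[ℂ] R := fun i =>
    AddMonoidAlgebra.mapDomainAlgHom ℂ ℂ (AddMonoidHom.single (fun _ => ℕ × Λ) i)
  let Ψ : WithConv (A →ₐ[ℂ] R) :=
    (List.ofFn fun i => WithConv.toConv ((ι i).comp (Φ i))).prod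
  have hΨ : ∀ χ : R →ₐ[ℂ] ℂ, WithConv.toConv (χ.comp Ψ.ofConv) =
      (List.ofFn fun i => (WithConv.toConv ((χ.comp (ι i)).comp (Φ i)) : Points A)).prod := by
    intro χ
    change evalPoint χ Ψ = _
    rw [map_list_prod, List.map_ofFn]
    rfl
  have hmem : ∀ χ : R →ₐ[ℂ] ℂ, WithConv.toConv (χ.comp Ψ.ofConv) ∈ M := by
    intro χ
    rw [hΨ]
    refine Subgroup.list_prod_mem _ fun g hg => ?_
    obtain ⟨i, rfl⟩ := (List.mem_ofFn' _ _).1 hg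
    exact comp_mem_closure_expSet hL (hxL i) hΛ (hΦ i) _
  have hker : ∀ f, Ψ.ofConv f = 0 → f ∈ vanishingIdeal M := by
    intro f hf
    rw [hM, ← hl]
    refine mem_vanishingIdeal_of_pointWord l hx hspan fun t => ?_
    obtain ⟨χ, hχ⟩ := exists_algHom_comp_mapDomain fun i =>
      expPolyEval (Λ := Λ) (t i) (t i • Λ.subtype)
    have h1 : WithConv.toConv (χ.comp Ψ.ofConv) = pointWord x t := by
      rw [hΨ, pointWord]
      congr 2
      funext i
      rw [hχ i]
      exact (isExp_expPolyEval (hΦ i) (t i)).unique (isExp_expPoint _)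
    rw [← h1]
    change χ (Ψ.ofConv f) = 0
    rw [hf, map_zero]
  let I : Ideal A := RingHom.ker Ψ.ofConv
  let φ : A ⧸ I →ₐ[ℂ] R := Ideal.kerLiftAlg Ψ.ofConv
  have hφ : Function.Injective φ := Ideal.kerLiftAlg_injective Ψ.ofConv
  have hRdom : IsDomain R := NoZeroDivisors.to_isDomain R
  have hIdom : IsDomain (A ⧸ I) := hφ.isDomain φ.toRingHom
  have hIfin : Algebra.FiniteType ℂ (A ⧸ I) :=
    Algebra.FiniteType.of_surjective (Ideal.Quotient.mkₐ ℂ I) (Ideal.Quotient.mkₐ_surjective ℂ I)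
  obtain ⟨r, hr, hext⟩ := exists_extension_of_injective hφ
  obtain ⟨f, rfl⟩ := Ideal.Quotient.mkₐ_surjective ℂ I r
  refine ⟨f, fun hf => ?_, fun g hg hgf => ?_⟩
  · have h1 : Ψ.ofConv f ≠ 0 := fun h0 => hr (hφ (by rw [map_zero]; exact h0))
    obtain ⟨χ, hχ⟩ := exists_algHom_apply_ne_zero h1
    exact hχ (hf _ (hmem χ))
  · obtain ⟨χ, hχ⟩ := hext (Ideal.Quotient.liftₐ I g.ofConv fun a ha => hg a (hker a ha)) hgf
    have h1 : g = WithConv.toConv (χ.comp Ψ.ofConv) :=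
      WithConv.ext (AlgHom.ext fun a =>
        (AlgHom.congr_fun hχ (Ideal.Quotient.mk I a)).symm)
    rw [h1]
    exact hmem χ

/-- The group generated by `exp (Lie L)` is Zariski closed if `L` is: a subgroup that contains a
nonempty Zariski open subset of its Zariski closure is Zariski closed. -/
theorem isZariskiClosed_closure_expSet_lieAlg {L : Subgroup (Points A)} (hL : IsZariskiClosed L) :
    IsZariskiClosed (Subgroup.closure (expSet (lieAlg L))) := by
  obtain ⟨f, hf, hopen⟩ := exists_ne_zero_of_mem_zariskiClosure hL
  set M := Subgroup.closure (expSet (lieAlg L))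
  intro g hg
  replace hg : g ∈ zariskiClosure M := hg
  have h1 : rightTr (pointFun g) f ∉ vanishingIdeal M := by
    intro h
    refine hf fun h' hh' => ?_
    have h2 := Subgroup.mul_mem _ (le_zariskiClosure M hh') (Subgroup.inv_mem _ hg) _ h
    rwa [← points_mul_apply_rightTr, inv_mul_cancel_right] at h2
  obtain ⟨h, hh, hne⟩ : ∃ h ∈ M, h (rightTr (pointFun g) f) ≠ 0 := by
    by_contra! h2
    exact h1 h2
  rw [← points_mul_apply_rightTr] at hne
  have h3 := hopen _ (Subgroup.mul_mem _ (le_zariskiClosure M hh) hg) hne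
  have h4 := M.mul_mem (M.inv_mem hh) h3
  rwa [inv_mul_cancel_left] at h4

end AlgebraicHull

/-! ### Complementary duals -/

section ComplementaryDual

variable {A : Type u} [CommRing A] [HopfAlgebra ℂ A]
variable {B : Type v} [CommRing B] [HopfAlgebra ℂ B]
variable {p : tangent A →ₗ[ℂ] tangent B →ₗ[ℂ] ℂ}

theorem smul_mem_orthogonal {S : Set (tangent A)} (c : ℂ) (ξ : tangent B)
    (hξ : ξ ∈ orthogonal p S) : c • ξ ∈ orthogonal p S :=
  (orthogonalSubmodule p S).smul_mem c hξ

/-- A connected Lie subgroup is determined by its Lie algebra. -/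
theorem isComplementaryDual_iff {C : Subgroup (Points A)} {M : Subgroup (Points B)}
    (hM : IsComplementaryDual p C M) (L : Subgroup (Points B)) :
    IsComplementaryDual p C L ↔ L = M := by
  refine ⟨fun hL => ?_, fun h => h ▸ hM⟩
  rw [← hL.1.generated, hL.2, ← hM.2, hM.1.generated]

theorem isConnected_perpGroup (K : Subgroup (Points A)) :
    IsConnected (perpGroup p K : Set (Points B)) :=
  isConnected_closure_expSet smul_mem_orthogonal

variable [Algebra.FiniteType ℂ B]

theorem lieAlg_perpGroup (K : Subgroup (Points A)) :
    lieAlg (perpGroup p K) =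
      (LieSubalgebra.lieSpan ℂ (tangent B) (orthogonal p (lieAlg K)) : Set (tangent B)) :=
  lieAlg_closure_expSet smul_mem_orthogonal

variable [Algebra.FiniteType ℂ A]
variable {P : PoissonStructure A} {Q : PoissonStructure B}

theorem IsPoissonDual.isLieCoideal_orthogonal_lieAlg (hp : IsPoissonDual P Q p)
    (K : Subgroup (Points A)) : Q.IsLieCoideal (orthogonal p (lieAlg K)) := by
  obtain ⟨l, hl⟩ := exists_lieSubalgebra_eq_lieAlg K
  rw [← hl]
  exact hp.isLieCoideal_orthogonal l

theorem IsPoissonDual.isLieCoideal_lieAlg_perpGroup (hp : IsPoissonDual P Q p)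
    (K : Subgroup (Points A)) : Q.IsLieCoideal (lieAlg (perpGroup p K)) := by
  rw [lieAlg_perpGroup]
  exact Q.isLieCoideal_lieSpan (V := orthogonalSubmodule p (lieAlg K))
    (hp.isLieCoideal_orthogonal_lieAlg K)

theorem IsPoissonDual.isCoisotropic_perpGroup (hp : IsPoissonDual P Q p)
    (K : Subgroup (Points A)) : Q.IsCoisotropic (perpGroup p K) :=
  Q.isCoisotropic_closure_expSet (V := orthogonalSubmodule p (lieAlg K))
    (hp.isLieCoideal_orthogonal_lieAlg K)

theorem IsPoissonDual.orthogonal_orthogonal_lieAlg (hp : IsPoissonDual P Q p)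
    (K : Subgroup (Points A)) : orthogonal p.flip (orthogonal p (lieAlg K)) = lieAlg K := by
  obtain ⟨l, hl⟩ := exists_lieSubalgebra_eq_lieAlg K
  rw [← hl]
  exact hp.orthogonal_orthogonal l.toSubmodule

/-- The orthogonal of a Lie coideal is already a Lie algebra. -/
theorem IsPoissonDual.lieSpan_orthogonal (hp : IsPoissonDual P Q p) {S : Set (tangent A)}
    (hS : P.IsLieCoideal S) :
    (LieSubalgebra.lieSpan ℂ (tangent B) (orthogonal p S) : Set (tangent B)) = orthogonal p S :=
  subset_antisymm
    (LieSubalgebra.lieSpan_le.2 subset_rfl :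
      LieSubalgebra.lieSpan ℂ (tangent B) (orthogonal p S) ≤ hp.orthogonalLie hS)
    LieSubalgebra.subset_lieSpan

/-- The Lie algebra of the double dual of `K` is the orthogonal of the Lie algebra
of the dual. -/
theorem IsPoissonDual.lieAlg_perpGroup_perpGroup (hp : IsPoissonDual P Q p)
    (K : Subgroup (Points A)) :
    lieAlg (perpGroup p.flip (perpGroup p K)) = orthogonal p.flip (lieAlg (perpGroup p K)) := by
  rw [lieAlg_perpGroup]
  exact hp.symm.lieSpan_orthogonal (hp.isLieCoideal_lieAlg_perpGroup K)

/-- If the Lie algebra of a subgroup is a Lie coideal contained in `Lie K`, then it is orthogonal to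
the Lie algebra of the dual of `K`. Hence the Lie algebra of the double dual is the largest one with
this property. -/
theorem IsPoissonDual.subset_orthogonal_lieAlg_perpGroup (hp : IsPoissonDual P Q p)
    {K L : Subgroup (Points A)} (hL : P.IsLieCoideal (lieAlg L)) (hLK : lieAlg L ⊆ lieAlg K) :
    lieAlg L ⊆ orthogonal p.flip (lieAlg (perpGroup p K)) := by
  rw [← hp.orthogonal_orthogonal_lieAlg L, lieAlg_perpGroup]
  refine orthogonal_anti (LieSubalgebra.lieSpan_le (K := hp.orthogonalLie hL).2 ?_)
  exact orthogonal_anti hLK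

variable {K : Subgroup (Points A)}

theorem IsPoissonDual.perpGroup_perpGroup_le (hp : IsPoissonDual P Q p) :
    perpGroup p.flip (perpGroup p K) ≤ K := by
  refine (Subgroup.closure_mono (expSet_mono ?_)).trans (closure_expSet_lieAlg_le K)
  rw [← hp.orthogonal_orthogonal_lieAlg K, lieAlg_perpGroup]
  exact orthogonal_anti LieSubalgebra.subset_lieSpan

/-- The double dual of `K` is Zariski closed: the Lie algebra of its Zariski closure is a Lie
coideal contained in `Lie K`, hence not larger than that of the double dual. -/
theorem IsPoissonDual.isZariskiClosed_perpGroup_perpGroup (hp : IsPoissonDual P Q p)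
    (hK : IsZariskiClosed K) : IsZariskiClosed (perpGroup p.flip (perpGroup p K)) := by
  set K₀ := perpGroup p.flip (perpGroup p K) with hK₀
  have hL := isZariskiClosed_zariskiClosure K₀
  have hco : P.IsCoisotropic (zariskiClosure K₀) := by
    have := hp.symm.isCoisotropic_perpGroup (perpGroup p K)
    unfold PoissonStructure.IsCoisotropic at this ⊢
    rwa [vanishingIdeal_zariskiClosure]
  have h1 : lieAlg (zariskiClosure K₀) = lieAlg K₀ := by
    refine subset_antisymm ?_ (lieAlg_mono (le_zariskiClosure K₀))
    rw [hK₀, hp.lieAlg_perpGroup_perpGroup K]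
    exact hp.subset_orthogonal_lieAlg_perpGroup (hco.isLieCoideal hL)
      (lieAlg_mono (zariskiClosure_le hK hp.perpGroup_perpGroup_le))
  have h2 := isZariskiClosed_closure_expSet_lieAlg hL
  rw [h1] at h2
  have h3 : Subgroup.closure (expSet (lieAlg K₀)) = K₀ :=
    (isConnectedLieSubgroup_closure_expSet smul_mem_orthogonal).generated
  rwa [h3] at h2

/-- The double dual of `K` is the largest connected Zariski closed coisotropic subgroup of `K`: such a
subgroup is generated by the exponentials of its Lie algebra, which is a Lie coideal. -/
theorem IsPoissonDual.isCoisotropicInterior_perpGroup_perpGroup (hp : IsPoissonDual P Q p)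
    (hK : IsZariskiClosed K) :
    P.IsCoisotropicInterior K (perpGroup p.flip (perpGroup p K)) := by
  refine ⟨⟨hp.isZariskiClosed_perpGroup_perpGroup hK, isConnected_perpGroup _,
    hp.symm.isCoisotropic_perpGroup _, hp.perpGroup_perpGroup_le⟩, ?_⟩
  rintro L ⟨hL, hLc, hLco, hLK⟩
  rw [← closure_expSet_lieAlg_eq hL hLc]
  exact Subgroup.closure_mono (expSet_mono
    (hp.subset_orthogonal_lieAlg_perpGroup (hLco.isLieCoideal hL) (lieAlg_mono hLK)))

theorem IsPoissonDual.isComplementaryDual_perpGroup_perpGroup (hp : IsPoissonDual P Q p) :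
    IsComplementaryDual p (perpGroup p.flip (perpGroup p K)) (perpGroup p K) := by
  refine ⟨isConnectedLieSubgroup_closure_expSet smul_mem_orthogonal, ?_⟩
  rw [hp.lieAlg_perpGroup_perpGroup]
  exact (hp.symm.orthogonal_orthogonal_lieAlg _).symm

theorem IsPoissonDual.lieAlg_perpGroup_of_isCoisotropic (hp : IsPoissonDual P Q p)
    (hK : IsZariskiClosed K) (hco : P.IsCoisotropic K) :
    lieAlg (perpGroup p K) = orthogonal p (lieAlg K) := by
  rw [lieAlg_perpGroup, hp.lieSpan_orthogonal (hco.isLieCoideal hK)]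

theorem IsPoissonDual.perpGroup_perpGroup_of_isCoisotropic (hp : IsPoissonDual P Q p)
    (hK : IsZariskiClosed K) (hco : P.IsCoisotropic K) :
    perpGroup p.flip (perpGroup p K) = Subgroup.closure (expSet (lieAlg K)) := by
  rw [perpGroup, hp.lieAlg_perpGroup_of_isCoisotropic hK hco, hp.orthogonal_orthogonal_lieAlg]

end ComplementaryDual

end PoissonGroup

end

theorem mainTheorem12
    {A : Type*} [CommRing A] [IsDomain A] [HopfAlgebra ℂ A] [Algebra.FiniteType ℂ A]
    {B : Type*} [CommRing B] [IsDomain B] [HopfAlgebra ℂ B] [Algebra.FiniteType ℂ B]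
    (P : PoissonGroup.PoissonStructure A) (Q : PoissonGroup.PoissonStructure B)
    (p : PoissonGroup.tangent A →ₗ[ℂ] PoissonGroup.tangent B →ₗ[ℂ] ℂ)
    (hp : PoissonGroup.IsPoissonDual P Q p)
    (K : Subgroup (PoissonGroup.Points A)) (hK : PoissonGroup.IsZariskiClosed K) :
    -- the Lie algebra of `K^⟨⊥⟩` is the Lie subalgebra generated by `𝔨^⊥`
    PoissonGroup.lieAlg (PoissonGroup.perpGroup p K) =
      (LieSubalgebra.lieSpan ℂ (PoissonGroup.tangent B)
        (PoissonGroup.orthogonal p (PoissonGroup.lieAlg K)) : Set (PoissonGroup.tangent B)) ∧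
    -- it is a Lie coideal, and `K^⟨⊥⟩` is coisotropic
    Q.IsLieCoideal (PoissonGroup.lieAlg (PoissonGroup.perpGroup p K)) ∧
    Q.IsCoisotropic (PoissonGroup.perpGroup p K) ∧
    -- if `K` is coisotropic, then `K^⟨⊥⟩ = K^⊥`
    (P.IsCoisotropic K → ∀ L : Subgroup (PoissonGroup.Points B),
      PoissonGroup.IsComplementaryDual p K L ↔ L = PoissonGroup.perpGroup p K) ∧
    (∃ K₀ : Subgroup (PoissonGroup.Points A), P.IsCoisotropicInterior K K₀ ∧
      -- `K^⟨⊥⟩` is the complementary dual of the coisotropic interior `K₀` of `K`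
      (∀ L : Subgroup (PoissonGroup.Points B),
        PoissonGroup.IsComplementaryDual p K₀ L ↔ L = PoissonGroup.perpGroup p K) ∧
      -- `(K^⟨⊥⟩)^⟨⊥⟩` is the coisotropic interior of `K`
      PoissonGroup.perpGroup p.flip (PoissonGroup.perpGroup p K) = K₀) ∧
    -- if `K` is coisotropic, then `(K^⟨⊥⟩)^⟨⊥⟩` is the identity component of `K`
    (P.IsCoisotropic K →
      (PoissonGroup.perpGroup p.flip (PoissonGroup.perpGroup p K) : Set (PoissonGroup.Points A)) =
        connectedComponentIn (K : Set (PoissonGroup.Points A)) 1) ∧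
    -- `(K^⟨⊥⟩)^⟨⊥⟩ = K` if and only if `K` is coisotropic and connected
    (PoissonGroup.perpGroup p.flip (PoissonGroup.perpGroup p K) = K ↔
      P.IsCoisotropic K ∧ IsConnected (K : Set (PoissonGroup.Points A))) := by

  refine ⟨PoissonGroup.lieAlg_perpGroup K, hp.isLieCoideal_lieAlg_perpGroup K,
    hp.isCoisotropic_perpGroup K, fun hco => ?_,
    ⟨_, hp.isCoisotropicInterior_perpGroup_perpGroup hK,
      PoissonGroup.isComplementaryDual_iff hp.isComplementaryDual_perpGroup_perpGroup, rfl⟩,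
    fun hco => ?_, fun h => ?_, fun ⟨hco, hc⟩ => ?_⟩
  · exact PoissonGroup.isComplementaryDual_iff
      ⟨PoissonGroup.isConnectedLieSubgroup_closure_expSet PoissonGroup.smul_mem_orthogonal,
        hp.lieAlg_perpGroup_of_isCoisotropic hK hco⟩
  · rw [hp.perpGroup_perpGroup_of_isCoisotropic hK hco,
      PoissonGroup.closure_expSet_lieAlg_eq_component hK]
  · rw [← h]
    exact ⟨hp.symm.isCoisotropic_perpGroup _, PoissonGroup.isConnected_perpGroup _⟩
  · rw [hp.perpGroup_perpGroup_of_isCoisotropic hK hco,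
      PoissonGroup.closure_expSet_lieAlg_eq hK hc]
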